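/- Let $\Omega=(0,1)^2$, let $0=x_0<\dots<x_n=1$ and $0=y_0<\dots<y_m=1$, and let $\mathcal T_h$ be the partition of $\Omega$ into the rectangles $T=[x_{i-1},x_i]\times[y_{j-1},y_j]$, with mesh size $h=\max_T \operatorname{diam} T$. The left, right, bottom and top edges of $T$ are denoted by $e_1,e_2,e_3,e_4$, and $|e|$ is the length of the edge $e$. Let $a$ be a symmetric $2\times2$ coefficient matrix that is constant on each element and satisfies $\lambda|\xi|^2\le a\xi\cdot\xi\le\Lambda|\xi|^2$ for all $\xi\in\mathbb R^2$, with $\lambda>0$. Let $f\in L^2(\Omega)$, and let $u\in H^3(\Omega)$ be a weak solution of $-\nabla\cdot(a\nabla u)=f$ in $\Omega$, $u=g$ on $\partial\Omega$ (in the sense of traces). Put $\mathbf q=(q_1,q_2)=a\nabla u$ (elementwise), and let $Q_b$ be the average over an edge (of the trace). *Weak Galerkin scheme.* Let $V_h$ be the space of all $v=\{v_0,v_b\}$ with $v_0|_T\in P_1(T)$ on each element and $v_b$ a single constant on each edge of the mesh; $V_b$ is the space of the edge components $v_b$, and $V_h^0=\{v\in V_h: v_b|_{\partial\Omega}=0\}$.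 The discrete weak gradient $\nabla_d v\in[P_0(T)]^2$ is defined on each $T$ by $(\nabla_d v,\psi)_T=-(v_0,\nabla\cdot\psi)_T+\langle v_b,\psi\cdot\mathbf n\rangle_{\partial T}$ for all $\psi\in[P_0(T)]^2$; it depends only on $v_b$. Given $\rho>0$, let $$s(w,v)=\rho h^{-1}\sum_T\langle w_b-Q_bw_0,\,v_b-Q_bv_0\rangle_{\partial T}.$$ For edgewise constant $v_b$, let $\mathcal S(v_b)\in P_1(T)$ be defined on each $T$ by $\langle\mathcal S(v_b),Q_b\phi\rangle_{\partial T}=\langle v_b,\phi\rangle_{\partial T}$ for all $\phi\in P_1(T)$, and let $$|||\mathcal S(v_b)-v_b|||^2=\rho h^{-1}\sum_T\|Q_b\mathcal S(v_b)-v_b\|^2_{L^2(\partial T)}.$$ *Correction.* Suppose that $w_b\in V_b$ is given on each element $T$ by $$w_b=\tfrac1{12}|e_s|\rho^{-1}h^{-1}\bigl(\rho h^{-1}|e_s|\,Q_b(u_{yy})|_{e_s}-6\,Q_b(q_{2y})|_{e_s}\bigr)\ \text{ on } e_s,\ s=1,2,$$ $$w_b=\tfrac1{12}|e_s|\rho^{-1}h^{-1}\bigl(\rho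 h^{-1}|e_s|\,Q_b(u_{xx})|_{e_s}-6\,Q_b(q_{1x})|_{e_s}\bigr)\ \text{ on } e_s,\ s=3,4,$$ where the traces of $q_{2y}$ and $q_{1x}$ are taken from within $T$, and the values obtained on an interior edge from its two adjacent elements coincide, as $w_b\in V_b$ requires (this is automatic where $a$ does not jump across the edge). Let $u_h=\{u_0,u_b\}\in V_h$ satisfy $u_b=Q_bg+h^2w_b$ on $\partial\Omega$ and $$\sum_T(a\nabla_du_h,\nabla_dv)_T+s(u_h,v)=(f,v_0)\qquad\text{for all } v\in V_h^0,$$ and let $\widetilde e_b=(Q_bu+h^2w_b)-u_b$. Then $$\Bigl(\sum_T\|\nabla_d\widetilde e_b\|_T^2\Bigr)^{1/2}+|||\mathcal S(\widetilde e_b)-\widetilde e_b|||\le C\,h^2\,\|u\|_{3},$$ where $\|\cdot\|_3$ is the norm of $H^3(\Omega)$ and the constant $C$ depends only on $\rho,\lambda,\Lambda$ (not on the mesh, $a$, $f$, $g$ or $u$). -/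

import Mathlib

open MeasureTheory Filter Topology
open scoped ContDiff

noncomputable section

namespace WG

/-! ### Sobolev spaces on open subsets of the plane -/

/-- The classical partial derivative in `x`. -/
def dx (φ : ℝ × ℝ → ℝ) : ℝ × ℝ → ℝ := fun p => fderiv ℝ φ p (1, 0)

/-- The classical partial derivative in `y`. -/
def dy (φ : ℝ × ℝ → ℝ) : ℝ × ℝ → ℝ := fun p => fderiv ℝ φ p (0, 1)

/-- Test functions on `U`: smooth functions with compact support contained in `U`. -/
def IsTest (U : Set (ℝ × ℝ)) (φ : ℝ × ℝ → ℝ) : Prop :=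
  ContDiff ℝ ∞ φ ∧ HasCompactSupport φ ∧ tsupport φ ⊆ U

/-- `d ∈ L²(U)` is the weak derivative `∂_x^α ∂_y^β v` in `U`. -/
def IsWeakDeriv (U : Set (ℝ × ℝ)) (α β : ℕ) (v d : ℝ × ℝ → ℝ) : Prop :=
  MemLp d 2 (volume.restrict U) ∧
    ∀ φ, IsTest U φ →
      ∫ p in U, v p * (dx^[α]) ((dy^[β]) φ) p = (-1) ^ (α + β) * ∫ p in U, d p * φ p

/-- The Sobolev space `H^s(U)`. -/
def MemH (s : ℕ) (U : Set (ℝ × ℝ)) (v : ℝ × ℝ → ℝ) : Prop :=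
  MemLp v 2 (volume.restrict U) ∧ ∀ α β, α + β ≤ s → ∃ d, IsWeakDeriv U α β v d

open Classical in
/-- The weak derivative `∂_x^α ∂_y^β v` in `U` (unique up to null sets; zero if there is none). -/
def weakDeriv (U : Set (ℝ × ℝ)) (α β : ℕ) (v : ℝ × ℝ → ℝ) : ℝ × ℝ → ℝ :=
  if h : ∃ d, IsWeakDeriv U α β v d then h.choose else 0

/-- The norm `‖v‖_{s,U}` of `H^s(U)`. -/
def sobolevNorm (s : ℕ) (U : Set (ℝ × ℝ)) (v : ℝ × ℝ → ℝ) : ℝ :=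
  Real.sqrt (∑ α ∈ Finset.range (s + 1), ∑ β ∈ Finset.range (s + 1 - α),
    ∫ p in U, (weakDeriv U α β v p) ^ 2)

/-! ### Axis-parallel segments and traces -/

/-- The segment `{c} × [lo, hi]` (if `vertical`) or `[lo, hi] × {c}` (otherwise). -/
structure Seg where
  vertical : Bool
  c : ℝ
  lo : ℝ
  hi : ℝ

/-- Arc length parametrization, on `[lo, hi]`. -/
def Seg.pt (e : Seg) (τ : ℝ) : ℝ × ℝ := if e.vertical then (e.c, τ) else (τ, e.c)

def Seg.len (e : Seg) : ℝ := e.hi - e.lo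

/-- The line integral of `g` over the segment. -/
def Seg.int (e : Seg) (g : ℝ × ℝ → ℝ) : ℝ := ∫ τ in e.lo..e.hi, g (e.pt τ)

/-- The average of `g` over the segment, i.e. the `L²` projection onto constants. -/
def Seg.mean (e : Seg) (g : ℝ × ℝ → ℝ) : ℝ := e.int g / e.len

/-- `g` (only its values on `e` matter) is the trace on the segment `e ⊆ closure U` of the function
`v ∈ H¹(U)`: some functions that are smooth up to the boundary converge to `v` in `H¹(U)` while
their restrictions to `e` converge to `g` in `L²(e)`. -/
def IsTrace (U : Set (ℝ × ℝ)) (e : Seg) (v g : ℝ × ℝ → ℝ) : Prop :=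
  MemH 1 U v ∧ MemLp (fun τ => g (e.pt τ)) 2 (volume.restrict (Set.Ioc e.lo e.hi)) ∧
    ∃ φ : ℕ → ℝ × ℝ → ℝ, (∀ k, ContDiff ℝ ∞ (φ k)) ∧
      Tendsto (fun k => eLpNorm (φ k - v) 2 (volume.restrict U)) atTop (𝓝 0) ∧
      Tendsto (fun k => eLpNorm (dx (φ k) - weakDeriv U 1 0 v) 2 (volume.restrict U))
        atTop (𝓝 0) ∧
      Tendsto (fun k => eLpNorm (dy (φ k) - weakDeriv U 0 1 v) 2 (volume.restrict U))
        atTop (𝓝 0) ∧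
      Tendsto (fun k => eLpNorm (fun τ => φ k (e.pt τ) - g (e.pt τ)) 2
        (volume.restrict (Set.Ioc e.lo e.hi))) atTop (𝓝 0)

/-- `r` is the average over `e` of the trace of `v ∈ H¹(U)`, i.e. `Q_b v = r` on `e`. -/
def HasTraceMean (U : Set (ℝ × ℝ)) (e : Seg) (v : ℝ × ℝ → ℝ) (r : ℝ) : Prop :=
  ∃ g, IsTrace U e v g ∧ r = e.mean g

/-! ### Tensor product meshes of the unit square -/

/-- The domain `Ω = (0,1)²`. -/
def Omega : Set (ℝ × ℝ) := Set.Ioo 0 1 ×ˢ Set.Ioo 0 1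

/-- The four sides of `Ω`. -/
def side : Fin 4 → Seg :=
  ![⟨true, 0, 0, 1⟩, ⟨true, 1, 0, 1⟩, ⟨false, 0, 0, 1⟩, ⟨false, 1, 0, 1⟩]

/-- Two partitions `0 = x₀ < ⋯ < x_n = 1` and `0 = y₀ < ⋯ < y_m = 1` of the unit interval. -/
structure Mesh where
  n : ℕ
  m : ℕ
  x : Fin (n + 1) → ℝ
  y : Fin (m + 1) → ℝ
  x_mono : StrictMono x
  y_mono : StrictMono y
  x_zero : x 0 = 0
  x_last : x (Fin.last n) = 1
  y_zero : y 0 = 0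
  y_last : y (Fin.last m) = 1

namespace Mesh

variable (M : Mesh)

/-- The pair `(i, j)` stands for the element `[x_i, x_{i+1}] × [y_j, y_{j+1}]`. -/
abbrev Elem : Type := Fin M.n × Fin M.m

/-- The vertical edges `{x_i} × [y_j, y_{j+1}]` and the horizontal edges
`[x_i, x_{i+1}] × {y_j}`. -/
abbrev Edge : Type := (Fin (M.n + 1) × Fin M.m) ⊕ (Fin M.n × Fin (M.m + 1))

variable {M}

/-- The interior of an element. -/
def interior (T : M.Elem) : Set (ℝ × ℝ) :=
  Set.Ioo (M.x T.1.castSucc) (M.x T.1.succ) ×ˢ Set.Ioo (M.y T.2.castSucc) (M.y T.2.succ)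

def hx (T : M.Elem) : ℝ := M.x T.1.succ - M.x T.1.castSucc

def hy (T : M.Elem) : ℝ := M.y T.2.succ - M.y T.2.castSucc

def area (T : M.Elem) : ℝ := hx T * hy T

def seg : M.Edge → Seg
  | .inl e => ⟨true, M.x e.1, M.y e.2.castSucc, M.y e.2.succ⟩
  | .inr e => ⟨false, M.y e.2, M.x e.1.castSucc, M.x e.1.succ⟩

/-- The edges `e₁` (left), `e₂` (right), `e₃` (bottom), `e₄` (top) of an element. -/
def edge (T : M.Elem) : Fin 4 → M.Edge :=
  ![.inl (T.1.castSucc, T.2), .inl (T.1.succ, T.2),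
    .inr (T.1, T.2.castSucc), .inr (T.1, T.2.succ)]

/-- The edge lies on `∂Ω`. -/
def IsBdry : M.Edge → Prop
  | .inl e => e.1 = 0 ∨ e.1 = Fin.last M.n
  | .inr e => e.2 = 0 ∨ e.2 = Fin.last M.m

variable (M)

/-- The mesh size: the largest diameter of an element. -/
def h : ℝ := ⨆ T : M.Elem, Real.sqrt (hx T ^ 2 + hy T ^ 2)

end Mesh

/-- The outward unit normals on `e₁, e₂, e₃, e₄`. -/
def normal : Fin 4 → Fin 2 → ℝ := ![![-1, 0], ![1, 0], ![0, -1], ![0, 1]]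

/-! ### The lowest order weak Galerkin scheme -/

open Mesh

/-- The polynomial `c₀ + c₁ x + c₂ y`. -/
def affine (c : Fin 3 → ℝ) (p : ℝ × ℝ) : ℝ := c 0 + c 1 * p.1 + c 2 * p.2

/-- The space `V_h` for `k = 1`: a linear polynomial on each element (given by its coefficients)
and a constant on each edge. -/
structure WeakFun (M : Mesh) where
  v0 : M.Elem → Fin 3 → ℝ
  vb : M.Edge → ℝ

variable {M : Mesh}

/-- The discrete weak gradient on the element `T`; it is constant there, and characterized by
`weakGrad_iff`. It does not depend on the interior component. -/
def weakGrad (vb : M.Edge → ℝ) (T : M.Elem) : Fin 2 → ℝ :=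
  ![(vb (edge T 1) - vb (edge T 0)) / hx T, (vb (edge T 3) - vb (edge T 2)) / hy T]

/-- The extension `S(v_b)` on `T` (coefficients of a linear polynomial), characterized by
`extS_iff`. -/
def extS (vb : M.Edge → ℝ) (T : M.Elem) : Fin 3 → ℝ :=
  let G := weakGrad vb T
  ![(hy T * (vb (edge T 0) + vb (edge T 1)) + hx T * (vb (edge T 2) + vb (edge T 3)))
        / (2 * (hx T + hy T))
      - G 0 * ((M.x T.1.castSucc + M.x T.1.succ) / 2)
      - G 1 * ((M.y T.2.castSucc + M.y T.2.succ) / 2), G 0, G 1]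

/-- The bilinear form `(a ∇_d w, ∇_d v)_h`, for `a` constant on each element. -/
def gradForm (a : M.Elem → Matrix (Fin 2) (Fin 2) ℝ) (wb vb : M.Edge → ℝ) : ℝ :=
  ∑ T : M.Elem, area T * ((a T).mulVec (weakGrad wb T) ⬝ᵥ weakGrad vb T)

/-- The stabilizer `s(w, v) = ρ h⁻¹ ∑_T ⟨w_b - Q_b w₀, v_b - Q_b v₀⟩_{∂T}`. -/
def stab (ρ : ℝ) (w v : WeakFun M) : ℝ :=
  ρ * M.h⁻¹ * ∑ T : M.Elem, ∑ s : Fin 4, (seg (edge T s)).len *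
    ((w.vb (edge T s) - (seg (edge T s)).mean (affine (w.v0 T))) *
      (v.vb (edge T s) - (seg (edge T s)).mean (affine (v.v0 T))))

/-- `uh` solves the weak Galerkin scheme with right-hand side `f` and boundary values `gb`. -/
def IsWGSolution (ρ : ℝ) (a : M.Elem → Matrix (Fin 2) (Fin 2) ℝ) (f : ℝ × ℝ → ℝ)
    (gb : M.Edge → ℝ) (uh : WeakFun M) : Prop :=
  (∀ e, IsBdry e → uh.vb e = gb e) ∧
    ∀ v : WeakFun M, (∀ e, IsBdry e → v.vb e = 0) →
      gradForm a uh.vb v.vb + stab ρ uh v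
        = ∑ T : M.Elem, ∫ p in interior T, f p * affine (v.v0 T) p

/-- The norm `‖∇_d v_b‖`. -/
def gradNorm (vb : M.Edge → ℝ) : ℝ :=
  Real.sqrt (∑ T : M.Elem, area T * (weakGrad vb T ⬝ᵥ weakGrad vb T))

/-- The quantity `|||S(v_b) - v_b|||`. -/
def stabNorm (ρ : ℝ) (vb : M.Edge → ℝ) : ℝ :=
  Real.sqrt (ρ * M.h⁻¹ * ∑ T : M.Elem, ∑ s : Fin 4, (seg (edge T s)).len *
    ((seg (edge T s)).mean (affine (extS vb T)) - vb (edge T s)) ^ 2)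

/-! ### The boundary value problem and the correction -/

/-- A symmetric coefficient tensor, constant on each element, with spectrum in `[lam, Lam]`. -/
def IsCoeff (lam Lam : ℝ) (a : M.Elem → Matrix (Fin 2) (Fin 2) ℝ) : Prop :=
  ∀ T, (a T).IsSymm ∧ ∀ ξ : Fin 2 → ℝ,
    lam * (ξ ⬝ᵥ ξ) ≤ (a T).mulVec ξ ⬝ᵥ ξ ∧ (a T).mulVec ξ ⬝ᵥ ξ ≤ Lam * (ξ ⬝ᵥ ξ)

/-- The component `q_{k+1}` of the flux `q = a ∇u` on the element `T`. -/
def flux (a : M.Elem → Matrix (Fin 2) (Fin 2) ℝ) (u : ℝ × ℝ → ℝ) (T : M.Elem) (k : Fin 2) :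
    ℝ × ℝ → ℝ :=
  fun p => a T k 0 * weakDeriv Omega 1 0 u p + a T k 1 * weakDeriv Omega 0 1 u p

/-- `-∇·(a∇u) = f` in `Ω` in the sense of distributions, and `u = g` on `∂Ω` in the sense of
traces. -/
def IsSolution (a : M.Elem → Matrix (Fin 2) (Fin 2) ℝ) (f g u : ℝ × ℝ → ℝ) : Prop :=
  (∀ φ, IsTest Omega φ →
    ∑ T : M.Elem, ∫ p in interior T, (flux a u T 0 p * dx φ p + flux a u T 1 p * dy φ p)
      = ∫ p in Omega, f p * φ p) ∧
  ∀ s, IsTrace Omega (side s) u g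

/-- `w ∈ V_b` is given on every element by the formulas that define the correction; the traces are
taken from within the element. -/
def IsCorrection (ρ : ℝ) (a : M.Elem → Matrix (Fin 2) (Fin 2) ℝ) (u : ℝ × ℝ → ℝ)
    (w : M.Edge → ℝ) : Prop :=
  ∀ T : M.Elem,
    (∀ s : Fin 4, s = 0 ∨ s = 1 → ∃ r t : ℝ,
      HasTraceMean (interior T) (seg (edge T s)) (weakDeriv Omega 0 2 u) r ∧
      HasTraceMean (interior T) (seg (edge T s)) (weakDeriv (interior T) 0 1 (flux a u T 1)) t ∧
      w (edge T s) = 1 / 12 * (seg (edge T s)).len * ρ⁻¹ * M.h⁻¹ *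
        (ρ * M.h⁻¹ * (seg (edge T s)).len * r - 6 * t)) ∧
    (∀ s : Fin 4, s = 2 ∨ s = 3 → ∃ r t : ℝ,
      HasTraceMean (interior T) (seg (edge T s)) (weakDeriv Omega 2 0 u) r ∧
      HasTraceMean (interior T) (seg (edge T s)) (weakDeriv (interior T) 1 0 (flux a u T 0)) t ∧
      w (edge T s) = 1 / 12 * (seg (edge T s)).len * ρ⁻¹ * M.h⁻¹ *
        (ρ * M.h⁻¹ * (seg (edge T s)).len * r - 6 * t))

/-- `Qu = Q_b u`: on each edge the average of the trace of `u ∈ H¹(Ω)`. -/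
def IsEdgeProjection (u : ℝ × ℝ → ℝ) (Qu : M.Edge → ℝ) : Prop :=
  ∀ e, HasTraceMean Omega (seg e) u (Qu e)

/-! ### The defining properties of the discrete weak gradient and of the extension -/

theorem hx_pos (T : M.Elem) : 0 < hx T := sub_pos.2 (M.x_mono Fin.castSucc_lt_succ)

theorem hy_pos (T : M.Elem) : 0 < hy T := sub_pos.2 (M.y_mono Fin.castSucc_lt_succ)

/-- `(∇_d v, ψ)_T = ⟨v_b, ψ·n⟩_{∂T}` for all constant `ψ` (whose divergence is zero). -/
theorem weakGrad_iff (vb : M.Edge → ℝ) (T : M.Elem) (G : Fin 2 → ℝ) :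
    (∀ ψ : Fin 2 → ℝ, area T * (G ⬝ᵥ ψ)
      = ∑ s : Fin 4, (seg (edge T s)).len * (vb (edge T s) * (ψ ⬝ᵥ normal s)))
      ↔ G = weakGrad vb T := by
  have h1 := hx_pos T
  have h2 := hy_pos T
  have e0 : (seg (edge T 0)).len = hy T := rfl
  have e1 : (seg (edge T 1)).len = hy T := rfl
  have e2 : (seg (edge T 2)).len = hx T := rfl
  have e3 : (seg (edge T 3)).len = hx T := rfl
  simp only [Fin.sum_univ_four, e0, e1, e2, e3, area, dotProduct, Fin.sum_univ_two, normal]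
  constructor
  · intro H
    have H0 := H ![1, 0]
    have H1 := H ![0, 1]
    simp at H0 H1
    funext k
    fin_cases k
    · simp only [weakGrad, Fin.zero_eta, Matrix.cons_val_zero]
      rw [eq_div_iff h1.ne']
      apply mul_left_cancel₀ h2.ne'
      linarith
    · simp only [weakGrad, Fin.mk_one, Matrix.cons_val_one, Matrix.cons_val_zero]
      rw [eq_div_iff h2.ne']
      apply mul_left_cancel₀ h1.ne'
      linarith
  · rintro rfl ψ
    simp [weakGrad]
    field_simp
    ring

theorem integral_linear (A B lo hi : ℝ) :
    ∫ τ in lo..hi, (A + B * τ) = (A + B * ((lo + hi) / 2)) * (hi - lo) := by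
  rw [intervalIntegral.integral_add (by simp) (Continuous.intervalIntegrable (by fun_prop) _ _)]
  rw [intervalIntegral.integral_const_mul, integral_id, intervalIntegral.integral_const, smul_eq_mul]
  ring

theorem mean_affine (c : Fin 3 → ℝ) (e : Seg) (he : e.lo < e.hi) :
    e.mean (affine c) = affine c (e.pt ((e.lo + e.hi) / 2)) := by
  have hne : e.hi - e.lo ≠ 0 := (sub_pos.2 he).ne'
  rcases e with ⟨b, c', lo, hi⟩
  cases b
  · have key := integral_linear (c 0 + c 2 * c') (c 1) lo hi
    have e1 : ∀ τ : ℝ, affine c ((Seg.mk false c' lo hi).pt τ) = c 0 + c 2 * c' + c 1 * τ := by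
      intro τ
      simp only [affine, Seg.pt, Bool.false_eq_true, if_false]
      ring
    simp only [Seg.mean, Seg.int, Seg.len, e1]
    rw [div_eq_iff hne, key]
  · have key := integral_linear (c 0 + c 1 * c') (c 2) lo hi
    have e1 : ∀ τ : ℝ, affine c ((Seg.mk true c' lo hi).pt τ) = c 0 + c 1 * c' + c 2 * τ := by
      intro τ
      simp only [affine, Seg.pt, if_true]
    simp only [Seg.mean, Seg.int, Seg.len, e1]
    rw [div_eq_iff hne, key]

/-- `⟨S(v_b), Q_b φ⟩_{∂T} = ⟨v_b, φ⟩_{∂T}` for all linear polynomials `φ`. -/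
theorem extS_iff (vb : M.Edge → ℝ) (T : M.Elem) (d : Fin 3 → ℝ) :
    (∀ c : Fin 3 → ℝ,
      ∑ s : Fin 4, (seg (edge T s)).int
          (fun p => affine d p * (seg (edge T s)).mean (affine c))
        = ∑ s : Fin 4, (seg (edge T s)).int (fun p => vb (edge T s) * affine c p))
      ↔ d = extS vb T := by
  have h1 := hx_pos T
  have h2 := hy_pos T
  have l0 : (seg (edge T 0)).len = hy T := rfl
  have l1 : (seg (edge T 1)).len = hy T := rfl
  have l2 : (seg (edge T 2)).len = hx T := rfl
  have l3 : (seg (edge T 3)).len = hx T := rfl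
  have hlt : ∀ s : Fin 4, (seg (edge T s)).lo < (seg (edge T s)).hi := by
    intro s
    fin_cases s
    · exact sub_pos.1 h2
    · exact sub_pos.1 h2
    · exact sub_pos.1 h1
    · exact sub_pos.1 h1
  have key : ∀ (e : Seg), e.lo < e.hi → ∀ c : Fin 3 → ℝ,
      e.int (affine c) = e.len * affine c (e.pt ((e.lo + e.hi) / 2)) := by
    intro e he c
    rw [← mean_affine c e he, Seg.mean, mul_div_cancel₀]
    exact (sub_pos.2 he).ne'
  have kl : ∀ (s : Fin 4) (c : Fin 3 → ℝ), (seg (edge T s)).int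
      (fun p => affine d p * (seg (edge T s)).mean (affine c))
      = (seg (edge T s)).len *
        affine d ((seg (edge T s)).pt (((seg (edge T s)).lo + (seg (edge T s)).hi) / 2)) *
        affine c ((seg (edge T s)).pt (((seg (edge T s)).lo + (seg (edge T s)).hi) / 2)) := by
    intro s c
    rw [mean_affine c _ (hlt s), ← key _ (hlt s)]
    simp only [Seg.int, intervalIntegral.integral_mul_const]
  have kr : ∀ (s : Fin 4) (c : Fin 3 → ℝ), (seg (edge T s)).int
      (fun p => vb (edge T s) * affine c p)
      = (seg (edge T s)).len * vb (edge T s) *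
        affine c ((seg (edge T s)).pt (((seg (edge T s)).lo + (seg (edge T s)).hi) / 2)) := by
    intro s c
    rw [mul_comm (Seg.len _), mul_assoc, ← key _ (hlt s)]
    simp only [Seg.int, intervalIntegral.integral_const_mul]
  have p0 : (seg (edge T 0)).pt (((seg (edge T 0)).lo + (seg (edge T 0)).hi) / 2)
      = (M.x T.1.castSucc, (M.y T.2.castSucc + M.y T.2.succ) / 2) := rfl
  have p1 : (seg (edge T 1)).pt (((seg (edge T 1)).lo + (seg (edge T 1)).hi) / 2)
      = (M.x T.1.succ, (M.y T.2.castSucc + M.y T.2.succ) / 2) := rfl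
  have p2 : (seg (edge T 2)).pt (((seg (edge T 2)).lo + (seg (edge T 2)).hi) / 2)
      = ((M.x T.1.castSucc + M.x T.1.succ) / 2, M.y T.2.castSucc) := rfl
  have p3 : (seg (edge T 3)).pt (((seg (edge T 3)).lo + (seg (edge T 3)).hi) / 2)
      = ((M.x T.1.castSucc + M.x T.1.succ) / 2, M.y T.2.succ) := rfl
  simp only [kl, kr, Fin.sum_univ_four, l0, l1, l2, l3, p0, p1, p2, p3]
  have hxs : M.x T.1.succ = M.x T.1.castSucc + hx T := by simp [hx]
  have hys : M.y T.2.succ = M.y T.2.castSucc + hy T := by simp [hy]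
  simp only [affine, extS, weakGrad, hxs, hys]
  generalize M.x T.1.castSucc = X
  generalize M.y T.2.castSucc = Y
  generalize vb (edge T 0) = v0
  generalize vb (edge T 1) = v1
  generalize vb (edge T 2) = v2
  generalize vb (edge T 3) = v3
  generalize hx T = A at *
  generalize hy T = B at *
  have hAB : A + B ≠ 0 := (add_pos h1 h2).ne'
  have hA := h1.ne'
  have hB := h2.ne'
  constructor
  · intro H
    have H0 := H ![1, 0, 0]
    have H1 := H ![-(X + A / 2), 1, 0]
    have H2 := H ![-(Y + B / 2), 0, 1]
    simp at H0 H1 H2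
    have g1 : d 1 = (v1 - v0) / A := by
      rw [eq_div_iff hA]
      apply mul_left_cancel₀ (mul_ne_zero hA hB)
      linear_combination 2 * H1
    have g2 : d 2 = (v3 - v2) / B := by
      rw [eq_div_iff hB]
      apply mul_left_cancel₀ (mul_ne_zero hA hB)
      linear_combination 2 * H2
    have g0 : d 0 + d 1 * (X + A / 2) + d 2 * (Y + B / 2)
        = (B * (v0 + v1) + A * (v2 + v3)) / (2 * (A + B)) := by
      rw [eq_div_iff (mul_ne_zero two_ne_zero hAB)]
      linear_combination H0
    funext k
    fin_cases k
    · simp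
      rw [← g0, ← g1, ← g2]
      ring
    · simpa using g1
    · simpa using g2
  · rintro rfl c
    simp
    field_simp
    ring

end WG

end

/-!
The scheme tested with `{S(v_b), v_b}`, `v_b = 0` on `∂Ω`, involves the edge components only,
because `S(v_b) - v_b` is orthogonal on `∂T` to the edge averages of linear polynomials. On a
rectangle, `S(v_b) - v_b` is moreover determined by a single number: it is `-δ |e₃|` on the
vertical edges and `δ |e₁|` on the horizontal ones. Inserting the corrected projection `Q_b u +
h² w_b` into the scheme, integrating by parts on every element and using that the normal flux is
conserved across interior edges, one is left with residuals tested with `∇_d v_b` and with `δ`.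
Since the midpoint of an edge is the centre of mass of that edge, the former are of third order
in `u` already. The latter contain second derivatives of `u` with the factor `h`; the correction
is exactly what cancels them, up to third derivatives with the factor `h²`. Cauchy–Schwarz on
each element, Young's inequality and testing with the error itself conclude.

Only `L²` bounds on weak derivatives are available, so every integration by parts is carried out
on the averages over lines parallel to an axis, which are absolutely continuous functions of one
variable by the lemma of du Bois-Reymond.
-/

noncomputable section

namespace WG

/-! ### Test functions on an interval -/

/-- The one-dimensional analogue of `IsTest`: smooth functions with compact support contained in
the open interval `(a, b)`. -/
def IsTestIoo (a b : ℝ) (η : ℝ → ℝ) : Prop :=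
  ContDiff ℝ ∞ η ∧ HasCompactSupport η ∧ tsupport η ⊆ Set.Ioo a b

section Interval

variable {a b : ℝ}

theorem IsTestIoo.eq_zero {η : ℝ → ℝ} (hη : IsTestIoo a b η) {t : ℝ} (ht : t ∉ Set.Ioo a b) :
    η t = 0 :=
  image_eq_zero_of_notMem_tsupport fun h => ht (hη.2.2 h)

theorem IsTestIoo.sub {η χ : ℝ → ℝ} (hη : IsTestIoo a b η) (hχ : IsTestIoo a b χ) :
    IsTestIoo a b (fun t => η t - χ t) :=
  ⟨hη.1.sub hχ.1, hη.2.1.sub hχ.2.1,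
    (closure_mono (Function.support_sub η χ)).trans
      (closure_union.subset.trans (Set.union_subset hη.2.2 hχ.2.2))⟩

theorem IsTestIoo.const_mul {η : ℝ → ℝ} (hη : IsTestIoo a b η) (c : ℝ) :
    IsTestIoo a b (fun t => c * η t) :=
  ⟨contDiff_const.mul hη.1, hη.2.1.mul_left, (tsupport_mul_subset_right ..).trans hη.2.2⟩

theorem IsTestIoo.integral_eq {η : ℝ → ℝ} (hη : IsTestIoo a b η) (hab : a ≤ b) :
    ∫ t in a..b, η t = ∫ t, η t := by
  rw [intervalIntegral.integral_of_le hab, integral_Ioc_eq_integral_Ioo]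
  exact setIntegral_eq_integral_of_forall_compl_eq_zero fun t ht => hη.eq_zero ht

theorem isTestIoo_contDiffBump {c : ℝ} (f : ContDiffBump c) (ha : a < c - f.rOut)
    (hb : c + f.rOut < b) : IsTestIoo a b f := by
  refine ⟨f.contDiff, f.hasCompactSupport, ?_⟩
  rw [f.tsupport_eq, Real.closedBall_eq_Icc]
  exact Set.Icc_subset_Ioo ha hb

theorem exists_isTestIoo_integral_eq_one (hab : a < b) :
    ∃ θ, IsTestIoo a b θ ∧ ∫ t, θ t = 1 := by
  let f : ContDiffBump ((a + b) / 2) :=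
    ⟨(b - a) / 8, (b - a) / 4, by linarith, by linarith⟩
  refine ⟨f.normed volume, ⟨f.contDiff_normed, f.hasCompactSupport_normed, ?_⟩,
    f.integral_normed⟩
  rw [f.tsupport_normed_eq, Real.closedBall_eq_Icc]
  exact Set.Icc_subset_Ioo (by simp only [f]; linarith) (by simp only [f]; linarith)

theorem exists_isTestIoo_eventually_eq_one (hab : a < b) :
    ∃ θ : ℕ → ℝ → ℝ, (∀ k, IsTestIoo a b (θ k)) ∧ (∀ k t, |θ k t| ≤ 1) ∧
      ∀ t ∈ Set.Ioo a b, ∀ᶠ k in atTop, θ k t = 1 := by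
  let r : ℕ → ℝ := fun k => (b - a) / 2 * (1 - 1 / ((k : ℝ) + 1 + 1))
  let f (k : ℕ) : ContDiffBump ((a + b) / 2) := by
    refine ⟨r k, r (k + 1), ?_, ?_⟩
    · refine mul_pos (by linarith) (sub_pos.2 ((div_lt_one (by positivity)).2 ?_))
      linarith [k.cast_nonneg (α := ℝ)]
    · simp only [r, Nat.cast_add, Nat.cast_one]
      gcongr
      linarith
  have hr (k : ℕ) : r k < (b - a) / 2 :=
    mul_lt_of_lt_one_right (by linarith) (sub_lt_self _ (by positivity))
  have hlim : Tendsto r atTop (𝓝 ((b - a) / 2)) := by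
    have h := ((tendsto_one_div_add_atTop_nhds_zero_nat (𝕜 := ℝ)).comp
      (tendsto_add_atTop_nat 1)).const_sub 1 |>.const_mul ((b - a) / 2)
    simpa [r, Function.comp_def] using h
  refine ⟨fun k => f k, fun k => isTestIoo_contDiffBump (f k) ?_ ?_, fun k t => ?_, fun t ht => ?_⟩
  · linarith [hr (k + 1)]
  · linarith [hr (k + 1)]
  · rw [abs_of_nonneg (f k).nonneg]
    exact (f k).le_one
  · have ht' : |t - (a + b) / 2| < (b - a) / 2 := by
      rw [abs_lt]
      constructor <;> linarith [ht.1, ht.2]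
    filter_upwards [hlim.eventually_const_lt ht'] with k hk
    refine (f k).one_of_mem_closedBall ?_
    rw [Metric.mem_closedBall, Real.dist_eq]
    exact hk.le

/-! ### The lemma of du Bois-Reymond -/

theorem IsTestIoo.primitive (hab : a < b) {g : ℝ → ℝ} (hg : IsTestIoo a b g)
    (hg0 : ∫ t, g t = 0) :
    IsTestIoo a b (fun x => ∫ t in a..x, g t) := by
  have hderiv (x : ℝ) : HasDerivAt (fun x => ∫ t in a..x, g t) (g x) x :=
    (hg.1.continuous.integral_hasStrictDerivAt a x).hasDerivAt
  have hsmooth : ContDiff ℝ ∞ (fun x => ∫ t in a..x, g t) :=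
    contDiff_infty_iff_deriv.2 ⟨fun x => (hderiv x).differentiableAt,
      (funext fun x => (hderiv x).deriv : deriv _ = g).symm ▸ hg.1⟩
  have hK : IsCompact (insert ((a + b) / 2) (tsupport g)) := hg.2.1.isCompact.insert _
  have hKab : insert ((a + b) / 2) (tsupport g) ⊆ Set.Ioo a b :=
    Set.insert_subset ⟨by linarith, by linarith⟩ hg.2.2
  obtain ⟨l, hl, hl'⟩ := hK.exists_isLeast (Set.insert_nonempty _ _)
  obtain ⟨r, hr, hr'⟩ := hK.exists_isGreatest (Set.insert_nonempty _ _)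
  have hgl {t : ℝ} (ht : t < l) : g t = 0 :=
    image_eq_zero_of_notMem_tsupport fun h => ht.not_ge (hl' (Set.mem_insert_of_mem _ h))
  have hgr {t : ℝ} (ht : r < t) : g t = 0 :=
    image_eq_zero_of_notMem_tsupport fun h => ht.not_ge (hr' (Set.mem_insert_of_mem _ h))
  have hsupp : tsupport (fun x => ∫ t in a..x, g t) ⊆ Set.Icc l r := by
    refine closure_minimal (Function.support_subset_iff'.2 fun x hx => ?_) isClosed_Icc
    rcases lt_or_ge x l with hxl | hxl
    · refine intervalIntegral.integral_zero_ae (ae_of_all _ fun t ht => hgl ?_)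
      exact ht.2.trans_lt (max_lt (hKab hl).1 hxl)
    · have hxr : r < x := not_le.1 fun h => hx ⟨hxl, h⟩
      rw [intervalIntegral.integral_of_le ((hKab hr).1.trans hxr).le, ← hg0]
      refine setIntegral_eq_integral_of_forall_compl_eq_zero fun t ht => ?_
      rcases le_or_gt t a with hta | hta
      · exact hgl (hta.trans_lt (hKab hl).1)
      · exact hgr (hxr.trans (not_le.1 fun h => ht ⟨hta, h⟩))
  exact ⟨hsmooth, isCompact_Icc.of_isClosed_subset (isClosed_tsupport _) hsupp,
    hsupp.trans (Set.Icc_subset_Ioo (hKab hl).1 (hKab hr).2)⟩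

theorem integral_mul_deriv_add_of_ae_eq_primitive {F G : ℝ → ℝ} {c : ℝ}
    (hG : IntervalIntegrable G volume a b)
    (hF : ∀ᵐ t, t ∈ Set.uIcc a b → F t = c + ∫ x in a..t, G x) {κ : ℝ → ℝ}
    (hκ : ContDiff ℝ 1 κ) :
    ∫ x in a..b, (F x * deriv κ x + G x * κ x) = (c + ∫ x in a..b, G x) * κ b - c * κ a := by
  have hprim : AbsolutelyContinuousOnInterval (fun t => c + ∫ x in a..t, G x) a b :=
    contDiffOn_const.absolutelyContinuousOnInterval.fun_add
      (hG.absolutelyContinuousOnInterval_intervalIntegral Set.left_mem_uIcc)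
  have hparts := hprim.integral_deriv_mul_eq_sub hκ.contDiffOn.absolutelyContinuousOnInterval
  rw [intervalIntegral.integral_same, add_zero] at hparts
  rw [← hparts]
  refine intervalIntegral.integral_congr_ae ?_
  filter_upwards [hF, hG.ae_hasDerivAt_integral] with x hFx hGx hx
  have hx' := Set.uIoc_subset_uIcc hx
  rw [hFx hx', ((hGx hx' a Set.left_mem_uIcc).const_add c).deriv]
  ring

theorem exists_integral_mul_eq_const_mul (hab : a < b) {D : ℝ → ℝ}
    (hD : IntervalIntegrable D volume a b)
    (h : ∀ η, IsTestIoo a b η → ∫ t in a..b, D t * deriv η t = 0) :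
    ∃ c, ∀ g, IsTestIoo a b g → ∫ t in a..b, D t * g t = c * ∫ t in a..b, g t := by
  obtain ⟨θ, hθ, hθ1⟩ := exists_isTestIoo_integral_eq_one hab
  refine ⟨∫ t in a..b, D t * θ t, fun g hg => ?_⟩
  have hgθ := hg.sub (hθ.const_mul (∫ t in a..b, g t))
  have hgθ0 : ∫ t, (g t - (∫ t in a..b, g t) * θ t) = 0 := by
    rw [integral_sub (hg.1.continuous.integrable_of_hasCompactSupport hg.2.1)
      ((hθ.1.continuous.integrable_of_hasCompactSupport hθ.2.1).const_mul _),
      integral_const_mul, hθ1, hg.integral_eq hab.le, mul_one, sub_self]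
  have hprim : deriv (fun x => ∫ t in a..x, (g t - (∫ t in a..b, g t) * θ t))
      = fun t => g t - (∫ t in a..b, g t) * θ t :=
    funext fun x => hgθ.1.continuous.deriv_integral _ a x
  have key := h _ (hgθ.primitive hab hgθ0)
  simp only [hprim, mul_sub] at key
  rw [intervalIntegral.integral_sub (hD.mul_continuousOn hg.1.continuous.continuousOn)
    (hD.mul_continuousOn (hθ.1.continuous.const_mul _).continuousOn)] at key
  simp only [mul_left_comm (D _), intervalIntegral.integral_const_mul] at key
  linarith

theorem ae_eq_const_of_forall_integral_mul_deriv_eq_zero (hab : a < b) {D : ℝ → ℝ}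
    (hD : IntervalIntegrable D volume a b)
    (h : ∀ η, IsTestIoo a b η → ∫ t in a..b, D t * deriv η t = 0) :
    ∃ c, ∀ᵐ t, t ∈ Set.uIcc a b → D t = c := by
  obtain ⟨c, hc⟩ := exists_integral_mul_eq_const_mul hab hD h
  refine ⟨c, ?_⟩
  have hDc := (intervalIntegrable_iff_integrableOn_Ioo_of_le hab.le).1
    (hD.sub (intervalIntegrable_const (c := c)))
  have hzero := isOpen_Ioo.ae_eq_zero_of_integral_contDiff_smul_eq_zero (U := Set.Ioo a b)
    hDc.locallyIntegrableOn fun g hg hgc hgs => by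
      have hgt : IsTestIoo a b g := ⟨hg, hgc, hgs⟩
      rw [← setIntegral_eq_integral_of_forall_compl_eq_zero (s := Set.Ioo a b) fun t ht => by
        rw [hgt.eq_zero ht, zero_smul], ← integral_Ioc_eq_integral_Ioo,
        ← intervalIntegral.integral_of_le hab.le]
      simp only [smul_eq_mul, mul_comm (g _), sub_mul]
      rw [intervalIntegral.integral_sub (hD.mul_continuousOn hg.continuous.continuousOn)
        ((hg.continuous.const_mul c).intervalIntegrable a b), hc g hgt,
        intervalIntegral.integral_const_mul, sub_self]
  filter_upwards [hzero, Measure.ae_ne volume a, Measure.ae_ne volume b] with t ht hta htb hmem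
  rw [Set.uIcc_of_le hab.le] at hmem
  exact sub_eq_zero.1 (ht ⟨lt_of_le_of_ne hmem.1 hta.symm, lt_of_le_of_ne hmem.2 htb⟩)

theorem ae_eq_primitive_of_forall_integral_eq_zero (hab : a < b) {F G : ℝ → ℝ}
    (hF : IntervalIntegrable F volume a b) (hG : IntervalIntegrable G volume a b)
    (h : ∀ η, IsTestIoo a b η → ∫ t in a..b, (F t * deriv η t + G t * η t) = 0) :
    ∃ c, ∀ᵐ t, t ∈ Set.uIcc a b → F t = c + ∫ x in a..t, G x := by
  have hP : IntervalIntegrable (fun t => ∫ x in a..t, G x) volume a b :=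
    (hG.absolutelyContinuousOnInterval_intervalIntegral
      Set.left_mem_uIcc).continuousOn.intervalIntegrable
  obtain ⟨c, hc⟩ := ae_eq_const_of_forall_integral_mul_deriv_eq_zero hab (hF.sub hP)
    fun η hη => by
      have hη' := (hη.1.continuous_deriv (by simp)).continuousOn (s := Set.uIcc a b)
      have hGη := hG.mul_continuousOn hη.1.continuous.continuousOn
      have hprim := integral_mul_deriv_add_of_ae_eq_primitive (F := fun t => ∫ x in a..t, G x)
        (c := 0) hG (by simp) (hη.1.of_le (by simp))
      rw [hη.eq_zero (by simp), hη.eq_zero (by simp), mul_zero, mul_zero, sub_zero] at hprim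
      calc ∫ t in a..b, (F t - ∫ x in a..t, G x) * deriv η t
          = (∫ t in a..b, (F t * deriv η t + G t * η t))
            - ∫ t in a..b, ((∫ x in a..t, G x) * deriv η t + G t * η t) := by
            rw [← intervalIntegral.integral_sub ((hF.mul_continuousOn hη').add hGη)
              ((hP.mul_continuousOn hη').add hGη)]
            simp only [sub_mul, add_sub_add_right_eq_sub]
        _ = 0 := by rw [h η hη, hprim, sub_zero]
  exact ⟨c, hc.mono fun t ht hmem => sub_eq_iff_eq_add.1 (ht hmem)⟩

theorem exists_integral_mul_deriv_add_eq (hab : a < b) {F G : ℝ → ℝ}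
    (hF : IntervalIntegrable F volume a b) (hG : IntervalIntegrable G volume a b)
    (h : ∀ η, IsTestIoo a b η → ∫ t in a..b, (F t * deriv η t + G t * η t) = 0) :
    ∃ l r : ℝ, ∀ κ : ℝ → ℝ, ContDiff ℝ 1 κ →
      ∫ x in a..b, (F x * deriv κ x + G x * κ x) = r * κ b - l * κ a := by
  obtain ⟨c, hc⟩ := ae_eq_primitive_of_forall_integral_eq_zero hab hF hG h
  exact ⟨_, _, fun κ hκ => integral_mul_deriv_add_of_ae_eq_primitive hG hc hκ⟩

end Interval

/-! ### Weak derivatives -/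

theorem hasDerivAt_dx {φ : ℝ × ℝ → ℝ} {x y : ℝ} (hφ : DifferentiableAt ℝ φ (x, y)) :
    HasDerivAt (fun t => φ (t, y)) (dx φ (x, y)) x :=
  HasFDerivAt.comp_hasDerivAt (f := fun t : ℝ => (t, y)) x hφ.hasFDerivAt
    ((hasDerivAt_id x).prodMk (hasDerivAt_const x y))

theorem dx_comp_swap (φ : ℝ × ℝ → ℝ) : dx (φ ∘ Prod.swap) = dy φ ∘ Prod.swap := by
  funext p
  exact DFunLike.congr_fun
    ((ContinuousLinearEquiv.prodComm ℝ ℝ ℝ).comp_right_fderiv (f := φ) (x := p)) (1, 0)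

theorem dy_comp_swap (φ : ℝ × ℝ → ℝ) : dy (φ ∘ Prod.swap) = dx φ ∘ Prod.swap := by
  funext p
  exact DFunLike.congr_fun
    ((ContinuousLinearEquiv.prodComm ℝ ℝ ℝ).comp_right_fderiv (f := φ) (x := p)) (0, 1)

theorem dx_mul_fst_snd {η χ : ℝ → ℝ} (hη : Differentiable ℝ η) (hχ : Differentiable ℝ χ) :
    dx (fun p => η p.1 * χ p.2) = fun p => deriv η p.1 * χ p.2 := by
  funext ⟨x, y⟩
  have hφ : Differentiable ℝ fun p : ℝ × ℝ => η p.1 * χ p.2 := by fun_prop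
  exact (hasDerivAt_dx (hφ (x, y))).unique ((hη x).hasDerivAt.mul_const (χ y))

theorem dy_mul_fst_snd {η χ : ℝ → ℝ} (hη : Differentiable ℝ η) (hχ : Differentiable ℝ χ) :
    dy (fun p => η p.1 * χ p.2) = fun p => η p.1 * deriv χ p.2 := by
  have hswap : (fun p : ℝ × ℝ => η p.1 * χ p.2) = (fun p => χ p.1 * η p.2) ∘ Prod.swap :=
    funext fun p => mul_comm _ _
  rw [hswap, dy_comp_swap, dx_mul_fst_snd hχ hη]
  exact funext fun p => mul_comm _ _

theorem contDiff_dx {φ : ℝ × ℝ → ℝ} (hφ : ContDiff ℝ ∞ φ) : ContDiff ℝ ∞ (dx φ) :=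
  (hφ.fderiv_right (m := ∞) (by simp)).clm_apply contDiff_const

theorem contDiff_dy {φ : ℝ × ℝ → ℝ} (hφ : ContDiff ℝ ∞ φ) : ContDiff ℝ ∞ (dy φ) :=
  (hφ.fderiv_right (m := ∞) (by simp)).clm_apply contDiff_const

theorem dx_dy_comm {φ : ℝ × ℝ → ℝ} (hφ : ContDiff ℝ ∞ φ) : dx (dy φ) = dy (dx φ) := by
  funext p
  have hsymm : IsSymmSndFDerivAt ℝ φ p := hφ.contDiffAt.isSymmSndFDerivAt (by
    simp only [minSmoothness_of_isRCLikeNormedField]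
    exact WithTop.coe_le_coe.2 le_top)
  have hd : DifferentiableAt ℝ (fderiv ℝ φ) p :=
    (hφ.fderiv_right (m := ∞) (by simp)).differentiable (by simp) p
  have happly (v w : ℝ × ℝ) :
      fderiv ℝ (fun q => fderiv ℝ φ q v) p w = fderiv ℝ (fderiv ℝ φ) p w v := by
    rw [fderiv_clm_apply hd (differentiableAt_const _)]
    simp
  exact (happly _ _).trans ((hsymm _ _).trans (happly _ _).symm)

theorem contDiff_iterate_dx {φ : ℝ × ℝ → ℝ} (hφ : ContDiff ℝ ∞ φ) (α : ℕ) :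
    ContDiff ℝ ∞ (dx^[α] φ) := by
  induction α with
  | zero => exact hφ
  | succ α ih => exact Function.iterate_succ_apply' dx α φ ▸ contDiff_dx ih

theorem contDiff_iterate_dy {φ : ℝ × ℝ → ℝ} (hφ : ContDiff ℝ ∞ φ) (β : ℕ) :
    ContDiff ℝ ∞ (dy^[β] φ) := by
  induction β with
  | zero => exact hφ
  | succ β ih => exact Function.iterate_succ_apply' dy β φ ▸ contDiff_dy ih

theorem iterate_dy_dx {φ : ℝ × ℝ → ℝ} (hφ : ContDiff ℝ ∞ φ) (β : ℕ) :
    dy^[β] (dx φ) = dx (dy^[β] φ) := by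
  induction β with
  | zero => rfl
  | succ β ih =>
    rw [Function.iterate_succ_apply', ih, Function.iterate_succ_apply',
      dx_dy_comm (contDiff_iterate_dy hφ β)]

theorem iterate_dx_iterate_dy_comm {φ : ℝ × ℝ → ℝ} (hφ : ContDiff ℝ ∞ φ) (α β : ℕ) :
    dx^[α] (dy^[β] φ) = dy^[β] (dx^[α] φ) := by
  induction α with
  | zero => rfl
  | succ α ih =>
    rw [Function.iterate_succ_apply', ih, Function.iterate_succ_apply',
      iterate_dy_dx (contDiff_iterate_dx hφ α)]

section WeakDeriv

variable {U V : Set (ℝ × ℝ)} {α β : ℕ} {φ v v' d d' : ℝ × ℝ → ℝ}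

theorem tsupport_dx_subset (φ : ℝ × ℝ → ℝ) : tsupport (dx φ) ⊆ tsupport φ :=
  tsupport_fderiv_apply_subset ℝ (1, 0)

theorem IsTest.mono (h : IsTest U φ) (hUV : U ⊆ V) : IsTest V φ :=
  ⟨h.1, h.2.1, h.2.2.trans hUV⟩

theorem IsTest.eq_zero (h : IsTest U φ) {p : ℝ × ℝ} (hp : p ∉ U) : φ p = 0 :=
  image_eq_zero_of_notMem_tsupport fun h' => hp (h.2.2 h')

theorem IsTest.comp_swap (h : IsTest U φ) : IsTest (Prod.swap ⁻¹' U) (φ ∘ Prod.swap) :=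
  ⟨h.1.comp (contDiff_snd.prodMk contDiff_fst), h.2.1.comp_homeomorph (Homeomorph.prodComm ℝ ℝ),
    (tsupport_comp_eq_preimage φ (Homeomorph.prodComm ℝ ℝ)).subset.trans
      (Set.preimage_mono h.2.2)⟩

theorem IsTest.dx (h : IsTest U φ) : IsTest U (dx φ) :=
  ⟨contDiff_dx h.1, h.2.1.of_isClosed_subset (isClosed_tsupport _) (tsupport_dx_subset φ),
    (tsupport_dx_subset φ).trans h.2.2⟩

theorem IsTest.dy (h : IsTest U φ) : IsTest U (dy φ) := by
  have h' := h.comp_swap.dx.comp_swap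
  rwa [dx_comp_swap] at h'

theorem IsTest.iterate (h : IsTest U φ) (α β : ℕ) :
    IsTest U (WG.dx^[α] (WG.dy^[β] φ)) := by
  have hdy : IsTest U (WG.dy^[β] φ) := by
    induction β with
    | zero => exact h
    | succ β ih => exact Function.iterate_succ_apply' WG.dy β φ ▸ ih.dy
  induction α with
  | zero => exact hdy
  | succ α ih => exact Function.iterate_succ_apply' WG.dx α _ ▸ ih.dx

theorem IsTest.setIntegral_mul (h : IsTest U φ) (hUV : U ⊆ V) (hV : MeasurableSet V)
    (v : ℝ × ℝ → ℝ) : ∫ p in V, v p * φ p = ∫ p in U, v p * φ p :=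
  setIntegral_eq_of_subset_of_forall_sdiff_eq_zero hV hUV fun p hp => by
    rw [h.eq_zero hp.2, mul_zero]

theorem IsTest.integrable_mul (h : IsTest U φ) (hv : MemLp v 2 (volume.restrict U)) :
    IntegrableOn (fun p => v p * φ p) U :=
  have hφ : MemLp φ 2 := h.1.continuous.memLp_of_hasCompactSupport h.2.1
  hv.integrable_mul (hφ.restrict U)

theorem IsTestIoo.mul_fst_snd {a b c d : ℝ} {η χ : ℝ → ℝ} (hη : IsTestIoo a b η)
    (hχ : IsTestIoo c d χ) :
    IsTest (Set.Ioo a b ×ˢ Set.Ioo c d) (fun p => η p.1 * χ p.2) := by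
  have hsupp : tsupport (fun p : ℝ × ℝ => η p.1 * χ p.2) ⊆ tsupport η ×ˢ tsupport χ :=
    closure_minimal (fun p hp => ⟨subset_closure (left_ne_zero_of_mul hp),
      subset_closure (right_ne_zero_of_mul hp)⟩)
      ((isClosed_tsupport _).prod (isClosed_tsupport _))
  exact ⟨(hη.1.comp contDiff_fst).mul (hχ.1.comp contDiff_snd),
    (hη.2.1.prod hχ.2.1).of_isClosed_subset (isClosed_tsupport _) hsupp,
    hsupp.trans (Set.prod_mono hη.2.2 hχ.2.2)⟩

theorem setIntegral_preimage_swap (U : Set (ℝ × ℝ)) (g : ℝ × ℝ → ℝ) :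
    ∫ p in Prod.swap ⁻¹' U, g p.swap = ∫ p in U, g p :=
  Measure.measurePreserving_swap.setIntegral_preimage_emb
    MeasurableEquiv.prodComm.measurableEmbedding g U

theorem memLp_comp_swap (hv : MemLp v 2 (volume.restrict U)) :
    MemLp (v ∘ Prod.swap) 2 (volume.restrict (Prod.swap ⁻¹' U)) :=
  hv.comp_measurePreserving (Measure.measurePreserving_swap.restrict_preimage_emb
    MeasurableEquiv.prodComm.measurableEmbedding U)

theorem IsWeakDeriv.comp_swap (h : IsWeakDeriv U α β v d) :
    IsWeakDeriv (Prod.swap ⁻¹' U) β α (v ∘ Prod.swap) (d ∘ Prod.swap) := by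
  refine ⟨memLp_comp_swap h.1, fun φ hφ => ?_⟩
  have hφU : IsTest U (φ ∘ Prod.swap) := hφ.comp_swap
  have hiter : dx^[α] (dy^[β] (φ ∘ Prod.swap)) = (dx^[β] (dy^[α] φ)) ∘ Prod.swap := by
    have hdy : Function.Semiconj (· ∘ Prod.swap) dx dy := fun ψ => (dy_comp_swap ψ).symm
    have hdx : Function.Semiconj (· ∘ Prod.swap) dy dx := fun ψ => (dx_comp_swap ψ).symm
    rw [← (hdy.iterate_right β).eq φ, ← (hdx.iterate_right α).eq,
      ← iterate_dx_iterate_dy_comm hφ.1]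
  have key := h.2 _ hφU
  rw [hiter, ← setIntegral_preimage_swap U, ← setIntegral_preimage_swap U, add_comm] at key
  exact key

theorem IsWeakDeriv.restrict (h : IsWeakDeriv V α β v d) (hUV : U ⊆ V) (hV : MeasurableSet V) :
    IsWeakDeriv U α β v d := by
  refine ⟨h.1.mono_measure (Measure.restrict_mono hUV le_rfl), fun φ hφ => ?_⟩
  rw [← (hφ.iterate α β).setIntegral_mul hUV hV, ← hφ.setIntegral_mul hUV hV]
  exact h.2 φ (hφ.mono hUV)

theorem IsWeakDeriv.succ_left (h : IsWeakDeriv U α β v d) (h' : IsWeakDeriv U (α + 1) β v d') :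
    IsWeakDeriv U 1 0 d d' := by
  refine ⟨h'.1, fun φ hφ => ?_⟩
  have hd := h.2 _ hφ.dx
  rw [iterate_dy_dx hφ.1, ← Function.iterate_succ_apply, h'.2 φ hφ, add_right_comm, pow_succ,
    mul_assoc] at hd
  have hd' := mul_left_cancel₀ (pow_ne_zero _ (by norm_num)) hd
  simpa using hd'.symm

theorem IsWeakDeriv.succ_right (h : IsWeakDeriv U α β v d)
    (h' : IsWeakDeriv U α (β + 1) v d') : IsWeakDeriv U 0 1 d d' :=
  (h.comp_swap.succ_left h'.comp_swap).comp_swap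

theorem IsWeakDeriv.congr (h : IsWeakDeriv U α β v d) (hv : v =ᵐ[volume.restrict U] v') :
    IsWeakDeriv U α β v' d := by
  refine ⟨h.1, fun φ hφ => (integral_congr_ae ?_).trans (h.2 φ hφ)⟩
  filter_upwards [hv] with p hp
  rw [hp]

theorem IsWeakDeriv.linearComb (h : IsWeakDeriv U α β v d) (h' : IsWeakDeriv U α β v' d')
    (hv : MemLp v 2 (volume.restrict U)) (hv' : MemLp v' 2 (volume.restrict U)) (r r' : ℝ) :
    IsWeakDeriv U α β (fun p => r * v p + r' * v' p) (fun p => r * d p + r' * d' p) := by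
  refine ⟨(h.1.const_mul r).add (h'.1.const_mul r'), fun φ hφ => ?_⟩
  have hi := hφ.iterate α β
  simp only [add_mul, mul_assoc]
  rw [integral_add ((hi.integrable_mul hv).const_mul r) ((hi.integrable_mul hv').const_mul r'),
    integral_add ((hφ.integrable_mul h.1).const_mul r) ((hφ.integrable_mul h'.1).const_mul r')]
  simp only [integral_const_mul]
  rw [h.2 φ hφ, h'.2 φ hφ]
  ring

theorem ae_eq_of_forall_isTest (hU : IsOpen U) (hd : MemLp d 2 (volume.restrict U))
    (hd' : MemLp d' 2 (volume.restrict U))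
    (h : ∀ φ, IsTest U φ → ∫ p in U, d p * φ p = ∫ p in U, d' p * φ p) :
    d =ᵐ[volume.restrict U] d' := by
  have hloc : LocallyIntegrableOn (d - d') U :=
    locallyIntegrableOn_of_locallyIntegrable_restrict
      ((hd.sub hd').locallyIntegrable (by norm_num))
  have hzero := hU.ae_eq_zero_of_integral_contDiff_smul_eq_zero hloc fun φ hφ hφc hφU => by
    have ht : IsTest U φ := ⟨hφ, hφc, hφU⟩
    rw [← setIntegral_eq_integral_of_forall_compl_eq_zero (s := U) fun p hp => by
      rw [ht.eq_zero hp, zero_smul]]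
    simp only [Pi.sub_apply, smul_eq_mul, mul_comm (φ _), sub_mul]
    rw [integral_sub (ht.integrable_mul hd) (ht.integrable_mul hd'), h φ ht, sub_self]
  rw [EventuallyEq, ae_restrict_iff' hU.measurableSet]
  filter_upwards [hzero] with p hp hpU
  exact sub_eq_zero.1 (hp hpU)

theorem IsWeakDeriv.ae_eq (hU : IsOpen U) (h : IsWeakDeriv U α β v d)
    (h' : IsWeakDeriv U α β v d') : d =ᵐ[volume.restrict U] d' :=
  ae_eq_of_forall_isTest hU h.1 h'.1 fun φ hφ =>
    mul_left_cancel₀ (pow_ne_zero _ (by norm_num)) ((h.2 φ hφ).symm.trans (h'.2 φ hφ))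

theorem IsWeakDeriv.weakDeriv (h : IsWeakDeriv U α β v d) :
    IsWeakDeriv U α β v (weakDeriv U α β v) := by
  have hex : ∃ d, IsWeakDeriv U α β v d := ⟨d, h⟩
  rw [WG.weakDeriv, dif_pos hex]
  exact hex.choose_spec

theorem MemH.isWeakDeriv {s : ℕ} (h : MemH s U v) (hαβ : α + β ≤ s) :
    IsWeakDeriv U α β v (weakDeriv U α β v) :=
  (h.2 α β hαβ).choose_spec.weakDeriv

end WeakDeriv

/-! ### Integration by parts on rectangles -/

/-- The open rectangle `(a, b) × (c, d)`. -/
abbrev rect (a b c d : ℝ) : Set (ℝ × ℝ) := Set.Ioo a b ×ˢ Set.Ioo c d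

/-- The integration by parts formula for `v` and its derivative `v'` in the direction of the
coordinate `π`, tested with functions of `π` only. It says that `l` and `r` are the integrals of
the traces of `v` over the ends `π = a` and `π = b` of `S`. -/
def HasEndIntegrals (S : Set (ℝ × ℝ)) (π : ℝ × ℝ → ℝ) (a b : ℝ) (v v' : ℝ × ℝ → ℝ)
    (l r : ℝ) : Prop :=
  ∀ κ : ℝ → ℝ, ContDiff ℝ 1 κ →
    ∫ p in S, (v p * deriv κ (π p) + v' p * κ (π p)) = r * κ b - l * κ a

theorem memLp_comp_of_mapsTo {α β : Type*} [MeasurableSpace α] [TopologicalSpace β]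
    [MeasurableSpace β] [OpensMeasurableSpace β] {μ : Measure α} {S : Set α} {K : Set β}
    [IsFiniteMeasure (μ.restrict S)] (hS : MeasurableSet S) {π : α → β} (hπ : Measurable π)
    (hK : IsCompact K) (hmem : Set.MapsTo π S K) {κ : β → ℝ} (hκ : Continuous κ) :
    MemLp (fun x => κ (π x)) 2 (μ.restrict S) := by
  obtain ⟨B, hB⟩ := hK.exists_bound_of_continuousOn hκ.continuousOn
  exact MemLp.of_bound (hκ.measurable.comp hπ).aestronglyMeasurable B
    (ae_restrict_of_forall_mem hS fun x hx => hB _ (hmem hx))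

section Rectangle

variable {a b c d : ℝ} {v v' : ℝ × ℝ → ℝ}

theorem measurableSet_rect : MeasurableSet (rect a b c d) :=
  measurableSet_Ioo.prod measurableSet_Ioo

theorem isOpen_rect : IsOpen (rect a b c d) :=
  isOpen_Ioo.prod isOpen_Ioo

theorem preimage_swap_rect : Prod.swap ⁻¹' rect a b c d = rect c d a b :=
  Set.preimage_swap_prod ..

theorem volume_real_rect (hab : a ≤ b) (hcd : c ≤ d) :
    volume.real (rect a b c d) = (b - a) * (d - c) := by
  rw [Measure.volume_eq_prod, measureReal_prod_prod, Real.volume_real_Ioo_of_le hab,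
    Real.volume_real_Ioo_of_le hcd]

instance isFiniteMeasure_restrict_rect : IsFiniteMeasure (volume.restrict (rect a b c d)) :=
  ⟨by
    rw [Measure.restrict_apply_univ, Measure.volume_eq_prod, Measure.prod_prod]
    exact ENNReal.mul_lt_top measure_Ioo_lt_top measure_Ioo_lt_top⟩

theorem rect_subset_Icc_prod_Icc : rect a b c d ⊆ Set.Icc a b ×ˢ Set.Icc c d :=
  Set.prod_mono Set.Ioo_subset_Icc_self Set.Ioo_subset_Icc_self

theorem integrableOn_rect_mul {g : ℝ × ℝ → ℝ} (hv : IntegrableOn v (rect a b c d))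
    (hg : Continuous g) : IntegrableOn (fun p => v p * g p) (rect a b c d) :=
  hv.mul_continuousOn_of_subset hg.continuousOn measurableSet_rect
    (isCompact_Icc.prod isCompact_Icc) rect_subset_Icc_prod_Icc

theorem memLp_rect_of_continuous {g : ℝ × ℝ → ℝ} (hg : Continuous g) :
    MemLp g 2 (volume.restrict (rect a b c d)) :=
  memLp_comp_of_mapsTo measurableSet_rect measurable_id (isCompact_Icc.prod isCompact_Icc)
    rect_subset_Icc_prod_Icc hg

theorem setIntegral_rect_mul_fst (hab : a ≤ b) (hv : IntegrableOn v (rect a b c d)) {κ : ℝ → ℝ}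
    (hκ : Continuous κ) :
    ∫ p in rect a b c d, v p * κ p.1 = ∫ x in a..b, (∫ y in Set.Ioo c d, v (x, y)) * κ x := by
  rw [intervalIntegral.integral_of_le hab, integral_Ioc_eq_integral_Ioo, Measure.volume_eq_prod,
    setIntegral_prod _ (integrableOn_rect_mul (g := fun p => κ p.1) hv (by fun_prop))]
  simp only [integral_mul_const]

theorem intervalIntegrable_integral_snd (hab : a ≤ b) (hv : IntegrableOn v (rect a b c d)) :
    IntervalIntegrable (fun x => ∫ y in Set.Ioo c d, v (x, y)) volume a b := by
  rw [intervalIntegrable_iff_integrableOn_Ioo_of_le hab]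
  rw [IntegrableOn, Measure.volume_eq_prod, ← Measure.prod_restrict] at hv
  exact hv.integral_prod_left

theorem exists_hasEndIntegrals_fst (hab : a < b) (hv : IntegrableOn v (rect a b c d))
    (hv' : IntegrableOn v' (rect a b c d))
    (h : ∀ η, IsTestIoo a b η → ∫ p in rect a b c d, (v p * deriv η p.1 + v' p * η p.1) = 0) :
    ∃ l r, HasEndIntegrals (rect a b c d) Prod.fst a b v v' l r := by
  have hI := intervalIntegrable_integral_snd hab.le hv
  have hI' := intervalIntegrable_integral_snd hab.le hv'
  have hfubini {κ : ℝ → ℝ} (hκ : ContDiff ℝ 1 κ) :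
      ∫ p in rect a b c d, (v p * deriv κ p.1 + v' p * κ p.1)
        = ∫ x in a..b, ((∫ y in Set.Ioo c d, v (x, y)) * deriv κ x
          + (∫ y in Set.Ioo c d, v' (x, y)) * κ x) := by
    have hκ' := hκ.continuous_deriv le_rfl
    rw [integral_add (integrableOn_rect_mul (g := fun p => deriv κ p.1) hv (by fun_prop))
      (integrableOn_rect_mul (g := fun p => κ p.1) hv' (by fun_prop)),
      setIntegral_rect_mul_fst hab.le hv hκ', setIntegral_rect_mul_fst hab.le hv' hκ.continuous,
      intervalIntegral.integral_add (hI.mul_continuousOn hκ'.continuousOn)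
        (hI'.mul_continuousOn hκ.continuous.continuousOn)]
  obtain ⟨l, r, hlr⟩ := exists_integral_mul_deriv_add_eq hab hI hI' fun η hη =>
    (hfubini (hη.1.of_le (by simp))).symm.trans (h η hη)
  exact ⟨l, r, fun κ hκ => (hfubini hκ).trans (hlr κ hκ)⟩

theorem IsWeakDeriv.integral_mul_fst_snd_add (hcd : c < d)
    (hv : MemLp v 2 (volume.restrict (rect a b c d)))
    (h : IsWeakDeriv (rect a b c d) 1 0 v v') {η χ : ℝ → ℝ} (hη : IsTestIoo a b η)
    (hχ : ContDiff ℝ ∞ χ) :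
    ∫ p in rect a b c d, (v p * deriv η p.1 + v' p * η p.1) * χ p.2 = 0 := by
  obtain ⟨θ, hθ, hθ_le, hθ_one⟩ := exists_isTestIoo_eventually_eq_one hcd
  have hη' := hη.1.continuous_deriv (by simp)
  have hint : IntegrableOn (fun p => (v p * deriv η p.1 + v' p * η p.1) * χ p.2)
      (rect a b c d) :=
    integrableOn_rect_mul ((integrableOn_rect_mul (hv.integrable (by norm_num))
      (hη'.comp continuous_fst)).add (integrableOn_rect_mul (h.1.integrable (by norm_num))
        (hη.1.continuous.comp continuous_fst))) (hχ.continuous.comp continuous_snd)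
  have hzero (k : ℕ) :
      ∫ p in rect a b c d, (v p * deriv η p.1 + v' p * η p.1) * χ p.2 * θ k p.2 = 0 := by
    have hχθ : IsTestIoo c d fun y => χ y * θ k y :=
      ⟨hχ.mul (hθ k).1, (hθ k).2.1.mul_left, (tsupport_mul_subset_right ..).trans (hθ k).2.2⟩
    have htest := hη.mul_fst_snd hχθ
    have key := h.2 _ htest
    simp only [Function.iterate_one, Function.iterate_zero, id, add_zero, pow_one,
      dx_mul_fst_snd (hη.1.differentiable (by simp)) (hχθ.1.differentiable (by simp))] at key
    have hi := htest.dx.integrable_mul hv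
    rw [dx_mul_fst_snd (hη.1.differentiable (by simp)) (hχθ.1.differentiable (by simp))] at hi
    calc _ = ∫ p in rect a b c d, (v p * (deriv η p.1 * (χ p.2 * θ k p.2))
          + v' p * (η p.1 * (χ p.2 * θ k p.2))) := by
          congr 1 with p
          ring
      _ = 0 := by
          rw [integral_add hi (htest.integrable_mul h.1), key]
          ring
  have hlim : Tendsto (fun k => ∫ p in rect a b c d,
      (v p * deriv η p.1 + v' p * η p.1) * χ p.2 * θ k p.2) atTop
      (𝓝 (∫ p in rect a b c d, (v p * deriv η p.1 + v' p * η p.1) * χ p.2)) := by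
    refine tendsto_integral_of_dominated_convergence _ (fun k => hint.aestronglyMeasurable.mul
      ((hθ k).1.continuous.comp continuous_snd).aestronglyMeasurable) hint.norm
      (fun k => ae_of_all _ fun p => ?_)
      (ae_restrict_of_forall_mem measurableSet_rect fun p hp => tendsto_const_nhds.congr' ?_)
    · rw [norm_mul]
      exact mul_le_of_le_one_right (norm_nonneg _) (hθ_le k p.2)
    · filter_upwards [hθ_one p.2 hp.2] with k hk
      rw [hk, mul_one]
  simp only [hzero] at hlim
  exact tendsto_nhds_unique hlim tendsto_const_nhds

theorem IsWeakDeriv.exists_hasEndIntegrals_fst (hab : a < b) (hcd : c < d)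
    (hv : MemLp v 2 (volume.restrict (rect a b c d)))
    (h : IsWeakDeriv (rect a b c d) 1 0 v v') :
    ∃ l r, HasEndIntegrals (rect a b c d) Prod.fst a b v v' l r :=
  WG.exists_hasEndIntegrals_fst hab (hv.integrable (by norm_num)) (h.1.integrable (by norm_num))
    fun η hη => by
      simpa only [mul_one] using
        h.integral_mul_fst_snd_add hcd hv hη (contDiff_const (c := (1 : ℝ)))

theorem HasEndIntegrals.comp_swap {S : Set (ℝ × ℝ)} {π : ℝ × ℝ → ℝ} {l r : ℝ}
    (h : HasEndIntegrals S π a b v v' l r) :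
    HasEndIntegrals (Prod.swap ⁻¹' S) (π ∘ Prod.swap) a b (v ∘ Prod.swap) (v' ∘ Prod.swap) l r :=
  fun κ hκ => (setIntegral_preimage_swap S _).trans (h κ hκ)

theorem IsWeakDeriv.integral_mul_snd_fst_add (hab : a < b)
    (hv : MemLp v 2 (volume.restrict (rect a b c d)))
    (h : IsWeakDeriv (rect a b c d) 0 1 v v') {η χ : ℝ → ℝ} (hη : IsTestIoo c d η)
    (hχ : ContDiff ℝ ∞ χ) :
    ∫ p in rect a b c d, (v p * deriv η p.2 + v' p * η p.2) * χ p.1 = 0 := by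
  have hv₁ := memLp_comp_swap hv
  have h₁ := h.comp_swap
  rw [preimage_swap_rect] at hv₁ h₁
  have hswap := setIntegral_preimage_swap (rect a b c d)
    fun p => (v p * deriv η p.2 + v' p * η p.2) * χ p.1
  rw [preimage_swap_rect] at hswap
  exact hswap.symm.trans (h₁.integral_mul_fst_snd_add hab hv₁ hη hχ)

theorem IsWeakDeriv.exists_hasEndIntegrals_snd (hab : a < b) (hcd : c < d)
    (hv : MemLp v 2 (volume.restrict (rect a b c d)))
    (h : IsWeakDeriv (rect a b c d) 0 1 v v') :
    ∃ l r, HasEndIntegrals (rect a b c d) Prod.snd c d v v' l r := by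
  have hv₁ := memLp_comp_swap hv
  have h₁ := h.comp_swap
  rw [preimage_swap_rect] at hv₁ h₁
  obtain ⟨l, r, hlr⟩ := h₁.exists_hasEndIntegrals_fst hcd hab hv₁
  have hlr' := hlr.comp_swap
  rw [preimage_swap_rect] at hlr'
  exact ⟨l, r, hlr'⟩

end Rectangle

theorem sq_integral_le {α : Type*} [MeasurableSpace α] {μ : Measure α} [IsFiniteMeasure μ]
    {w : α → ℝ} (hw : MemLp w 2 μ) : (∫ x, w x ∂μ) ^ 2 ≤ μ.real Set.univ * ∫ x, w x ^ 2 ∂μ := by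
  have hw₁ : Integrable w μ := hw.integrable (by norm_num)
  have hquad (t : ℝ) :
      0 ≤ μ.real Set.univ * (t * t) + (-2 * ∫ x, w x ∂μ) * t + ∫ x, w x ^ 2 ∂μ := by
    have heq : ∫ x, (w x - t) ^ 2 ∂μ
        = μ.real Set.univ * (t * t) + (-2 * ∫ x, w x ∂μ) * t + ∫ x, w x ^ 2 ∂μ := by
      simp only [sub_sq]
      have hlin : Integrable (fun x => 2 * w x * t) μ := (hw₁.const_mul 2).mul_const t
      rw [integral_add (f := fun x => w x ^ 2 - 2 * w x * t) (hw.integrable_sq.sub hlin)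
        (integrable_const _), integral_sub hw.integrable_sq hlin, integral_mul_const,
        integral_const_mul, integral_const, smul_eq_mul]
      ring
    exact heq ▸ integral_nonneg fun x => sq_nonneg _
  have hdiscrim := discrim_le_zero hquad
  rw [discrim] at hdiscrim
  linarith

theorem sq_integral_mul_le {α : Type*} [MeasurableSpace α] {μ : Measure α} [IsFiniteMeasure μ]
    {v g : α → ℝ} {K : ℝ} (hv : MemLp v 2 μ) (hg : AEStronglyMeasurable g μ)
    (hK : ∀ᵐ x ∂μ, |g x| ≤ K) :
    (∫ x, v x * g x ∂μ) ^ 2 ≤ K ^ 2 * (μ.real Set.univ * ∫ x, v x ^ 2 ∂μ) := by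
  have hvg : MemLp (fun x => v x * g x) 2 μ :=
    hv.of_le_mul (c := K) (hv.1.mul hg) (hK.mono fun x hx => by
      rw [norm_mul, mul_comm]
      exact mul_le_mul_of_nonneg_right hx (norm_nonneg _))
  have hmono : ∫ x, (v x * g x) ^ 2 ∂μ ≤ ∫ x, K ^ 2 * v x ^ 2 ∂μ :=
    integral_mono_ae hvg.integrable_sq (hv.integrable_sq.const_mul _) (hK.mono fun x hx => by
      simp only [mul_pow, mul_comm (v x ^ 2)]
      exact mul_le_mul_of_nonneg_right (sq_le_sq.2 (hx.trans (le_abs_self K))) (sq_nonneg _))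
  calc (∫ x, v x * g x ∂μ) ^ 2 ≤ μ.real Set.univ * ∫ x, (v x * g x) ^ 2 ∂μ := sq_integral_le hvg
    _ ≤ μ.real Set.univ * (K ^ 2 * ∫ x, v x ^ 2 ∂μ) := by
        rw [integral_const_mul] at hmono
        exact mul_le_mul_of_nonneg_left hmono measureReal_nonneg
    _ = K ^ 2 * (μ.real Set.univ * ∫ x, v x ^ 2 ∂μ) := by ring

section EndIntegrals

variable {S : Set (ℝ × ℝ)} {π : ℝ × ℝ → ℝ} {lo hi l r l' r' : ℝ} {v v' v'' : ℝ × ℝ → ℝ}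

theorem HasEndIntegrals.congr {w w' : ℝ × ℝ → ℝ} (h : HasEndIntegrals S π lo hi v v' l r)
    (hw : v =ᵐ[volume.restrict S] w) (hw' : v' =ᵐ[volume.restrict S] w') :
    HasEndIntegrals S π lo hi w w' l r := fun κ hκ =>
  (integral_congr_ae (by filter_upwards [hw, hw'] with p hp hp'; rw [hp, hp'])).trans (h κ hκ)

theorem HasEndIntegrals.sub_eq (h : HasEndIntegrals S π lo hi v v' l r) :
    r - l = ∫ p in S, v' p := by
  simpa using (h (fun _ => 1) contDiff_const).symm

theorem HasEndIntegrals.unique (hlohi : lo < hi) (h : HasEndIntegrals S π lo hi v v' l r)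
    (h' : HasEndIntegrals S π lo hi v v' l' r') : l = l' ∧ r = r' := by
  have hκ {κ : ℝ → ℝ} (hκ : ContDiff ℝ 1 κ) : r * κ hi - l * κ lo = r' * κ hi - l' * κ lo :=
    (h κ hκ).symm.trans (h' κ hκ)
  have hl := hκ (κ := fun t => hi - t) (by fun_prop)
  have hr := hκ (κ := fun t => t - lo) (by fun_prop)
  constructor <;> refine mul_left_cancel₀ (sub_pos.2 hlohi).ne' ?_
  · linear_combination -hl
  · linear_combination hr

variable [IsFiniteMeasure (volume.restrict S)]

theorem HasEndIntegrals.integral_add_integral (hS : MeasurableSet S) (hπ : Measurable π)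
    (hmem : Set.MapsTo π S (Set.Icc lo hi)) (hv : MemLp v 2 (volume.restrict S))
    (hv' : MemLp v' 2 (volume.restrict S)) (h : HasEndIntegrals S π lo hi v v' l r) {κ : ℝ → ℝ}
    (hκ : ContDiff ℝ 1 κ) :
    (∫ p in S, v p * deriv κ (π p)) + ∫ p in S, v' p * κ (π p) = r * κ hi - l * κ lo :=
  have hint := hv.integrable_mul
    (memLp_comp_of_mapsTo hS hπ isCompact_Icc hmem (hκ.continuous_deriv le_rfl))
  have hint' := hv'.integrable_mul (memLp_comp_of_mapsTo hS hπ isCompact_Icc hmem hκ.continuous)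
  (integral_add hint hint').symm.trans (h κ hκ)

theorem HasEndIntegrals.half_add_mul_sub (hS : MeasurableSet S) (hπ : Measurable π)
    (hmem : Set.MapsTo π S (Set.Icc lo hi)) (hv : MemLp v 2 (volume.restrict S))
    (hv' : MemLp v' 2 (volume.restrict S)) (h : HasEndIntegrals S π lo hi v v' l r) :
    (l + r) / 2 * (hi - lo) = (∫ p in S, v p) + ∫ p in S, v' p * (π p - (lo + hi) / 2) := by
  have key := h.integral_add_integral hS hπ hmem hv hv' (κ := fun t => t - (lo + hi) / 2)
    (by fun_prop)
  simp only [deriv_sub_const, deriv_id'', mul_one] at key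
  linarith

theorem HasEndIntegrals.integral_mul_sub (hS : MeasurableSet S) (hπ : Measurable π)
    (hmem : Set.MapsTo π S (Set.Icc lo hi)) (hv : MemLp v 2 (volume.restrict S))
    (hv' : MemLp v' 2 (volume.restrict S)) (h : HasEndIntegrals S π lo hi v v' l r) :
    ∫ p in S, v p * (π p - (lo + hi) / 2) = ∫ p in S, v' p * ((π p - lo) * (hi - π p) / 2) := by
  have hderiv : deriv (fun t => (t - lo) * (hi - t) / 2) = fun t => -(t - (lo + hi) / 2) := by
    funext t
    refine (((((hasDerivAt_id t).sub_const lo).mul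
      ((hasDerivAt_id t).const_sub hi)).div_const 2).deriv).trans ?_
    simp only [id]
    ring
  have key := h.integral_add_integral hS hπ hmem hv hv' (κ := fun t => (t - lo) * (hi - t) / 2)
    (by fun_prop)
  simp only [hderiv, mul_neg] at key
  rw [integral_neg] at key
  linear_combination -key

theorem HasEndIntegrals.integral_mul_sub_sub (hS : MeasurableSet S) (hπ : Measurable π)
    (hmem : Set.MapsTo π S (Set.Icc lo hi)) (hv : MemLp v 2 (volume.restrict S))
    (hv' : MemLp v' 2 (volume.restrict S)) (hv'' : MemLp v'' 2 (volume.restrict S))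
    (h : HasEndIntegrals S π lo hi v v' l r) (h' : HasEndIntegrals S π lo hi v' v'' l' r') :
    (∫ p in S, v p * (π p - (lo + hi) / 2)) - (hi - lo) ^ 2 / 12 * ∫ p in S, v' p
      = -∫ p in S, v'' p * ((π p - (lo + hi) / 2) * (π p - lo) * (hi - π p) / 6) := by
  have hderiv : deriv (fun t => (t - (lo + hi) / 2) * (t - lo) * (hi - t) / 6)
      = fun t => (t - lo) * (hi - t) / 2 - (hi - lo) ^ 2 / 12 := by
    funext t
    refine ((((((hasDerivAt_id t).sub_const ((lo + hi) / 2)).mul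
      ((hasDerivAt_id t).sub_const lo)).mul
      ((hasDerivAt_id t).const_sub hi)).div_const 6).deriv).trans ?_
    simp only [id, Pi.mul_apply]
    ring
  have key := h'.integral_add_integral hS hπ hmem hv' hv''
    (κ := fun t => (t - (lo + hi) / 2) * (t - lo) * (hi - t) / 6) (by fun_prop)
  have hint : Integrable (fun p => v' p * ((π p - lo) * (hi - π p) / 2)) (volume.restrict S) :=
    hv'.integrable_mul (memLp_comp_of_mapsTo hS hπ isCompact_Icc hmem
      (κ := fun t => (t - lo) * (hi - t) / 2) (by fun_prop))
  simp only [hderiv, mul_sub (v' _)] at key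
  rw [integral_sub hint ((hv'.integrable (by norm_num)).mul_const _), integral_mul_const] at key
  rw [h.integral_mul_sub hS hπ hmem hv hv']
  linear_combination key

theorem HasEndIntegrals.sq_integral_mul_sub_le (hS : MeasurableSet S) (hπ : Measurable π)
    (hmem : Set.MapsTo π S (Set.Icc lo hi)) (hv : MemLp v 2 (volume.restrict S))
    (hv' : MemLp v' 2 (volume.restrict S)) (h : HasEndIntegrals S π lo hi v v' l r) :
    (∫ p in S, v p * (π p - (lo + hi) / 2)) ^ 2
      ≤ ((hi - lo) ^ 2 / 8) ^ 2 * (volume.real S * ∫ p in S, v' p ^ 2) := by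
  rw [h.integral_mul_sub hS hπ hmem hv hv', ← measureReal_restrict_apply_univ S]
  refine sq_integral_mul_le hv' (by fun_prop) (ae_restrict_of_forall_mem hS fun p hp => ?_)
  obtain ⟨hlo, hhi⟩ := hmem hp
  rw [abs_of_nonneg (by nlinarith)]
  nlinarith [sq_nonneg (π p - lo - (hi - π p))]

theorem HasEndIntegrals.sq_integral_mul_sub_sub_le (hS : MeasurableSet S) (hπ : Measurable π)
    (hmem : Set.MapsTo π S (Set.Icc lo hi)) (hv : MemLp v 2 (volume.restrict S))
    (hv' : MemLp v' 2 (volume.restrict S)) (hv'' : MemLp v'' 2 (volume.restrict S))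
    (h : HasEndIntegrals S π lo hi v v' l r) (h' : HasEndIntegrals S π lo hi v' v'' l' r') :
    ((∫ p in S, v p * (π p - (lo + hi) / 2)) - (hi - lo) ^ 2 / 12 * ∫ p in S, v' p) ^ 2
      ≤ ((hi - lo) ^ 3 / 48) ^ 2 * (volume.real S * ∫ p in S, v'' p ^ 2) := by
  rw [h.integral_mul_sub_sub hS hπ hmem hv hv' hv'' h', neg_sq,
    ← measureReal_restrict_apply_univ S]
  refine sq_integral_mul_le hv'' (by fun_prop) (ae_restrict_of_forall_mem hS fun p hp => ?_)
  obtain ⟨hlo, hhi⟩ := hmem hp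
  have hmid : |π p - (lo + hi) / 2| ≤ (hi - lo) / 2 := abs_le.2 ⟨by linarith, by linarith⟩
  have hbubble : (π p - lo) * (hi - π p) ≤ ((hi - lo) / 2) ^ 2 := by
    nlinarith [sq_nonneg (π p - lo - (hi - π p))]
  have hnonneg : 0 ≤ (π p - lo) * (hi - π p) := mul_nonneg (sub_nonneg.2 hlo) (sub_nonneg.2 hhi)
  calc |(π p - (lo + hi) / 2) * (π p - lo) * (hi - π p) / 6|
      = |π p - (lo + hi) / 2| * ((π p - lo) * (hi - π p)) / 6 := by
        rw [mul_assoc, abs_div, abs_mul, abs_of_nonneg hnonneg,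
          abs_of_pos (by norm_num : (0 : ℝ) < 6)]
    _ ≤ (hi - lo) / 2 * ((hi - lo) / 2) ^ 2 / 6 := by
        have := mul_le_mul hmid hbubble hnonneg ((abs_nonneg _).trans hmid)
        linarith
    _ = (hi - lo) ^ 3 / 48 := by ring

end EndIntegrals

/-! ### Traces -/

theorem tendsto_integral_mul_of_tendsto_eLpNorm {α : Type*} [MeasurableSpace α] {μ : Measure α}
    {F : ℕ → α → ℝ} {f κ : α → ℝ} (hF : ∀ k, MemLp (F k) 2 μ) (hf : MemLp f 2 μ)
    (hκ : MemLp κ 2 μ) (h : Tendsto (fun k => eLpNorm (F k - f) 2 μ) atTop (𝓝 0)) :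
    Tendsto (fun k => ∫ p, F k p * κ p ∂μ) atTop (𝓝 (∫ p, f p * κ p ∂μ)) := by
  have hbound (k : ℕ) : eLpNorm ((fun p => F k p * κ p) - fun p => f p * κ p) 1 μ
      ≤ eLpNorm (F k - f) 2 μ * eLpNorm κ 2 μ := by
    have hholder := eLpNorm_le_eLpNorm_mul_eLpNorm_of_nnnorm (p := 2) (q := 2) (r := 1)
      ((hF k).sub hf).aestronglyMeasurable hκ.aestronglyMeasurable (fun x y : ℝ => x * y) 1
      (Eventually.of_forall fun x => by simp)
    simpa only [Pi.sub_apply, sub_mul, ENNReal.coe_one, one_mul, Pi.sub_def] using hholder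
  have hlim : Tendsto (fun k => eLpNorm (F k - f) 2 μ * eLpNorm κ 2 μ) atTop (𝓝 0) := by
    simpa only [zero_mul] using ENNReal.Tendsto.mul_const h (Or.inr hκ.eLpNorm_ne_top)
  exact tendsto_integral_of_L1' _ (hf.integrable_mul hκ).aestronglyMeasurable
    (Eventually.of_forall fun k => (hF k).integrable_mul hκ)
    (tendsto_of_tendsto_of_tendsto_of_le_of_le tendsto_const_nhds hlim (fun _ => zero_le) hbound)

section Trace

variable {a b c d : ℝ} {S U : Set (ℝ × ℝ)} {e e₀ e₁ : Seg} {t t₀ t₁ : ℝ} {v v' : ℝ × ℝ → ℝ}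

theorem hasEndIntegrals_fst_of_contDiff (hab : a ≤ b) (hcd : c ≤ d) {φ : ℝ × ℝ → ℝ}
    (hφ : ContDiff ℝ ∞ φ) :
    HasEndIntegrals (rect a b c d) Prod.fst a b φ (dx φ) (Seg.int ⟨true, a, c, d⟩ φ)
      (Seg.int ⟨true, b, c, d⟩ φ) := by
  intro κ hκ
  have := hκ.continuous_deriv le_rfl
  have := (contDiff_dx hφ).continuous
  have hint : IntegrableOn (fun p => φ p * deriv κ p.1 + dx φ p * κ p.1) (rect a b c d) :=
    (memLp_rect_of_continuous (by fun_prop)).integrable (by norm_num)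
  have hparts (y : ℝ) : ∫ x in Set.Ioo a b, (φ (x, y) * deriv κ x + dx φ (x, y) * κ x)
      = φ (b, y) * κ b - φ (a, y) * κ a := by
    rw [← integral_Ioc_eq_integral_Ioo, ← intervalIntegral.integral_of_le hab]
    refine intervalIntegral.integral_eq_sub_of_hasDerivAt (f := fun x => φ (x, y) * κ x)
      (fun x _ => ?_) (Continuous.intervalIntegrable (by fun_prop) _ _)
    exact ((hasDerivAt_dx (hφ.differentiable (by simp) (x, y))).mul
      (hκ.differentiable one_ne_zero x).hasDerivAt).congr_deriv (add_comm _ _)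
  calc ∫ p in rect a b c d, (φ p * deriv κ p.1 + dx φ p * κ p.1)
      = ∫ y in Set.Ioo c d, ∫ x in Set.Ioo a b, (φ (x, y) * deriv κ x + dx φ (x, y) * κ x) := by
        rw [IntegrableOn, Measure.volume_eq_prod, ← Measure.prod_restrict] at hint
        rw [Measure.volume_eq_prod, ← Measure.prod_restrict, integral_prod_symm _ hint]
    _ = ∫ y in c..d, (φ (b, y) * κ b - φ (a, y) * κ a) := by
        simp only [hparts, intervalIntegral.integral_of_le hcd, integral_Ioc_eq_integral_Ioo]
    _ = Seg.int ⟨true, b, c, d⟩ φ * κ b - Seg.int ⟨true, a, c, d⟩ φ * κ a := by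
        rw [intervalIntegral.integral_sub (Continuous.intervalIntegrable (by fun_prop) _ _)
          (Continuous.intervalIntegrable (by fun_prop) _ _), intervalIntegral.integral_mul_const,
          intervalIntegral.integral_mul_const]
        rfl

theorem hasEndIntegrals_snd_of_contDiff (hab : a ≤ b) (hcd : c ≤ d) {φ : ℝ × ℝ → ℝ}
    (hφ : ContDiff ℝ ∞ φ) :
    HasEndIntegrals (rect a b c d) Prod.snd c d φ (dy φ) (Seg.int ⟨false, c, a, b⟩ φ)
      (Seg.int ⟨false, d, a, b⟩ φ) := by
  have hφ' : ContDiff ℝ ∞ (φ ∘ Prod.swap) := hφ.comp (contDiff_snd.prodMk contDiff_fst)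
  have h := (hasEndIntegrals_fst_of_contDiff hcd hab hφ').comp_swap
  rw [preimage_swap_rect, dx_comp_swap] at h
  exact h

theorem Seg.continuous_pt (e : Seg) : Continuous e.pt := by
  unfold Seg.pt
  split_ifs <;> fun_prop

theorem HasTraceMean.exists_contDiff_tendsto (he : e.lo < e.hi) (h : HasTraceMean U e v t) :
    ∃ φ : ℕ → ℝ × ℝ → ℝ, (∀ k, ContDiff ℝ ∞ (φ k)) ∧
      Tendsto (fun k => eLpNorm (φ k - v) 2 (volume.restrict U)) atTop (𝓝 0) ∧
      Tendsto (fun k => eLpNorm (dx (φ k) - weakDeriv U 1 0 v) 2 (volume.restrict U))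
        atTop (𝓝 0) ∧
      Tendsto (fun k => eLpNorm (dy (φ k) - weakDeriv U 0 1 v) 2 (volume.restrict U))
        atTop (𝓝 0) ∧
      Tendsto (fun k => e.int (φ k)) atTop (𝓝 (e.len * t)) := by
  obtain ⟨g, ⟨-, hg, φ, hφ, hlim, hlim_dx, hlim_dy, hlim_trace⟩, rfl⟩ := h
  refine ⟨φ, hφ, hlim, hlim_dx, hlim_dy, ?_⟩
  have hφe (k : ℕ) : MemLp (fun τ => φ k (e.pt τ)) 2 (volume.restrict (Set.Ioc e.lo e.hi)) :=
    memLp_comp_of_mapsTo measurableSet_Ioc measurable_id isCompact_Icc Set.Ioc_subset_Icc_self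
      ((hφ k).continuous.comp e.continuous_pt)
  have hint := tendsto_integral_mul_of_tendsto_eLpNorm hφe hg (memLp_const (1 : ℝ)) hlim_trace
  have hlen : e.len ≠ 0 := (sub_pos.2 he).ne'
  rw [Seg.mean, mul_div_cancel₀ _ hlen]
  simpa only [mul_one, Seg.int, intervalIntegral.integral_of_le he.le] using hint

theorem HasEndIntegrals.tendsto [IsFiniteMeasure (volume.restrict S)] {π : ℝ × ℝ → ℝ}
    (hS : MeasurableSet S) (hπ : Measurable π) (hmem : Set.MapsTo π S (Set.Icc a b)) (hab : a < b)
    {V V' : ℕ → ℝ × ℝ → ℝ} {L R : ℕ → ℝ} {l r : ℝ}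
    (hV : ∀ k, MemLp (V k) 2 (volume.restrict S)) (hV' : ∀ k, MemLp (V' k) 2 (volume.restrict S))
    (hv : MemLp v 2 (volume.restrict S)) (hv' : MemLp v' 2 (volume.restrict S))
    (hlim : Tendsto (fun k => eLpNorm (V k - v) 2 (volume.restrict S)) atTop (𝓝 0))
    (hlim' : Tendsto (fun k => eLpNorm (V' k - v') 2 (volume.restrict S)) atTop (𝓝 0))
    (hE : ∀ k, HasEndIntegrals S π a b (V k) (V' k) (L k) (R k))
    (h : HasEndIntegrals S π a b v v' l r) :
    Tendsto L atTop (𝓝 l) ∧ Tendsto R atTop (𝓝 r) := by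
  have hκ {κ : ℝ → ℝ} (hκ : ContDiff ℝ 1 κ) :
      Tendsto (fun k => R k * κ b - L k * κ a) atTop (𝓝 (r * κ b - l * κ a)) := by
    rw [← h.integral_add_integral hS hπ hmem hv hv' hκ]
    simp only [← (hE _).integral_add_integral hS hπ hmem (hV _) (hV' _) hκ]
    exact (tendsto_integral_mul_of_tendsto_eLpNorm hV hv (memLp_comp_of_mapsTo hS hπ
        isCompact_Icc hmem (hκ.continuous_deriv le_rfl)) hlim).add
      (tendsto_integral_mul_of_tendsto_eLpNorm hV' hv' (memLp_comp_of_mapsTo hS hπ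
        isCompact_Icc hmem hκ.continuous) hlim')
  have hne : b - a ≠ 0 := (sub_pos.2 hab).ne'
  have hL := (hκ (κ := fun t => t - b) (by fun_prop)).div_const (b - a)
  have hR := (hκ (κ := fun t => t - a) (by fun_prop)).div_const (b - a)
  refine ⟨?_, ?_⟩
  · refine (hL.congr fun k => ?_).trans (le_of_eq (congrArg 𝓝 ?_)) <;> field_simp <;> ring
  · refine (hR.congr fun k => ?_).trans (le_of_eq (congrArg 𝓝 ?_)) <;> field_simp <;> ring

theorem tendsto_eLpNorm_restrict_mono (hSU : S ⊆ U) {F : ℕ → ℝ × ℝ → ℝ}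
    (h : Tendsto (fun k => eLpNorm (F k) 2 (volume.restrict U)) atTop (𝓝 0)) :
    Tendsto (fun k => eLpNorm (F k) 2 (volume.restrict S)) atTop (𝓝 0) :=
  tendsto_of_tendsto_of_tendsto_of_le_of_le tendsto_const_nhds h (fun _ => zero_le) fun _ =>
    eLpNorm_mono_measure _ (Measure.restrict_mono_set volume hSU)

theorem HasTraceMean.hasEndIntegrals_fst (hab : a < b) (hcd : c < d) (hU : MeasurableSet U)
    (hSU : rect a b c d ⊆ U) (h₀ : HasTraceMean U ⟨true, a, c, d⟩ v t₀)
    (h₁ : HasTraceMean U ⟨true, b, c, d⟩ v t₁) :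
    HasEndIntegrals (rect a b c d) Prod.fst a b v (weakDeriv U 1 0 v) ((d - c) * t₀)
      ((d - c) * t₁) := by
  have hle := Measure.restrict_mono_set (μ := volume) hSU
  have hv : MemH 1 U v := h₀.choose_spec.1.1
  have hS := hv.1.mono_measure hle
  have hd := (hv.isWeakDeriv (α := 1) (β := 0) le_rfl).restrict hSU hU
  obtain ⟨l, r, h⟩ := hd.exists_hasEndIntegrals_fst hab hcd hS
  have hends {φ : ℕ → ℝ × ℝ → ℝ} (hφ : ∀ k, ContDiff ℝ ∞ (φ k))
      (hlim : Tendsto (fun k => eLpNorm (φ k - v) 2 (volume.restrict U)) atTop (𝓝 0))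
      (hlim' : Tendsto (fun k => eLpNorm (dx (φ k) - weakDeriv U 1 0 v) 2 (volume.restrict U))
        atTop (𝓝 0)) :
      Tendsto (fun k => Seg.int ⟨true, a, c, d⟩ (φ k)) atTop (𝓝 l) ∧
        Tendsto (fun k => Seg.int ⟨true, b, c, d⟩ (φ k)) atTop (𝓝 r) :=
    HasEndIntegrals.tendsto measurableSet_rect measurable_fst
      (fun p hp => Set.Ioo_subset_Icc_self hp.1) hab
      (fun k => memLp_rect_of_continuous (hφ k).continuous)
      (fun k => memLp_rect_of_continuous (contDiff_dx (hφ k)).continuous) hS hd.1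
      (tendsto_eLpNorm_restrict_mono hSU hlim) (tendsto_eLpNorm_restrict_mono hSU hlim')
      (fun k => hasEndIntegrals_fst_of_contDiff hab.le hcd.le (hφ k)) h
  obtain ⟨φ, hφ, hφ_lim, hφ_dx, -, hφ_int⟩ := h₀.exists_contDiff_tendsto hcd
  obtain ⟨ψ, hψ, hψ_lim, hψ_dx, -, hψ_int⟩ := h₁.exists_contDiff_tendsto hcd
  have hl : (d - c) * t₀ = l := tendsto_nhds_unique hφ_int (hends hφ hφ_lim hφ_dx).1
  have hr : (d - c) * t₁ = r := tendsto_nhds_unique hψ_int (hends hψ hψ_lim hψ_dx).2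
  rwa [hl, hr]

theorem HasTraceMean.hasEndIntegrals_snd (hab : a < b) (hcd : c < d) (hU : MeasurableSet U)
    (hSU : rect a b c d ⊆ U) (h₀ : HasTraceMean U ⟨false, c, a, b⟩ v t₀)
    (h₁ : HasTraceMean U ⟨false, d, a, b⟩ v t₁) :
    HasEndIntegrals (rect a b c d) Prod.snd c d v (weakDeriv U 0 1 v) ((b - a) * t₀)
      ((b - a) * t₁) := by
  have hle := Measure.restrict_mono_set (μ := volume) hSU
  have hv : MemH 1 U v := h₀.choose_spec.1.1
  have hS := hv.1.mono_measure hle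
  have hd := (hv.isWeakDeriv (α := 0) (β := 1) le_rfl).restrict hSU hU
  obtain ⟨l, r, h⟩ := hd.exists_hasEndIntegrals_snd hab hcd hS
  have hends {φ : ℕ → ℝ × ℝ → ℝ} (hφ : ∀ k, ContDiff ℝ ∞ (φ k))
      (hlim : Tendsto (fun k => eLpNorm (φ k - v) 2 (volume.restrict U)) atTop (𝓝 0))
      (hlim' : Tendsto (fun k => eLpNorm (dy (φ k) - weakDeriv U 0 1 v) 2 (volume.restrict U))
        atTop (𝓝 0)) :
      Tendsto (fun k => Seg.int ⟨false, c, a, b⟩ (φ k)) atTop (𝓝 l) ∧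
        Tendsto (fun k => Seg.int ⟨false, d, a, b⟩ (φ k)) atTop (𝓝 r) :=
    HasEndIntegrals.tendsto measurableSet_rect measurable_snd
      (fun p hp => Set.Ioo_subset_Icc_self hp.2) hcd
      (fun k => memLp_rect_of_continuous (hφ k).continuous)
      (fun k => memLp_rect_of_continuous (contDiff_dy (hφ k)).continuous) hS hd.1
      (tendsto_eLpNorm_restrict_mono hSU hlim) (tendsto_eLpNorm_restrict_mono hSU hlim')
      (fun k => hasEndIntegrals_snd_of_contDiff hab.le hcd.le (hφ k)) h
  obtain ⟨φ, hφ, hφ_lim, -, hφ_dy, hφ_int⟩ := h₀.exists_contDiff_tendsto hab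
  obtain ⟨ψ, hψ, hψ_lim, -, hψ_dy, hψ_int⟩ := h₁.exists_contDiff_tendsto hab
  have hl : (b - a) * t₀ = l := tendsto_nhds_unique hφ_int (hends hφ hφ_lim hφ_dy).1
  have hr : (b - a) * t₁ = r := tendsto_nhds_unique hψ_int (hends hψ hψ_lim hψ_dy).2
  rwa [hl, hr]

theorem IsTrace.subsegment {vert : Bool} {g : ℝ × ℝ → ℝ} {c lo hi lo' hi' : ℝ}
    (h : IsTrace U ⟨vert, c, lo, hi⟩ v g) (hlo : lo ≤ lo') (hhi : hi' ≤ hi) :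
    IsTrace U ⟨vert, c, lo', hi'⟩ v g := by
  obtain ⟨hv, hg, φ, hφ, hlim, hlim_dx, hlim_dy, hlim_trace⟩ := h
  have hmono := Measure.restrict_mono (μ := (volume : Measure ℝ))
    (Set.Ioc_subset_Ioc hlo hhi) le_rfl
  exact ⟨hv, hg.mono_measure hmono, φ, hφ, hlim, hlim_dx, hlim_dy,
    tendsto_of_tendsto_of_tendsto_of_le_of_le tendsto_const_nhds hlim_trace (fun _ => zero_le)
      fun k => eLpNorm_mono_measure _ hmono⟩

end Trace

/-! ### Geometry of the mesh -/

section Grid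

variable {n : ℕ} {x : Fin (n + 1) → ℝ}

theorem exists_mem_Ioo_of_forall_ne {t : ℝ} (h₀ : x 0 < t) (h₁ : t < x (Fin.last n))
    (hne : ∀ i, x i ≠ t) : ∃ i : Fin n, t ∈ Set.Ioo (x i.castSucc) (x i.succ) := by
  by_contra! h
  have hlt : ∀ i, x i < t := Fin.induction h₀ fun i hi =>
    lt_of_le_of_ne (not_lt.1 fun h' => h i ⟨hi, h'⟩) (hne _)
  exact lt_asymm h₁ (hlt _)

theorem disjoint_Ioo_of_ne (hx : StrictMono x) {i j : Fin n} (hij : i ≠ j) :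
    Disjoint (Set.Ioo (x i.castSucc) (x i.succ)) (Set.Ioo (x j.castSucc) (x j.succ)) := by
  wlog h : i < j
  · exact (this hx hij.symm (lt_of_le_of_ne (not_lt.1 h) hij.symm)).symm
  rw [Set.disjoint_left]
  intro t hi hj
  exact lt_asymm hi.2 ((hx.monotone (Fin.succ_le_castSucc_iff.2 h)).trans_lt hj.1)

end Grid

open Mesh

section Geometry

variable {M : Mesh} {T T' : M.Elem}

theorem x_lt (T : M.Elem) : M.x T.1.castSucc < M.x T.1.succ := M.x_mono Fin.castSucc_lt_succ

theorem y_lt (T : M.Elem) : M.y T.2.castSucc < M.y T.2.succ := M.y_mono Fin.castSucc_lt_succ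

theorem x_mem_Icc (i : Fin (M.n + 1)) : M.x i ∈ Set.Icc 0 1 :=
  ⟨M.x_zero ▸ M.x_mono.monotone (Fin.zero_le i), M.x_last ▸ M.x_mono.monotone (Fin.le_last i)⟩

theorem y_mem_Icc (i : Fin (M.m + 1)) : M.y i ∈ Set.Icc 0 1 :=
  ⟨M.y_zero ▸ M.y_mono.monotone (Fin.zero_le i), M.y_last ▸ M.y_mono.monotone (Fin.le_last i)⟩

theorem measurableSet_interior (T : M.Elem) : MeasurableSet (interior T) := measurableSet_rect

theorem isOpen_interior (T : M.Elem) : IsOpen (interior T) := isOpen_rect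

theorem measurableSet_Omega : MeasurableSet Omega := measurableSet_rect

instance isFiniteMeasure_restrict_interior (T : M.Elem) :
    IsFiniteMeasure (volume.restrict (interior T)) :=
  isFiniteMeasure_restrict_rect

theorem volume_real_interior (T : M.Elem) : volume.real (interior T) = area T :=
  volume_real_rect (x_lt T).le (y_lt T).le

theorem interior_subset_Omega (T : M.Elem) : interior T ⊆ Omega :=
  Set.prod_mono (Set.Ioo_subset_Ioo (x_mem_Icc _).1 (x_mem_Icc _).2)
    (Set.Ioo_subset_Ioo (y_mem_Icc _).1 (y_mem_Icc _).2)

theorem disjoint_interior (h : T ≠ T') : Disjoint (interior T) (interior T') := by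
  by_cases h₁ : T.1 = T'.1
  · exact Set.disjoint_prod.2 (Or.inr (disjoint_Ioo_of_ne M.y_mono fun h₂ => h (Prod.ext h₁ h₂)))
  · exact Set.disjoint_prod.2 (Or.inl (disjoint_Ioo_of_ne M.x_mono h₁))

theorem Omega_ae_eq_biUnion_interior (M : Mesh) :
    Omega =ᵐ[volume] ⋃ T ∈ (Finset.univ : Finset M.Elem), interior T := by
  have hx : ∀ᵐ p : ℝ × ℝ, p.1 ∉ Set.range M.x :=
    Measure.quasiMeasurePreserving_fst.ae ((Set.finite_range M.x).countable.ae_notMem volume)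
  have hy : ∀ᵐ p : ℝ × ℝ, p.2 ∉ Set.range M.y :=
    Measure.quasiMeasurePreserving_snd.ae ((Set.finite_range M.y).countable.ae_notMem volume)
  filter_upwards [hx, hy] with p hpx hpy
  refine propext ⟨fun hp => ?_, fun hp => ?_⟩
  · obtain ⟨i, hi⟩ := exists_mem_Ioo_of_forall_ne (M.x_zero ▸ hp.1.1) (M.x_last ▸ hp.1.2)
      fun i h => hpx ⟨i, h⟩
    obtain ⟨j, hj⟩ := exists_mem_Ioo_of_forall_ne (M.y_zero ▸ hp.2.1) (M.y_last ▸ hp.2.2)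
      fun j h => hpy ⟨j, h⟩
    exact Set.mem_iUnion₂.2 ⟨(i, j), Finset.mem_univ _, hi, hj⟩
  · obtain ⟨T, -, hT⟩ := Set.mem_iUnion₂.1 hp
    exact interior_subset_Omega T hT

theorem sum_setIntegral_interior {F : ℝ × ℝ → ℝ} (hF : IntegrableOn F Omega) :
    ∑ T : M.Elem, ∫ p in interior T, F p = ∫ p in Omega, F p := by
  rw [setIntegral_congr_set (Omega_ae_eq_biUnion_interior M),
    integral_biUnion_finset Finset.univ (fun T _ => measurableSet_interior T)
      (fun _ _ _ _ h => disjoint_interior h) fun T _ => hF.mono_set (interior_subset_Omega T)]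

theorem n_pos (M : Mesh) : 0 < M.n := by
  by_contra! h
  have hlast : Fin.last M.n = 0 := Fin.ext (Nat.le_zero.1 h)
  exact one_ne_zero (M.x_last.symm.trans ((congrArg M.x hlast).trans M.x_zero))

theorem m_pos (M : Mesh) : 0 < M.m := by
  by_contra! h
  have hlast : Fin.last M.m = 0 := Fin.ext (Nat.le_zero.1 h)
  exact one_ne_zero (M.y_last.symm.trans ((congrArg M.y hlast).trans M.y_zero))

theorem sqrt_le_h (T : M.Elem) : √(hx T ^ 2 + hy T ^ 2) ≤ M.h :=
  le_ciSup (f := fun T : M.Elem => √(hx T ^ 2 + hy T ^ 2)) (Set.finite_range _).bddAbove T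

theorem hx_le_h (T : M.Elem) : hx T ≤ M.h :=
  (Real.le_sqrt_of_sq_le (by linarith [sq_nonneg (hy T)])).trans (sqrt_le_h T)

theorem hy_le_h (T : M.Elem) : hy T ≤ M.h :=
  (Real.le_sqrt_of_sq_le (by linarith [sq_nonneg (hx T)])).trans (sqrt_le_h T)

theorem h_pos (M : Mesh) : 0 < M.h :=
  (hx_pos (M := M) (⟨0, n_pos M⟩, ⟨0, m_pos M⟩)).trans_le (hx_le_h _)

theorem area_pos (T : M.Elem) : 0 < area T := mul_pos (hx_pos T) (hy_pos T)

/-- The abscissa of the centre of `T`. -/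
def xMid (T : M.Elem) : ℝ := (M.x T.1.castSucc + M.x T.1.succ) / 2

/-- The ordinate of the centre of `T`. -/
def yMid (T : M.Elem) : ℝ := (M.y T.2.castSucc + M.y T.2.succ) / 2

theorem exists_edge_eq (e : M.Edge) : ∃ (T : M.Elem) (s : Fin 4), edge T s = e := by
  rcases e with ⟨i, j⟩ | ⟨i, j⟩
  · rcases i.eq_zero_or_eq_succ with rfl | ⟨i, rfl⟩
    · exact ⟨(⟨0, n_pos M⟩, j), 0, rfl⟩
    · exact ⟨(i, j), 1, rfl⟩
  · rcases j.eq_zero_or_eq_succ with rfl | ⟨j, rfl⟩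
    · exact ⟨(i, ⟨0, m_pos M⟩), 2, rfl⟩
    · exact ⟨(i, j), 3, rfl⟩

/-! ### Edge averages of the solution -/

variable {u g : ℝ × ℝ → ℝ} {Qu Qu' : M.Edge → ℝ}

theorem IsEdgeProjection.hasEndIntegrals_fst (hQ : IsEdgeProjection u Qu) (T : M.Elem) :
    HasEndIntegrals (interior T) Prod.fst (M.x T.1.castSucc) (M.x T.1.succ) u
      (weakDeriv Omega 1 0 u) (hy T * Qu (edge T 0)) (hy T * Qu (edge T 1)) :=
  HasTraceMean.hasEndIntegrals_fst (x_lt T) (y_lt T) measurableSet_Omega (interior_subset_Omega T)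
    (hQ (edge T 0)) (hQ (edge T 1))

theorem IsEdgeProjection.hasEndIntegrals_snd (hQ : IsEdgeProjection u Qu) (T : M.Elem) :
    HasEndIntegrals (interior T) Prod.snd (M.y T.2.castSucc) (M.y T.2.succ) u
      (weakDeriv Omega 0 1 u) (hx T * Qu (edge T 2)) (hx T * Qu (edge T 3)) :=
  HasTraceMean.hasEndIntegrals_snd (x_lt T) (y_lt T) measurableSet_Omega (interior_subset_Omega T)
    (hQ (edge T 2)) (hQ (edge T 3))

theorem IsEdgeProjection.unique (hQ : IsEdgeProjection u Qu) (hQ' : IsEdgeProjection u Qu') :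
    Qu = Qu' := by
  funext e
  obtain ⟨T, s, rfl⟩ := exists_edge_eq e
  have hv := (hQ.hasEndIntegrals_fst T).unique (x_lt T) (hQ'.hasEndIntegrals_fst T)
  have hh := (hQ.hasEndIntegrals_snd T).unique (y_lt T) (hQ'.hasEndIntegrals_snd T)
  fin_cases s
  · exact mul_left_cancel₀ (hy_pos T).ne' hv.1
  · exact mul_left_cancel₀ (hy_pos T).ne' hv.2
  · exact mul_left_cancel₀ (hx_pos T).ne' hh.1
  · exact mul_left_cancel₀ (hx_pos T).ne' hh.2

theorem isTrace_seg_of_isBdry (hg : ∀ s, IsTrace Omega (side s) u g) {e : M.Edge}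
    (he : IsBdry e) : IsTrace Omega (seg e) u g := by
  rcases e with ⟨i, j⟩ | ⟨i, j⟩
  · have hlo := (y_mem_Icc (M := M) j.castSucc).1
    have hhi := (y_mem_Icc (M := M) j.succ).2
    rcases he with rfl | rfl
    · simpa [seg, M.x_zero] using (hg 0).subsegment hlo hhi
    · simpa [seg, M.x_last] using (hg 1).subsegment hlo hhi
  · have hlo := (x_mem_Icc (M := M) i.castSucc).1
    have hhi := (x_mem_Icc (M := M) i.succ).2
    rcases he with rfl | rfl
    · simpa [seg, M.y_zero] using (hg 2).subsegment hlo hhi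
    · simpa [seg, M.y_last] using (hg 3).subsegment hlo hhi

theorem IsEdgeProjection.eq_mean_of_isBdry (hQ : IsEdgeProjection u Qu)
    (hg : ∀ s, IsTrace Omega (side s) u g) {e : M.Edge} (he : IsBdry e) :
    Qu e = (seg e).mean g := by
  classical
  have hQ' : IsEdgeProjection u (Function.update Qu e ((seg e).mean g)) := fun e' => by
    rcases eq_or_ne e' e with rfl | hne
    · simpa only [Function.update_self] using ⟨g, isTrace_seg_of_isBdry hg he, rfl⟩
    · simpa only [Function.update_of_ne hne] using hQ e'
  simpa only [Function.update_self] using congrFun (hQ.unique hQ') e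

theorem IsEdgeProjection.mul_sub_eq_integral (hQ : IsEdgeProjection u Qu) (T : M.Elem) :
    hy T * (Qu (edge T 1) - Qu (edge T 0)) = (∫ p in interior T, weakDeriv Omega 1 0 u p) ∧
      hx T * (Qu (edge T 3) - Qu (edge T 2)) = ∫ p in interior T, weakDeriv Omega 0 1 u p := by
  simp only [mul_sub]
  exact ⟨(hQ.hasEndIntegrals_fst T).sub_eq, (hQ.hasEndIntegrals_snd T).sub_eq⟩

end Geometry

/-! ### Conservation of the normal flux -/

section Conservation

theorem exists_isTestIoo_eq_nodes {n : ℕ} {x : Fin (n + 1) → ℝ} (hx : StrictMono x)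
    (hlt : x 0 < x (Fin.last n)) {c : Fin (n + 1) → ℝ} (h₀ : c 0 = 0) (h₁ : c (Fin.last n) = 0) :
    ∃ η, IsTestIoo (x 0) (x (Fin.last n)) η ∧ ∀ i, η (x i) = c i := by
  obtain ⟨θ, hθ, -, hθ_one⟩ := exists_isTestIoo_eventually_eq_one hlt
  have hnodes : ∀ᶠ k in atTop, ∀ i, x i ∈ Set.Ioo (x 0) (x (Fin.last n)) → θ k (x i) = 1 :=
    eventually_all.2 fun i => eventually_imp_distrib_left.2 (hθ_one (x i))
  obtain ⟨k, hk⟩ := hnodes.exists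
  let P : Polynomial ℝ := Lagrange.interpolate Finset.univ x c
  have hP_smooth : ContDiff ℝ ∞ fun t => P.eval t := by
    simpa only [Polynomial.coe_aeval_eq_eval] using P.contDiff_aeval (𝕜 := ℝ) ∞
  refine ⟨fun t => P.eval t * θ k t, ⟨hP_smooth.mul (hθ k).1, (hθ k).2.1.mul_left,
    (tsupport_mul_subset_right).trans (hθ k).2.2⟩, fun i => ?_⟩
  have hP : P.eval (x i) = c i :=
    Lagrange.eval_interpolate_at_node c hx.injective.injOn (Finset.mem_univ i)
  by_cases hi : x i ∈ Set.Ioo (x 0) (x (Fin.last n))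
  · simp only [hP, hk i hi, mul_one]
  · have hend : i = 0 ∨ i = Fin.last n := by
      by_contra! h
      exact hi ⟨hx (Fin.pos_iff_ne_zero.2 h.1), hx (Fin.lt_last_iff_ne_last.2 h.2)⟩
    rcases hend with rfl | rfl <;> simp only [(hθ k).eq_zero hi, mul_zero, h₀, h₁]

/-- Choosing `η` with prescribed values at the nodes avoids gluing neighbouring elements. -/
theorem sum_endIntegrals_mul_eq_zero {n : ℕ} {x : Fin (n + 1) → ℝ} (hx : StrictMono x)
    (hlt : x 0 < x (Fin.last n)) {S : Fin n → Set (ℝ × ℝ)} {π : ℝ × ℝ → ℝ}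
    {v v' : Fin n → ℝ × ℝ → ℝ} {l r : Fin n → ℝ}
    (hE : ∀ i, HasEndIntegrals (S i) π (x i.castSucc) (x i.succ) (v i) (v' i) (l i) (r i))
    (h : ∀ η, IsTestIoo (x 0) (x (Fin.last n)) η →
      ∑ i, ∫ p in S i, (v i p * deriv η (π p) + v' i p * η (π p)) = 0)
    {c : Fin (n + 1) → ℝ} (h₀ : c 0 = 0) (h₁ : c (Fin.last n) = 0) :
    ∑ i, (r i * c i.succ - l i * c i.castSucc) = 0 := by
  obtain ⟨η, hη, hηc⟩ := exists_isTestIoo_eq_nodes hx hlt h₀ h₁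
  have hsum := h η hη
  simp only [fun i => hE i η (hη.1.of_le (by norm_num)), hηc] at hsum
  exact hsum

theorem sum_setIntegral_eq_zero_of_forall_isTestIoo {ι : Type*} [Fintype ι] {c d : ℝ}
    (hcd : c < d) {S : ι → Set (ℝ × ℝ)} (hS : ∀ i, MeasurableSet (S i)) {π : ℝ × ℝ → ℝ}
    (hπ : Measurable π) (hmem : ∀ i, Set.MapsTo π (S i) (Set.Ioo c d)) {F : ι → ℝ × ℝ → ℝ}
    (hF : ∀ i, IntegrableOn (F i) (S i))
    (h : ∀ χ, IsTestIoo c d χ → ∑ i, ∫ p in S i, F i p * χ (π p) = 0) :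
    ∑ i, ∫ p in S i, F i p = 0 := by
  obtain ⟨θ, hθ, hθ_le, hθ_one⟩ := exists_isTestIoo_eventually_eq_one hcd
  have hlim (i : ι) : Tendsto (fun k => ∫ p in S i, F i p * θ k (π p)) atTop
      (𝓝 (∫ p in S i, F i p)) := by
    refine tendsto_integral_of_dominated_convergence (fun p => ‖F i p‖)
      (fun k => (hF i).1.mul ((hθ k).1.continuous.measurable.comp hπ).aestronglyMeasurable)
      (hF i).norm (fun k => Eventually.of_forall fun p => ?_)
      (ae_restrict_of_forall_mem (hS i) fun p hp => ?_)
    · rw [norm_mul]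
      exact mul_le_of_le_one_right (norm_nonneg _) (hθ_le k _)
    · exact tendsto_const_nhds.congr' ((hθ_one _ (hmem i hp)).mono fun k hk => by
        simp only [hk, mul_one])
  refine tendsto_nhds_unique (tendsto_finsetSum _ fun i _ => hlim i) ?_
  simp only [fun k => h (θ k) (hθ k), tendsto_const_nhds]

theorem setIntegral_eq_zero_of_disjoint {S U : Set (ℝ × ℝ)} {φ : ℝ × ℝ → ℝ}
    (hφ : IsTest U φ) (hSU : Disjoint S U) (F G H : ℝ × ℝ → ℝ) :
    ∫ p in S, (F p * dx φ p + G p * dy φ p + H p * φ p) = 0 :=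
  setIntegral_eq_zero_of_forall_eq_zero fun p hp => by
    have hpU : p ∉ U := Set.disjoint_left.1 hSU hp
    rw [hφ.dx.eq_zero hpU, hφ.dy.eq_zero hpU, hφ.eq_zero hpU]
    ring

variable {a b c d : ℝ} {q₁ q₂ d₁ d₂ : ℝ × ℝ → ℝ} {η χ : ℝ → ℝ}

theorem integral_flux_mul_fst_snd (hq₁ : IntegrableOn q₁ (rect a b c d))
    (hq₂ : IntegrableOn q₂ (rect a b c d)) (hd₁ : IntegrableOn d₁ (rect a b c d))
    (hd₂ : IntegrableOn d₂ (rect a b c d)) (hη : ContDiff ℝ ∞ η) (hχ : ContDiff ℝ ∞ χ) :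
    ∫ p in rect a b c d, (q₁ p * dx (fun p => η p.1 * χ p.2) p
        + q₂ p * dy (fun p => η p.1 * χ p.2) p + (d₁ p + d₂ p) * (η p.1 * χ p.2))
      = (∫ p in rect a b c d, (q₁ p * deriv η p.1 + d₁ p * η p.1) * χ p.2)
        + ∫ p in rect a b c d, (q₂ p * deriv χ p.2 + d₂ p * χ p.2) * η p.1 := by
  have hη' : Continuous (deriv η) := hη.continuous_deriv (by norm_num)
  have hχ' : Continuous (deriv χ) := hχ.continuous_deriv (by norm_num)
  have hη₀ := hη.continuous
  have hχ₀ := hχ.continuous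
  have h₁ := (integrableOn_rect_mul (g := fun p => deriv η p.1) hq₁ (by fun_prop)).add
    (integrableOn_rect_mul (g := fun p => η p.1) hd₁ (by fun_prop))
  have h₂ := (integrableOn_rect_mul (g := fun p => deriv χ p.2) hq₂ (by fun_prop)).add
    (integrableOn_rect_mul (g := fun p => χ p.2) hd₂ (by fun_prop))
  rw [dx_mul_fst_snd (hη.differentiable (by norm_num)) (hχ.differentiable (by norm_num)),
    dy_mul_fst_snd (hη.differentiable (by norm_num)) (hχ.differentiable (by norm_num))]
  refine Eq.trans (integral_congr_ae (Eventually.of_forall fun p => ?_)) (integral_add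
    (integrableOn_rect_mul (g := fun p => χ p.2) h₁ (by fun_prop))
    (integrableOn_rect_mul (g := fun p => η p.1) h₂ (by fun_prop)))
  beta_reduce
  ring

end Conservation

section Flux

variable {M : Mesh} {a : M.Elem → Matrix (Fin 2) (Fin 2) ℝ} {f g u : ℝ × ℝ → ℝ}

/-- The derivative `∂_x q₁` of the flux on the element `T`. -/
def fluxDx (a : M.Elem → Matrix (Fin 2) (Fin 2) ℝ) (u : ℝ × ℝ → ℝ) (T : M.Elem) (p : ℝ × ℝ) : ℝ :=
  a T 0 0 * weakDeriv Omega 2 0 u p + a T 0 1 * weakDeriv Omega 1 1 u p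

/-- The derivative `∂_y q₂` of the flux on the element `T`. -/
def fluxDy (a : M.Elem → Matrix (Fin 2) (Fin 2) ℝ) (u : ℝ × ℝ → ℝ) (T : M.Elem) (p : ℝ × ℝ) : ℝ :=
  a T 1 0 * weakDeriv Omega 1 1 u p + a T 1 1 * weakDeriv Omega 0 2 u p

/-- The mixed derivative `∂_x ∂_y q_{k+1}` of the flux on the element `T`. -/
def fluxDxy (a : M.Elem → Matrix (Fin 2) (Fin 2) ℝ) (u : ℝ × ℝ → ℝ) (T : M.Elem) (k : Fin 2)
    (p : ℝ × ℝ) : ℝ :=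
  a T k 0 * weakDeriv Omega 2 1 u p + a T k 1 * weakDeriv Omega 1 2 u p

section Derivatives

variable (hu : MemH 3 Omega u) (T : M.Elem) (a : M.Elem → Matrix (Fin 2) (Fin 2) ℝ) {α β : ℕ}
include hu

theorem MemH.memLp_weakDeriv_interior (h : α + β ≤ 3) :
    MemLp (weakDeriv Omega α β u) 2 (volume.restrict (interior T)) :=
  (hu.isWeakDeriv h).1.mono_measure (Measure.restrict_mono (interior_subset_Omega T) le_rfl)

theorem MemH.isWeakDeriv_interior_left (h : α + 1 + β ≤ 3) :
    IsWeakDeriv (interior T) 1 0 (weakDeriv Omega α β u) (weakDeriv Omega (α + 1) β u) :=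
  ((hu.isWeakDeriv (by omega)).succ_left (hu.isWeakDeriv h)).restrict (interior_subset_Omega T)
    measurableSet_Omega

theorem MemH.isWeakDeriv_interior_right (h : α + (β + 1) ≤ 3) :
    IsWeakDeriv (interior T) 0 1 (weakDeriv Omega α β u) (weakDeriv Omega α (β + 1) u) :=
  ((hu.isWeakDeriv (by omega)).succ_right (hu.isWeakDeriv h)).restrict (interior_subset_Omega T)
    measurableSet_Omega

theorem memLp_flux (k : Fin 2) : MemLp (flux a u T k) 2 (volume.restrict (interior T)) :=
  ((hu.memLp_weakDeriv_interior T (by norm_num)).const_mul _).add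
    ((hu.memLp_weakDeriv_interior T (by norm_num)).const_mul _)

theorem isWeakDeriv_fluxDx : IsWeakDeriv (interior T) 1 0 (flux a u T 0) (fluxDx a u T) :=
  (hu.isWeakDeriv_interior_left T (by norm_num)).linearComb
    (hu.isWeakDeriv_interior_left T (by norm_num)) (hu.memLp_weakDeriv_interior T (by norm_num))
    (hu.memLp_weakDeriv_interior T (by norm_num)) _ _

theorem isWeakDeriv_fluxDy : IsWeakDeriv (interior T) 0 1 (flux a u T 1) (fluxDy a u T) :=
  (hu.isWeakDeriv_interior_right T (by norm_num)).linearComb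
    (hu.isWeakDeriv_interior_right T (by norm_num)) (hu.memLp_weakDeriv_interior T (by norm_num))
    (hu.memLp_weakDeriv_interior T (by norm_num)) _ _

theorem isWeakDeriv_fluxDxy_zero :
    IsWeakDeriv (interior T) 0 1 (fluxDx a u T) (fluxDxy a u T 0) :=
  (hu.isWeakDeriv_interior_right T (by norm_num)).linearComb
    (hu.isWeakDeriv_interior_right T (by norm_num)) (hu.memLp_weakDeriv_interior T (by norm_num))
    (hu.memLp_weakDeriv_interior T (by norm_num)) _ _

theorem isWeakDeriv_fluxDxy_one :
    IsWeakDeriv (interior T) 1 0 (fluxDy a u T) (fluxDxy a u T 1) :=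
  (hu.isWeakDeriv_interior_left T (by norm_num)).linearComb
    (hu.isWeakDeriv_interior_left T (by norm_num)) (hu.memLp_weakDeriv_interior T (by norm_num))
    (hu.memLp_weakDeriv_interior T (by norm_num)) _ _

end Derivatives

theorem integrableOn_interior_mul {T : M.Elem} {v κ : ℝ × ℝ → ℝ}
    (hv : MemLp v 2 (volume.restrict (interior T))) (hκ : Continuous κ) :
    IntegrableOn (fun p => v p * κ p) (interior T) :=
  integrableOn_rect_mul (hv.integrable (by norm_num)) hκ

theorem IsSolution.ae_eq (hs : IsSolution a f g u) (hf : MemLp f 2 (volume.restrict Omega))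
    (hu : MemH 3 Omega u) (T : M.Elem) :
    f =ᵐ[volume.restrict (interior T)] fun p => -(fluxDx a u T p + fluxDy a u T p) := by
  have hT := interior_subset_Omega T
  have hX := isWeakDeriv_fluxDx hu T a
  have hY := isWeakDeriv_fluxDy hu T a
  refine ae_eq_of_forall_isTest (isOpen_interior T)
    (hf.mono_measure (Measure.restrict_mono hT le_rfl)) (hX.1.add hY.1).neg fun φ hφ => ?_
  have hweak := hs.1 φ (hφ.mono hT)
  have hother (T' : M.Elem) (h : T' ≠ T) :
      ∫ p in interior T', (flux a u T' 0 p * dx φ p + flux a u T' 1 p * dy φ p) = 0 := by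
    simpa only [zero_mul, add_zero] using
      setIntegral_eq_zero_of_disjoint hφ (disjoint_interior h) _ _ (fun _ => 0)
  rw [hφ.setIntegral_mul hT measurableSet_Omega, Finset.sum_eq_single T (fun T' _ => hother T')
    fun h => (h (Finset.mem_univ T)).elim, integral_add
    (integrableOn_interior_mul (memLp_flux hu T a 0) (contDiff_dx hφ.1).continuous)
    (integrableOn_interior_mul (memLp_flux hu T a 1) (contDiff_dy hφ.1).continuous)] at hweak
  have hX₁ : ∫ p in interior T, flux a u T 0 p * dx φ p = (-1) ^ (1 + 0) * _ := hX.2 φ hφ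
  have hY₁ : ∫ p in interior T, flux a u T 1 p * dy φ p = (-1) ^ (0 + 1) * _ := hY.2 φ hφ
  rw [← hweak, hX₁, hY₁]
  simp only [neg_mul, add_mul, integral_neg]
  rw [integral_add (hφ.integrable_mul hX.1) (hφ.integrable_mul hY.1)]
  ring

theorem IsSolution.sum_setIntegral_eq_zero (hs : IsSolution a f g u)
    (hf : MemLp f 2 (volume.restrict Omega)) (hu : MemH 3 Omega u) {φ : ℝ × ℝ → ℝ}
    (hφ : IsTest Omega φ) :
    ∑ T : M.Elem, ∫ p in interior T, (flux a u T 0 p * dx φ p + flux a u T 1 p * dy φ p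
      + (fluxDx a u T p + fluxDy a u T p) * φ p) = 0 := by
  have hφ₀ := hφ.1.continuous
  have hsplit (T : M.Elem) : ∫ p in interior T, (flux a u T 0 p * dx φ p + flux a u T 1 p * dy φ p
        + (fluxDx a u T p + fluxDy a u T p) * φ p)
      = (∫ p in interior T, (flux a u T 0 p * dx φ p + flux a u T 1 p * dy φ p))
        - ∫ p in interior T, f p * φ p := by
    have hdiv : ∫ p in interior T, f p * φ p
        = -∫ p in interior T, (fluxDx a u T p + fluxDy a u T p) * φ p := by
      rw [← integral_neg]
      refine integral_congr_ae ((hs.ae_eq hf hu T).mono fun p hp => ?_)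
      simp only [hp, neg_mul]
    rw [hdiv, sub_neg_eq_add]
    exact integral_add
      ((integrableOn_interior_mul (memLp_flux hu T a 0) (contDiff_dx hφ.1).continuous).add
        (integrableOn_interior_mul (memLp_flux hu T a 1) (contDiff_dy hφ.1).continuous))
      (integrableOn_interior_mul
        ((isWeakDeriv_fluxDx hu T a).1.add (isWeakDeriv_fluxDy hu T a).1) hφ₀)
  rw [Finset.sum_congr rfl fun T _ => hsplit T, Finset.sum_sub_distrib, hs.1 φ hφ,
    sum_setIntegral_interior (hφ.integrable_mul hf), sub_self]

theorem IsSolution.sum_row_eq_zero (hs : IsSolution a f g u)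
    (hf : MemLp f 2 (volume.restrict Omega)) (hu : MemH 3 Omega u) (j : Fin M.m) {η : ℝ → ℝ}
    (hη : IsTestIoo 0 1 η) :
    ∑ i : Fin M.n, ∫ p in interior (i, j),
      (flux a u (i, j) 0 p * deriv η p.1 + fluxDx a u (i, j) p * η p.1) = 0 := by
  have hη' : Continuous (deriv η) := hη.1.continuous_deriv (by norm_num)
  have hη₀ := hη.1.continuous
  have hX (T : M.Elem) := isWeakDeriv_fluxDx hu T a
  have hY (T : M.Elem) := isWeakDeriv_fluxDy hu T a
  have hdisj (i j') (hj : j' ≠ j) : Disjoint (interior (i, j'))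
      (Set.Ioo 0 1 ×ˢ Set.Ioo (M.y j.castSucc) (M.y j.succ)) :=
    Set.disjoint_prod.2 (Or.inr (disjoint_Ioo_of_ne M.y_mono hj))
  refine sum_setIntegral_eq_zero_of_forall_isTestIoo (M.y_mono (Fin.castSucc_lt_succ (i := j)))
    (fun i => measurableSet_interior (i, j)) measurable_snd (fun i p hp => hp.2)
    (fun i => (integrableOn_interior_mul (memLp_flux hu _ a 0) (by fun_prop)).add
      (integrableOn_interior_mul (hX _).1 (by fun_prop))) fun χ hχ => ?_
  have hφ := hη.mul_fst_snd hχ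
  have hsum := hs.sum_setIntegral_eq_zero hf hu (hφ.mono
    (Set.prod_mono subset_rfl (Set.Ioo_subset_Ioo (y_mem_Icc _).1 (y_mem_Icc _).2)))
  rw [Fintype.sum_prod_type] at hsum
  refine Eq.trans (Finset.sum_congr rfl fun i _ => ?_) hsum
  rw [Finset.sum_eq_single j (fun j' _ hj =>
      setIntegral_eq_zero_of_disjoint hφ (hdisj i j' hj) _ _ _)
    fun h => (h (Finset.mem_univ j)).elim]
  have hsplit := integral_flux_mul_fst_snd ((memLp_flux hu (i, j) a 0).integrable (by norm_num))
    ((memLp_flux hu (i, j) a 1).integrable (by norm_num)) ((hX _).1.integrable (by norm_num))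
    ((hY _).1.integrable (by norm_num)) hη.1 hχ.1
  have hzero := (hY (i, j)).integral_mul_snd_fst_add (x_lt _) (memLp_flux hu _ a 1) hχ hη.1
  exact (hsplit.trans (by rw [hzero, add_zero]; rfl)).symm

theorem IsSolution.sum_column_eq_zero (hs : IsSolution a f g u)
    (hf : MemLp f 2 (volume.restrict Omega)) (hu : MemH 3 Omega u) (i : Fin M.n) {χ : ℝ → ℝ}
    (hχ : IsTestIoo 0 1 χ) :
    ∑ j : Fin M.m, ∫ p in interior (i, j),
      (flux a u (i, j) 1 p * deriv χ p.2 + fluxDy a u (i, j) p * χ p.2) = 0 := by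
  have hχ' : Continuous (deriv χ) := hχ.1.continuous_deriv (by norm_num)
  have hχ₀ := hχ.1.continuous
  have hX (T : M.Elem) := isWeakDeriv_fluxDx hu T a
  have hY (T : M.Elem) := isWeakDeriv_fluxDy hu T a
  have hdisj (i') (j) (hi : i' ≠ i) : Disjoint (interior (i', j))
      (Set.Ioo (M.x i.castSucc) (M.x i.succ) ×ˢ Set.Ioo 0 1) :=
    Set.disjoint_prod.2 (Or.inl (disjoint_Ioo_of_ne M.x_mono hi))
  refine sum_setIntegral_eq_zero_of_forall_isTestIoo (M.x_mono (Fin.castSucc_lt_succ (i := i)))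
    (fun j => measurableSet_interior (i, j)) measurable_fst (fun j p hp => hp.1)
    (fun j => (integrableOn_interior_mul (memLp_flux hu _ a 1) (by fun_prop)).add
      (integrableOn_interior_mul (hY _).1 (by fun_prop))) fun η hη => ?_
  have hφ := hη.mul_fst_snd hχ
  have hsum := hs.sum_setIntegral_eq_zero hf hu (hφ.mono
    (Set.prod_mono (Set.Ioo_subset_Ioo (x_mem_Icc _).1 (x_mem_Icc _).2) subset_rfl))
  rw [Fintype.sum_prod_type_right] at hsum
  refine Eq.trans (Finset.sum_congr rfl fun j _ => ?_) hsum
  rw [Finset.sum_eq_single i (fun i' _ hi =>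
      setIntegral_eq_zero_of_disjoint hφ (hdisj i' j hi) _ _ _)
    fun h => (h (Finset.mem_univ i)).elim]
  have hsplit := integral_flux_mul_fst_snd ((memLp_flux hu (i, j) a 0).integrable (by norm_num))
    ((memLp_flux hu (i, j) a 1).integrable (by norm_num)) ((hX _).1.integrable (by norm_num))
    ((hY _).1.integrable (by norm_num)) hη.1 hχ.1
  have hzero := (hX (i, j)).integral_mul_fst_snd_add (y_lt _) (memLp_flux hu _ a 0) hη hχ.1
  exact (hsplit.trans (by rw [hzero, zero_add]; rfl)).symm

/-- `F T s` is the integral over the edge `e_{s+1}` of `T` of the trace, taken from within `T`, of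
`q₁` (on the vertical edges) or `q₂` (on the horizontal ones). -/
def IsEdgeFlux (a : M.Elem → Matrix (Fin 2) (Fin 2) ℝ) (u : ℝ × ℝ → ℝ)
    (F : M.Elem → Fin 4 → ℝ) : Prop :=
  ∀ T : M.Elem,
    HasEndIntegrals (interior T) Prod.fst (M.x T.1.castSucc) (M.x T.1.succ) (flux a u T 0)
      (fluxDx a u T) (F T 0) (F T 1) ∧
    HasEndIntegrals (interior T) Prod.snd (M.y T.2.castSucc) (M.y T.2.succ) (flux a u T 1)
      (fluxDy a u T) (F T 2) (F T 3)

theorem exists_isEdgeFlux (hu : MemH 3 Omega u) (a : M.Elem → Matrix (Fin 2) (Fin 2) ℝ) :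
    ∃ F, IsEdgeFlux a u F := by
  choose l r hlr using fun T : M.Elem => (isWeakDeriv_fluxDx hu T a).exists_hasEndIntegrals_fst
    (x_lt T) (y_lt T) (memLp_flux hu T a 0)
  choose b t hbt using fun T : M.Elem => (isWeakDeriv_fluxDy hu T a).exists_hasEndIntegrals_snd
    (x_lt T) (y_lt T) (memLp_flux hu T a 1)
  exact ⟨fun T => ![l T, r T, b T, t T], fun T => ⟨hlr T, hbt T⟩⟩

theorem IsSolution.sum_edgeFlux_mul_eq_zero (hs : IsSolution a f g u)
    (hf : MemLp f 2 (volume.restrict Omega)) (hu : MemH 3 Omega u) {F : M.Elem → Fin 4 → ℝ}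
    (hF : IsEdgeFlux a u F) {v : M.Edge → ℝ} (hv : ∀ e, IsBdry e → v e = 0) :
    ∑ T : M.Elem, (F T 1 * v (edge T 1) - F T 0 * v (edge T 0)
      + (F T 3 * v (edge T 3) - F T 2 * v (edge T 2))) = 0 := by
  have hrow (j : Fin M.m) : ∑ i : Fin M.n,
      (F (i, j) 1 * v (edge (i, j) 1) - F (i, j) 0 * v (edge (i, j) 0)) = 0 :=
    sum_endIntegrals_mul_eq_zero M.x_mono (by rw [M.x_zero, M.x_last]; exact one_pos)
      (fun i => (hF (i, j)).1) (fun η hη => hs.sum_row_eq_zero hf hu j (by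
        rwa [M.x_zero, M.x_last] at hη)) (c := fun i => v (.inl (i, j)))
      (hv _ (Or.inl rfl)) (hv _ (Or.inr rfl))
  have hcolumn (i : Fin M.n) : ∑ j : Fin M.m,
      (F (i, j) 3 * v (edge (i, j) 3) - F (i, j) 2 * v (edge (i, j) 2)) = 0 :=
    sum_endIntegrals_mul_eq_zero M.y_mono (by rw [M.y_zero, M.y_last]; exact one_pos)
      (fun j => (hF (i, j)).2) (fun χ hχ => hs.sum_column_eq_zero hf hu i (by
        rwa [M.y_zero, M.y_last] at hχ)) (c := fun j => v (.inr (i, j)))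
      (hv _ (Or.inl rfl)) (hv _ (Or.inr rfl))
  rw [Finset.sum_add_distrib, Fintype.sum_prod_type_right, Fintype.sum_prod_type]
  simp only [hrow, hcolumn, Finset.sum_const_zero, add_zero]

end Flux

/-! ### The extension and the stabilizer -/

section Stabilizer

variable {M : Mesh}

section Defect

variable (vb zb : M.Edge → ℝ) (T : M.Elem)

/-- `v_b - Q_b S(v_b)` equals `defect * |e₃|` on the vertical and `-defect * |e₁|` on the horizontal
edges of `T`. -/
def defect : ℝ :=
  (vb (edge T 0) + vb (edge T 1) - vb (edge T 2) - vb (edge T 3)) / (2 * (hx T + hy T))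

theorem weakGrad_sub : weakGrad (vb - zb) T = weakGrad vb T - weakGrad zb T := by
  refine funext (Fin.forall_fin_two.2 ⟨?_, ?_⟩) <;>
    simp only [weakGrad, Pi.sub_apply, Matrix.cons_val_zero, Matrix.cons_val_one] <;> ring

theorem weakGrad_add_smul (r : ℝ) :
    weakGrad (vb + r • zb) T = weakGrad vb T + r • weakGrad zb T := by
  refine funext (Fin.forall_fin_two.2 ⟨?_, ?_⟩) <;>
    simp only [weakGrad, Pi.add_apply, Pi.smul_apply, smul_eq_mul, Matrix.cons_val_zero,
      Matrix.cons_val_one] <;> ring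

theorem defect_sub : defect (vb - zb) T = defect vb T - defect zb T := by
  simp only [defect, Pi.sub_apply]
  ring

theorem defect_add_smul (r : ℝ) : defect (vb + r • zb) T = defect vb T + r * defect zb T := by
  simp only [defect, Pi.add_apply, Pi.smul_apply, smul_eq_mul]
  ring

theorem hx_mul_weakGrad : hx T * weakGrad vb T 0 = vb (edge T 1) - vb (edge T 0) :=
  mul_div_cancel₀ _ (hx_pos T).ne'

theorem hy_mul_weakGrad : hy T * weakGrad vb T 1 = vb (edge T 3) - vb (edge T 2) :=
  mul_div_cancel₀ _ (hy_pos T).ne'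

theorem defect_mul_add : defect vb T * (hx T + hy T)
    = (vb (edge T 0) + vb (edge T 1)) / 2 - (vb (edge T 2) + vb (edge T 3)) / 2 := by
  have hne := (add_pos (hx_pos T) (hy_pos T)).ne'
  rw [defect]
  field_simp
  ring

theorem affine_extS_eq_fst (p : ℝ × ℝ) : affine (extS vb T) p =
    (vb (edge T 0) + vb (edge T 1)) / 2 - defect vb T * hx T
      + weakGrad vb T 0 * (p.1 - xMid T) + weakGrad vb T 1 * (p.2 - yMid T) := by
  have hne := (add_pos (hx_pos T) (hy_pos T)).ne'
  change (hy T * (vb (edge T 0) + vb (edge T 1)) + hx T * (vb (edge T 2) + vb (edge T 3)))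
      / (2 * (hx T + hy T)) - weakGrad vb T 0 * xMid T - weakGrad vb T 1 * yMid T
      + weakGrad vb T 0 * p.1 + weakGrad vb T 1 * p.2 = _
  rw [defect]
  field_simp
  ring

theorem affine_extS_eq_snd (p : ℝ × ℝ) : affine (extS vb T) p =
    (vb (edge T 2) + vb (edge T 3)) / 2 + defect vb T * hy T
      + weakGrad vb T 0 * (p.1 - xMid T) + weakGrad vb T 1 * (p.2 - yMid T) := by
  rw [affine_extS_eq_fst]
  linarith [defect_mul_add vb T]

theorem seg_edge_lt (s : Fin 4) : (seg (edge T s)).lo < (seg (edge T s)).hi := by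
  fin_cases s
  exacts [y_lt T, y_lt T, x_lt T, x_lt T]

theorem mean_affine_edge (c : Fin 3 → ℝ) :
    (fun s => (seg (edge T s)).mean (affine c)) =
      ![affine c (xMid T - hx T / 2, yMid T), affine c (xMid T + hx T / 2, yMid T),
        affine c (xMid T, yMid T - hy T / 2), affine c (xMid T, yMid T + hy T / 2)] := by
  funext s
  rw [mean_affine c _ (seg_edge_lt T s)]
  fin_cases s <;>
    simp only [edge, seg, Seg.pt, xMid, yMid, hx, hy, Matrix.cons_val_zero, Matrix.cons_val_one,
      Matrix.cons_val, Fin.zero_eta, Fin.mk_one, Fin.reduceFinMk, Bool.false_eq_true,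
      ↓reduceIte] <;>
    ring_nf

theorem sub_mean_extS : (fun s => vb (edge T s) - (seg (edge T s)).mean (affine (extS vb T))) =
    ![defect vb T * hx T, defect vb T * hx T, -(defect vb T * hy T), -(defect vb T * hy T)] := by
  have h₀ := hx_mul_weakGrad vb T
  have h₁ := hy_mul_weakGrad vb T
  funext s
  rw [congrFun (mean_affine_edge T (extS vb T)) s]
  fin_cases s
  · change vb (edge T 0) - affine _ (xMid T - hx T / 2, yMid T) = defect vb T * hx T
    rw [affine_extS_eq_fst]
    linarith
  · change vb (edge T 1) - affine _ (xMid T + hx T / 2, yMid T) = defect vb T * hx T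
    rw [affine_extS_eq_fst]
    linarith
  · change vb (edge T 2) - affine _ (xMid T, yMid T - hy T / 2) = -(defect vb T * hy T)
    rw [affine_extS_eq_snd]
    linarith
  · change vb (edge T 3) - affine _ (xMid T, yMid T + hy T / 2) = -(defect vb T * hy T)
    rw [affine_extS_eq_snd]
    linarith

theorem sum_len_mul_sub_mean_extS (c : Fin 3 → ℝ) :
    ∑ s : Fin 4, (seg (edge T s)).len * ((zb (edge T s) - (seg (edge T s)).mean (affine c)) *
        (vb (edge T s) - (seg (edge T s)).mean (affine (extS vb T))))
      = 2 * (area T * (hx T + hy T) * (defect zb T * defect vb T)) := by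
  have hlen : (fun s => (seg (edge T s)).len) = ![hy T, hy T, hx T, hx T] := by
    funext s; fin_cases s <;> rfl
  have hdefect := defect_mul_add zb T
  simp only [congrFun hlen, congrFun (mean_affine_edge T c), congrFun (sub_mean_extS vb T),
    Fin.sum_univ_four, affine, area, Matrix.cons_val_zero, Matrix.cons_val_one, Matrix.cons_val]
  linear_combination (-2 * hx T * hy T * defect vb T) * hdefect

end Defect

/-- The stabilizer `s({c, z_b}, {S(v_b), v_b})`; it does not depend on the interior component `c`
because `S(v_b) - v_b` is orthogonal on `∂T` to the edge averages of linear polynomials. -/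
def stabForm (ρ : ℝ) (zb vb : M.Edge → ℝ) : ℝ :=
  2 * (ρ * M.h⁻¹) * ∑ T : M.Elem, area T * (hx T + hy T) * (defect zb T * defect vb T)

theorem stab_extS (ρ : ℝ) (z : WeakFun M) (vb : M.Edge → ℝ) :
    stab ρ z ⟨extS vb, vb⟩ = stabForm ρ z.vb vb := by
  simp only [stab, stabForm, sum_len_mul_sub_mean_extS, ← Finset.mul_sum]
  ring

theorem stabNorm_sq {ρ : ℝ} (hρ : 0 < ρ) (vb : M.Edge → ℝ) :
    stabNorm ρ vb ^ 2 = stabForm ρ vb vb := by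
  have hh := h_pos M
  rw [stabNorm, Real.sq_sqrt, ← stab_extS ρ ⟨extS vb, vb⟩]
  · simp only [stab, ← sq, sub_sq_comm (vb _)]
  · exact mul_nonneg (by positivity) (Finset.sum_nonneg fun T _ => Finset.sum_nonneg fun s _ =>
      mul_nonneg (sub_pos.2 (seg_edge_lt T s)).le (sq_nonneg _))

theorem stabForm_sub (ρ : ℝ) (zb z'b vb : M.Edge → ℝ) :
    stabForm ρ (zb - z'b) vb = stabForm ρ zb vb - stabForm ρ z'b vb := by
  simp only [stabForm, defect_sub, sub_mul, mul_sub, Finset.sum_sub_distrib]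

theorem gradForm_sub (a : M.Elem → Matrix (Fin 2) (Fin 2) ℝ) (zb z'b vb : M.Edge → ℝ) :
    gradForm a (zb - z'b) vb = gradForm a zb vb - gradForm a z'b vb := by
  simp only [gradForm, weakGrad_sub, Matrix.mulVec_sub, sub_dotProduct, mul_sub,
    Finset.sum_sub_distrib]

theorem gradNorm_sq (vb : M.Edge → ℝ) :
    gradNorm vb ^ 2 = ∑ T : M.Elem, area T * (weakGrad vb T ⬝ᵥ weakGrad vb T) :=
  Real.sq_sqrt (Finset.sum_nonneg fun T _ => mul_nonneg (area_pos T).le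
    (Finset.sum_nonneg fun _ _ => mul_self_nonneg _))

theorem IsWGSolution.error_eq {ρ : ℝ} {a : M.Elem → Matrix (Fin 2) (Fin 2) ℝ} {f : ℝ × ℝ → ℝ}
    {gb : M.Edge → ℝ} {uh : WeakFun M} (huh : IsWGSolution ρ a f gb uh) (zb : M.Edge → ℝ)
    {vb : M.Edge → ℝ} (hvb : ∀ e, IsBdry e → vb e = 0) :
    gradForm a (zb - uh.vb) vb + stabForm ρ (zb - uh.vb) vb = gradForm a zb vb + stabForm ρ zb vb
      - ∑ T : M.Elem, ∫ p in interior T, f p * affine (extS vb T) p := by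
  have hscheme := huh.2 ⟨extS vb, vb⟩ hvb
  rw [stab_extS] at hscheme
  rw [gradForm_sub, stabForm_sub, ← hscheme]
  ring

end Stabilizer

/-! ### The consistency error -/

section Consistency

variable {M : Mesh} {T : M.Elem}

section Moments

variable {v v' : ℝ × ℝ → ℝ} {l r : ℝ}

theorem mapsTo_fst_interior (T : M.Elem) :
    Set.MapsTo Prod.fst (interior T) (Set.Icc (M.x T.1.castSucc) (M.x T.1.succ)) :=
  fun _ hp => Set.Ioo_subset_Icc_self hp.1

theorem mapsTo_snd_interior (T : M.Elem) :
    Set.MapsTo Prod.snd (interior T) (Set.Icc (M.y T.2.castSucc) (M.y T.2.succ)) :=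
  fun _ hp => Set.Ioo_subset_Icc_self hp.2

theorem HasEndIntegrals.half_add_mul_hx (hv : MemLp v 2 (volume.restrict (interior T)))
    (hv' : MemLp v' 2 (volume.restrict (interior T)))
    (h : HasEndIntegrals (interior T) Prod.fst (M.x T.1.castSucc) (M.x T.1.succ) v v' l r) :
    (l + r) / 2 * hx T
      = (∫ p in interior T, v p) + ∫ p in interior T, v' p * (p.1 - xMid T) :=
  h.half_add_mul_sub (measurableSet_interior T) measurable_fst (mapsTo_fst_interior T) hv hv'

theorem HasEndIntegrals.half_add_mul_hy (hv : MemLp v 2 (volume.restrict (interior T)))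
    (hv' : MemLp v' 2 (volume.restrict (interior T)))
    (h : HasEndIntegrals (interior T) Prod.snd (M.y T.2.castSucc) (M.y T.2.succ) v v' l r) :
    (l + r) / 2 * hy T
      = (∫ p in interior T, v p) + ∫ p in interior T, v' p * (p.2 - yMid T) :=
  h.half_add_mul_sub (measurableSet_interior T) measurable_snd (mapsTo_snd_interior T) hv hv'

theorem setIntegral_mul_affine (hv : MemLp v 2 (volume.restrict (interior T))) (c c₁ c₂ : ℝ) :
    ∫ p in interior T, v p * (c + c₁ * (p.1 - xMid T) + c₂ * (p.2 - yMid T)) =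
      c * (∫ p in interior T, v p) + c₁ * (∫ p in interior T, v p * (p.1 - xMid T))
        + c₂ * ∫ p in interior T, v p * (p.2 - yMid T) := by
  have h₀ : IntegrableOn (fun p => c * v p) (interior T) :=
    (hv.integrable (by norm_num)).const_mul c
  have h₁ : IntegrableOn (fun p => c₁ * (v p * (p.1 - xMid T))) (interior T) :=
    (integrableOn_interior_mul hv (by fun_prop)).const_mul c₁
  have h₂ : IntegrableOn (fun p => c₂ * (v p * (p.2 - yMid T))) (interior T) :=
    (integrableOn_interior_mul hv (by fun_prop)).const_mul c₂
  have h₀₁ : IntegrableOn (fun p => c * v p + c₁ * (v p * (p.1 - xMid T))) (interior T) :=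
    h₀.add h₁
  simp only [← integral_const_mul]
  rw [← integral_add h₀ h₁, ← integral_add h₀₁ h₂]
  congr 1 with p
  ring

end Moments

variable {a : M.Elem → Matrix (Fin 2) (Fin 2) ℝ} {f g u : ℝ × ℝ → ℝ} {Qu : M.Edge → ℝ}

theorem IsEdgeProjection.area_mul_defect (hQ : IsEdgeProjection u Qu) (hu : MemH 3 Omega u)
    (T : M.Elem) : area T * (hx T + hy T) * defect Qu T =
      (∫ p in interior T, weakDeriv Omega 1 0 u p * (p.1 - xMid T))
        - ∫ p in interior T, weakDeriv Omega 0 1 u p * (p.2 - yMid T) := by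
  have hu₀ : MemLp u 2 (volume.restrict (interior T)) :=
    hu.1.mono_measure (Measure.restrict_mono (interior_subset_Omega T) le_rfl)
  have hv := (hQ.hasEndIntegrals_fst T).half_add_mul_hx hu₀
    (hu.memLp_weakDeriv_interior T (by norm_num))
  have hh := (hQ.hasEndIntegrals_snd T).half_add_mul_hy hu₀
    (hu.memLp_weakDeriv_interior T (by norm_num))
  have hdefect := defect_mul_add Qu T
  rw [area]
  linear_combination (hx T * hy T) * hdefect + hv - hh

theorem IsEdgeProjection.setIntegral_flux (hQ : IsEdgeProjection u Qu) (hu : MemH 3 Omega u)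
    (a : M.Elem → Matrix (Fin 2) (Fin 2) ℝ) (T : M.Elem) (k : Fin 2) :
    ∫ p in interior T, flux a u T k p = area T * (a T).mulVec (weakGrad Qu T) k := by
  obtain ⟨hx_eq, hy_eq⟩ := hQ.mul_sub_eq_integral T
  rw [← hx_mul_weakGrad] at hx_eq
  rw [← hy_mul_weakGrad] at hy_eq
  have h₁₀ := (hu.memLp_weakDeriv_interior (α := 1) (β := 0) T (by norm_num)).integrable
    (by norm_num)
  have h₀₁ := (hu.memLp_weakDeriv_interior (α := 0) (β := 1) T (by norm_num)).integrable
    (by norm_num)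
  simp only [flux, Matrix.mulVec, dotProduct, Fin.sum_univ_two]
  rw [integral_add (h₁₀.const_mul _) (h₀₁.const_mul _), integral_const_mul, integral_const_mul,
    ← hx_eq, ← hy_eq, area]
  ring

theorem IsEdgeFlux.sum_mul_eq {F : M.Elem → Fin 4 → ℝ} (hF : IsEdgeFlux a u F)
    (hu : MemH 3 Omega u) (vb : M.Edge → ℝ) (T : M.Elem) :
    F T 1 * vb (edge T 1) - F T 0 * vb (edge T 0)
        + (F T 3 * vb (edge T 3) - F T 2 * vb (edge T 2))
      = weakGrad vb T 0 * ((∫ p in interior T, flux a u T 0 p)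
          + ∫ p in interior T, fluxDx a u T p * (p.1 - xMid T))
        + weakGrad vb T 1 * ((∫ p in interior T, flux a u T 1 p)
          + ∫ p in interior T, fluxDy a u T p * (p.2 - yMid T))
        + (vb (edge T 0) + vb (edge T 1)) / 2 * (∫ p in interior T, fluxDx a u T p)
        + (vb (edge T 2) + vb (edge T 3)) / 2 * ∫ p in interior T, fluxDy a u T p := by
  have hX := (hF T).1.half_add_mul_hx (memLp_flux hu T a 0) (isWeakDeriv_fluxDx hu T a).1
  have hY := (hF T).2.half_add_mul_hy (memLp_flux hu T a 1) (isWeakDeriv_fluxDy hu T a).1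
  rw [← hX, ← hY, ← (hF T).1.sub_eq, ← (hF T).2.sub_eq]
  linear_combination -(F T 0 + F T 1) / 2 * hx_mul_weakGrad vb T
    - (F T 2 + F T 3) / 2 * hy_mul_weakGrad vb T

theorem IsSolution.setIntegral_mul_extS (hs : IsSolution a f g u)
    (hf : MemLp f 2 (volume.restrict Omega)) (hu : MemH 3 Omega u) (vb : M.Edge → ℝ)
    (T : M.Elem) :
    ∫ p in interior T, f p * affine (extS vb T) p =
      -(((vb (edge T 0) + vb (edge T 1)) / 2 - defect vb T * hx T)
          * (∫ p in interior T, fluxDx a u T p)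
        + ((vb (edge T 2) + vb (edge T 3)) / 2 + defect vb T * hy T)
          * (∫ p in interior T, fluxDy a u T p)
        + weakGrad vb T 0 * ((∫ p in interior T, fluxDx a u T p * (p.1 - xMid T))
          + ∫ p in interior T, fluxDy a u T p * (p.1 - xMid T))
        + weakGrad vb T 1 * ((∫ p in interior T, fluxDx a u T p * (p.2 - yMid T))
          + ∫ p in interior T, fluxDy a u T p * (p.2 - yMid T))) := by
  have hX := (isWeakDeriv_fluxDx hu T a).1
  have hY := (isWeakDeriv_fluxDy hu T a).1
  have hcont : Continuous (affine (extS vb T)) := by unfold affine; fun_prop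
  have hsplit : ∫ p in interior T, f p * affine (extS vb T) p
      = -((∫ p in interior T, fluxDx a u T p * affine (extS vb T) p)
        + ∫ p in interior T, fluxDy a u T p * affine (extS vb T) p) := by
    rw [← integral_add (integrableOn_interior_mul hX hcont) (integrableOn_interior_mul hY hcont),
      ← integral_neg]
    refine integral_congr_ae ((hs.ae_eq hf hu T).mono fun p hp => ?_)
    simp only [hp]
    ring
  have hX_mul := setIntegral_mul_affine hX
    ((vb (edge T 0) + vb (edge T 1)) / 2 - defect vb T * hx T) (weakGrad vb T 0) (weakGrad vb T 1)
  have hY_mul := setIntegral_mul_affine hY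
    ((vb (edge T 2) + vb (edge T 3)) / 2 + defect vb T * hy T) (weakGrad vb T 0) (weakGrad vb T 1)
  simp only [← affine_extS_eq_fst] at hX_mul
  simp only [← affine_extS_eq_snd] at hY_mul
  rw [hsplit, hX_mul, hY_mul]
  ring

theorem IsSolution.consistency (hs : IsSolution a f g u)
    (hf : MemLp f 2 (volume.restrict Omega)) (hu : MemH 3 Omega u)
    (hQ : IsEdgeProjection u Qu) {F : M.Elem → Fin 4 → ℝ} (hF : IsEdgeFlux a u F)
    (vb : M.Edge → ℝ) (T : M.Elem) :
    area T * ((a T).mulVec (weakGrad Qu T) ⬝ᵥ weakGrad vb T)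
        - (∫ p in interior T, f p * affine (extS vb T) p)
        - (F T 1 * vb (edge T 1) - F T 0 * vb (edge T 0)
          + (F T 3 * vb (edge T 3) - F T 2 * vb (edge T 2)))
      = (∫ p in interior T, fluxDy a u T p * (p.1 - xMid T)) * weakGrad vb T 0
        + (∫ p in interior T, fluxDx a u T p * (p.2 - yMid T)) * weakGrad vb T 1
        - (hx T * (∫ p in interior T, fluxDx a u T p)
          - hy T * ∫ p in interior T, fluxDy a u T p) * defect vb T := by
  rw [hs.setIntegral_mul_extS hf hu, hF.sum_mul_eq hu, hQ.setIntegral_flux hu,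
    hQ.setIntegral_flux hu, dotProduct, Fin.sum_univ_two]
  ring

/-- The part of the consistency error of the corrected projection `Q_b u + h² w_b` on `T` that is
tested with `∇_d v_b`. -/
def gradResidual (a : M.Elem → Matrix (Fin 2) (Fin 2) ℝ) (u : ℝ × ℝ → ℝ) (w : M.Edge → ℝ)
    (T : M.Elem) : Fin 2 → ℝ :=
  ![∫ p in interior T, fluxDy a u T p * (p.1 - xMid T),
    ∫ p in interior T, fluxDx a u T p * (p.2 - yMid T)]
    + (M.h ^ 2 * area T) • (a T).mulVec (weakGrad w T)

/-- The part of the consistency error of the corrected projection `Q_b u + h² w_b` on `T` that is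
tested with `S(v_b) - v_b`. The correction is chosen so that it is of higher order. -/
def stabResidual (ρ : ℝ) (a : M.Elem → Matrix (Fin 2) (Fin 2) ℝ) (u : ℝ × ℝ → ℝ)
    (Qu w : M.Edge → ℝ) (T : M.Elem) : ℝ :=
  2 * (ρ * M.h⁻¹) * (area T * (hx T + hy T) * defect (Qu + M.h ^ 2 • w) T)
    - (hx T * (∫ p in interior T, fluxDx a u T p) - hy T * ∫ p in interior T, fluxDy a u T p)

theorem IsSolution.sum_residual (hs : IsSolution a f g u)
    (hf : MemLp f 2 (volume.restrict Omega)) (hu : MemH 3 Omega u) (hQ : IsEdgeProjection u Qu)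
    (ρ : ℝ) (w : M.Edge → ℝ) {vb : M.Edge → ℝ} (hvb : ∀ e, IsBdry e → vb e = 0) :
    gradForm a (Qu + M.h ^ 2 • w) vb + stabForm ρ (Qu + M.h ^ 2 • w) vb
        - ∑ T : M.Elem, ∫ p in interior T, f p * affine (extS vb T) p
      = ∑ T : M.Elem, (gradResidual a u w T ⬝ᵥ weakGrad vb T
          + stabResidual ρ a u Qu w T * defect vb T) := by
  obtain ⟨F, hF⟩ := exists_isEdgeFlux hu a
  rw [← sub_zero (_ - _), ← hs.sum_edgeFlux_mul_eq_zero hf hu hF hvb, gradForm, stabForm,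
    Finset.mul_sum, ← Finset.sum_add_distrib, ← Finset.sum_sub_distrib, ← Finset.sum_sub_distrib]
  refine Finset.sum_congr rfl fun T _ => ?_
  have hT := hs.consistency hf hu hQ hF vb T
  simp only [gradResidual, stabResidual, weakGrad_add_smul, Matrix.mulVec_add, Matrix.mulVec_smul,
    Pi.add_apply, Pi.smul_apply, smul_eq_mul, dotProduct, Fin.sum_univ_two,
    Matrix.cons_val_zero, Matrix.cons_val_one] at hT ⊢
  linear_combination hT

end Consistency

/-! ### Bounds by the third derivatives -/

section Estimate

variable {M : Mesh} {T : M.Elem} {a : M.Elem → Matrix (Fin 2) (Fin 2) ℝ} {f g u : ℝ × ℝ → ℝ}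
  {w Qu : M.Edge → ℝ} {ρ lam Lam L : ℝ}

/-- The square of the seminorm `|u|_{3,T}` of `H³(T)`. -/
def thirdSq (u : ℝ × ℝ → ℝ) (T : M.Elem) : ℝ :=
  ∑ α ∈ Finset.range 4, ∫ p in interior T, weakDeriv Omega α (3 - α) u p ^ 2

theorem setIntegral_sq_le_thirdSq (u : ℝ × ℝ → ℝ) (T : M.Elem) {α : ℕ} (hα : α < 4) :
    ∫ p in interior T, weakDeriv Omega α (3 - α) u p ^ 2 ≤ thirdSq u T :=
  Finset.single_le_sum (f := fun α => ∫ p in interior T, weakDeriv Omega α (3 - α) u p ^ 2)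
    (fun _ _ => integral_nonneg fun _ => sq_nonneg _) (Finset.mem_range.2 hα)

theorem thirdSq_nonneg (u : ℝ × ℝ → ℝ) (T : M.Elem) : 0 ≤ thirdSq u T :=
  Finset.sum_nonneg fun _ _ => integral_nonneg fun _ => sq_nonneg _

theorem sum_thirdSq_le (hu : MemH 3 Omega u) :
    ∑ T : M.Elem, thirdSq u T ≤ sobolevNorm 3 Omega u ^ 2 := by
  have hnonneg (α β : ℕ) : 0 ≤ ∫ p in Omega, weakDeriv Omega α β u p ^ 2 :=
    integral_nonneg fun _ => sq_nonneg _
  simp only [thirdSq]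
  rw [sobolevNorm, Real.sq_sqrt (Finset.sum_nonneg fun α _ =>
    Finset.sum_nonneg fun β _ => hnonneg α β), Finset.sum_comm]
  refine Finset.sum_le_sum fun α hα => ?_
  have hα' := Finset.mem_range.1 hα
  rw [sum_setIntegral_interior (hu.isWeakDeriv (by omega)).1.integrable_sq]
  exact Finset.single_le_sum (f := fun β => ∫ p in Omega, weakDeriv Omega α β u p ^ 2)
    (fun β _ => hnonneg α β) (Finset.mem_range.2 (by omega))

/-- `|T|^{1/2} |u|_{3,T}`, which is what the Cauchy–Schwarz inequality on `T` gives for the integral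
of a third derivative of `u`. -/
def scaledSeminorm (u : ℝ × ℝ → ℝ) (T : M.Elem) : ℝ :=
  Real.sqrt (area T * thirdSq u T)

theorem scaledSeminorm_nonneg (u : ℝ × ℝ → ℝ) (T : M.Elem) : 0 ≤ scaledSeminorm u T :=
  Real.sqrt_nonneg _

theorem scaledSeminorm_sq (u : ℝ × ℝ → ℝ) (T : M.Elem) :
    scaledSeminorm u T ^ 2 = area T * thirdSq u T :=
  Real.sq_sqrt (mul_nonneg (area_pos T).le (thirdSq_nonneg u T))

/-- `‖v‖_{L²(T)} ≤ c |u|_{3,T}`. -/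
def IsDominated (u : ℝ × ℝ → ℝ) (T : M.Elem) (c : ℝ) (v : ℝ × ℝ → ℝ) : Prop :=
  0 ≤ c ∧ MemLp v 2 (volume.restrict (interior T)) ∧
    ∫ p in interior T, v p ^ 2 ≤ c ^ 2 * thirdSq u T

theorem MemH.isDominated_weakDeriv (hu : MemH 3 Omega u) (T : M.Elem) {α : ℕ} (hα : α < 4) :
    IsDominated u T 1 (weakDeriv Omega α (3 - α) u) :=
  ⟨zero_le_one, hu.memLp_weakDeriv_interior T (by omega), by
    simpa only [one_pow, one_mul] using setIntegral_sq_le_thirdSq u T hα⟩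

theorem IsCoeff.abs_entry_le (ha : IsCoeff lam Lam a) (hlam : 0 ≤ lam) (T : M.Elem)
    (i j : Fin 2) : |a T i j| ≤ Lam := by
  obtain ⟨hsymm, hbounds⟩ := ha T
  have h₁₀ : a T 1 0 = a T 0 1 := congrFun (congrFun hsymm 0) 1
  have h₀ := hbounds ![1, 0]
  have h₁ := hbounds ![0, 1]
  have hadd := hbounds ![1, 1]
  have hsub := hbounds ![1, -1]
  simp only [dotProduct, Matrix.mulVec, Fin.sum_univ_two, Matrix.cons_val_zero,
    Matrix.cons_val_one, h₁₀] at h₀ h₁ hadd hsub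
  fin_cases i <;> fin_cases j <;>
    simp only [Fin.zero_eta, Fin.mk_one, h₁₀] <;> rw [abs_le] <;> constructor <;> linarith

theorem MemH.isDominated_fluxDxy (hu : MemH 3 Omega u) {k : Fin 2} (ha : ∀ j, |a T k j| ≤ L) :
    IsDominated u T (2 * L) (fluxDxy a u T k) := by
  have hL : 0 ≤ L := (abs_nonneg _).trans (ha 0)
  obtain ⟨-, h₂₁, h₂₁_le⟩ := hu.isDominated_weakDeriv T (α := 2) (by norm_num)
  obtain ⟨-, h₁₂, h₁₂_le⟩ := hu.isDominated_weakDeriv T (α := 1) (by norm_num)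
  have hmem : MemLp (fluxDxy a u T k) 2 (volume.restrict (interior T)) :=
    (h₂₁.const_mul _).add (h₁₂.const_mul _)
  refine ⟨by positivity, hmem, ?_⟩
  have hsq (j : Fin 2) : a T k j ^ 2 ≤ L ^ 2 := sq_le_sq' (abs_le.1 (ha j)).1 (abs_le.1 (ha j)).2
  have hle : ∫ p in interior T, fluxDxy a u T k p ^ 2 ≤ ∫ p in interior T,
      (2 * L ^ 2 * weakDeriv Omega 2 1 u p ^ 2 + 2 * L ^ 2 * weakDeriv Omega 1 2 u p ^ 2) := by
    refine integral_mono hmem.integrable_sq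
      ((h₂₁.integrable_sq.const_mul _).add (h₁₂.integrable_sq.const_mul _)) fun p => ?_
    calc fluxDxy a u T k p ^ 2
        ≤ 2 * ((a T k 0 * weakDeriv Omega 2 1 u p) ^ 2
            + (a T k 1 * weakDeriv Omega 1 2 u p) ^ 2) := add_sq_le
      _ = 2 * a T k 0 ^ 2 * weakDeriv Omega 2 1 u p ^ 2
            + 2 * a T k 1 ^ 2 * weakDeriv Omega 1 2 u p ^ 2 := by ring
      _ ≤ _ := add_le_add (mul_le_mul_of_nonneg_right (by linarith [hsq 0]) (sq_nonneg _))
          (mul_le_mul_of_nonneg_right (by linarith [hsq 1]) (sq_nonneg _))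
  rw [integral_add (h₂₁.integrable_sq.const_mul _) (h₁₂.integrable_sq.const_mul _),
    integral_const_mul, integral_const_mul] at hle
  nlinarith [sq_nonneg L]

section Moments

variable {v v' v'' : ℝ × ℝ → ℝ} {c : ℝ}

theorem IsDominated.abs_le_of_sq_le (hv : IsDominated u T c v) {K x : ℝ} (hK : 0 ≤ K)
    (h : x ^ 2 ≤ K ^ 2 * (area T * ∫ p in interior T, v p ^ 2)) :
    |x| ≤ K * c * scaledSeminorm u T := by
  refine abs_le_of_sq_le_sq (h.trans ?_)
    (mul_nonneg (mul_nonneg hK hv.1) (scaledSeminorm_nonneg u T))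
  calc K ^ 2 * (area T * ∫ p in interior T, v p ^ 2)
      ≤ K ^ 2 * (area T * (c ^ 2 * thirdSq u T)) := by
        have := (area_pos T).le
        gcongr
        exact hv.2.2
    _ = (K * c * scaledSeminorm u T) ^ 2 := by rw [mul_pow, scaledSeminorm_sq]; ring

theorem IsDominated.abs_integral_le (hv : IsDominated u T c v) :
    |∫ p in interior T, v p| ≤ c * scaledSeminorm u T := by
  have h := sq_integral_le hv.2.1
  rw [measureReal_restrict_apply_univ, volume_real_interior] at h
  simpa only [one_mul] using
    hv.abs_le_of_sq_le zero_le_one (by simpa only [one_pow, one_mul] using h)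

theorem IsDominated.abs_integral_mul_xMid_le (hv : IsDominated u T c v) :
    |∫ p in interior T, v p * (p.1 - xMid T)| ≤ hx T / 2 * c * scaledSeminorm u T := by
  have h := sq_integral_mul_le hv.2.1 (g := fun p => p.1 - xMid T) (K := hx T / 2) (by fun_prop)
    (ae_restrict_of_forall_mem (measurableSet_interior T) fun p hp => by
      obtain ⟨hlo, hhi⟩ := mapsTo_fst_interior T hp
      simp only [xMid, hx]
      exact abs_le.2 ⟨by linarith, by linarith⟩)
  rw [measureReal_restrict_apply_univ, volume_real_interior] at h
  exact hv.abs_le_of_sq_le (half_pos (hx_pos T)).le h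

theorem IsDominated.abs_integral_mul_yMid_le (hv : IsDominated u T c v) :
    |∫ p in interior T, v p * (p.2 - yMid T)| ≤ hy T / 2 * c * scaledSeminorm u T := by
  have h := sq_integral_mul_le hv.2.1 (g := fun p => p.2 - yMid T) (K := hy T / 2) (by fun_prop)
    (ae_restrict_of_forall_mem (measurableSet_interior T) fun p hp => by
      obtain ⟨hlo, hhi⟩ := mapsTo_snd_interior T hp
      simp only [yMid, hy]
      exact abs_le.2 ⟨by linarith, by linarith⟩)
  rw [measureReal_restrict_apply_univ, volume_real_interior] at h
  exact hv.abs_le_of_sq_le (half_pos (hy_pos T)).le h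

theorem IsWeakDeriv.abs_integral_mul_xMid_le (h : IsWeakDeriv (interior T) 1 0 v v')
    (hv : MemLp v 2 (volume.restrict (interior T))) (hv' : IsDominated u T c v') :
    |∫ p in interior T, v p * (p.1 - xMid T)| ≤ hx T ^ 2 / 8 * c * scaledSeminorm u T := by
  obtain ⟨l, r, hlr⟩ := h.exists_hasEndIntegrals_fst (x_lt T) (y_lt T) hv
  have hsq := hlr.sq_integral_mul_sub_le (measurableSet_interior T) measurable_fst
    (mapsTo_fst_interior T) hv h.1
  rw [volume_real_interior] at hsq
  exact hv'.abs_le_of_sq_le (by positivity) hsq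

theorem IsWeakDeriv.abs_integral_mul_yMid_le (h : IsWeakDeriv (interior T) 0 1 v v')
    (hv : MemLp v 2 (volume.restrict (interior T))) (hv' : IsDominated u T c v') :
    |∫ p in interior T, v p * (p.2 - yMid T)| ≤ hy T ^ 2 / 8 * c * scaledSeminorm u T := by
  obtain ⟨l, r, hlr⟩ := h.exists_hasEndIntegrals_snd (x_lt T) (y_lt T) hv
  have hsq := hlr.sq_integral_mul_sub_le (measurableSet_interior T) measurable_snd
    (mapsTo_snd_interior T) hv h.1
  rw [volume_real_interior] at hsq
  exact hv'.abs_le_of_sq_le (by positivity) hsq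

theorem IsWeakDeriv.abs_integral_mul_xMid_sub_le (h : IsWeakDeriv (interior T) 1 0 v v')
    (h' : IsWeakDeriv (interior T) 1 0 v' v'') (hv : MemLp v 2 (volume.restrict (interior T)))
    (hv'' : IsDominated u T c v'') :
    |(∫ p in interior T, v p * (p.1 - xMid T)) - hx T ^ 2 / 12 * ∫ p in interior T, v' p|
      ≤ hx T ^ 3 / 48 * c * scaledSeminorm u T := by
  obtain ⟨l, r, hlr⟩ := h.exists_hasEndIntegrals_fst (x_lt T) (y_lt T) hv
  obtain ⟨l', r', hlr'⟩ := h'.exists_hasEndIntegrals_fst (x_lt T) (y_lt T) h.1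
  have hsq := hlr.sq_integral_mul_sub_sub_le (measurableSet_interior T) measurable_fst
    (mapsTo_fst_interior T) hv h.1 h'.1 hlr'
  rw [volume_real_interior] at hsq
  exact hv''.abs_le_of_sq_le (div_nonneg (pow_nonneg (hx_pos T).le 3) (by norm_num)) hsq

theorem IsWeakDeriv.abs_integral_mul_yMid_sub_le (h : IsWeakDeriv (interior T) 0 1 v v')
    (h' : IsWeakDeriv (interior T) 0 1 v' v'') (hv : MemLp v 2 (volume.restrict (interior T)))
    (hv'' : IsDominated u T c v'') :
    |(∫ p in interior T, v p * (p.2 - yMid T)) - hy T ^ 2 / 12 * ∫ p in interior T, v' p|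
      ≤ hy T ^ 3 / 48 * c * scaledSeminorm u T := by
  obtain ⟨l, r, hlr⟩ := h.exists_hasEndIntegrals_snd (x_lt T) (y_lt T) hv
  obtain ⟨l', r', hlr'⟩ := h'.exists_hasEndIntegrals_snd (x_lt T) (y_lt T) h.1
  have hsq := hlr.sq_integral_mul_sub_sub_le (measurableSet_interior T) measurable_snd
    (mapsTo_snd_interior T) hv h.1 h'.1 hlr'
  rw [volume_real_interior] at hsq
  exact hv''.abs_le_of_sq_le (div_nonneg (pow_nonneg (hy_pos T).le 3) (by norm_num)) hsq

end Moments

/-! ### The correction -/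

section Traces

variable {v q q' : ℝ × ℝ → ℝ} {t₀ t₁ : ℝ}

theorem HasTraceMean.hasEndIntegrals_fst_interior
    (h₀ : HasTraceMean (interior T) (seg (edge T 0)) v t₀)
    (h₁ : HasTraceMean (interior T) (seg (edge T 1)) v t₁)
    (hvq : v =ᵐ[volume.restrict (interior T)] q) (hq : IsWeakDeriv (interior T) 1 0 q q') :
    HasEndIntegrals (interior T) Prod.fst (M.x T.1.castSucc) (M.x T.1.succ) q q'
      (hy T * t₀) (hy T * t₁) := by
  have hv := hq.congr hvq.symm
  exact (HasTraceMean.hasEndIntegrals_fst (x_lt T) (y_lt T) (measurableSet_interior T) subset_rfl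
    h₀ h₁).congr hvq (hv.weakDeriv.ae_eq (isOpen_interior T) hv)

theorem HasTraceMean.hasEndIntegrals_snd_interior
    (h₀ : HasTraceMean (interior T) (seg (edge T 2)) v t₀)
    (h₁ : HasTraceMean (interior T) (seg (edge T 3)) v t₁)
    (hvq : v =ᵐ[volume.restrict (interior T)] q) (hq : IsWeakDeriv (interior T) 0 1 q q') :
    HasEndIntegrals (interior T) Prod.snd (M.y T.2.castSucc) (M.y T.2.succ) q q'
      (hx T * t₀) (hx T * t₁) := by
  have hv := hq.congr hvq.symm
  exact (HasTraceMean.hasEndIntegrals_snd (x_lt T) (y_lt T) (measurableSet_interior T) subset_rfl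
    h₀ h₁).congr hvq (hv.weakDeriv.ae_eq (isOpen_interior T) hv)

end Traces

theorem IsCorrection.exists_vertical (hw : IsCorrection ρ a u w) (hρ : ρ ≠ 0)
    (hu : MemH 3 Omega u) (T : M.Elem) : ∃ r₀ r₁ t₀ t₁,
      HasEndIntegrals (interior T) Prod.fst (M.x T.1.castSucc) (M.x T.1.succ)
        (weakDeriv Omega 0 2 u) (weakDeriv Omega 1 2 u) r₀ r₁ ∧
      HasEndIntegrals (interior T) Prod.fst (M.x T.1.castSucc) (M.x T.1.succ)
        (fluxDy a u T) (fluxDxy a u T 1) t₀ t₁ ∧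
      w (edge T 0) = M.h⁻¹ / 12 * (hy T * M.h⁻¹ * r₀ - 6 * ρ⁻¹ * t₀) ∧
      w (edge T 1) = M.h⁻¹ / 12 * (hy T * M.h⁻¹ * r₁ - 6 * ρ⁻¹ * t₁) := by
  obtain ⟨r₀, t₀, hr₀, ht₀, hw₀⟩ := (hw T).1 0 (Or.inl rfl)
  obtain ⟨r₁, t₁, hr₁, ht₁, hw₁⟩ := (hw T).1 1 (Or.inr rfl)
  have hq := isWeakDeriv_fluxDy hu T a
  have hlen₀ : (seg (edge T 0)).len = hy T := rfl
  have hlen₁ : (seg (edge T 1)).len = hy T := rfl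
  refine ⟨_, _, _, _,
    hr₀.hasEndIntegrals_fst_interior hr₁ ae_eq_rfl (hu.isWeakDeriv_interior_left T (by norm_num)),
    ht₀.hasEndIntegrals_fst_interior ht₁ (hq.weakDeriv.ae_eq (isOpen_interior T) hq)
      (isWeakDeriv_fluxDxy_one hu T a), ?_, ?_⟩
  · rw [hw₀, hlen₀]
    linear_combination M.h⁻¹ ^ 2 * hy T ^ 2 * r₀ / 12 * inv_mul_cancel₀ hρ
  · rw [hw₁, hlen₁]
    linear_combination M.h⁻¹ ^ 2 * hy T ^ 2 * r₁ / 12 * inv_mul_cancel₀ hρ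

theorem IsCorrection.exists_horizontal (hw : IsCorrection ρ a u w) (hρ : ρ ≠ 0)
    (hu : MemH 3 Omega u) (T : M.Elem) : ∃ r₀ r₁ t₀ t₁,
      HasEndIntegrals (interior T) Prod.snd (M.y T.2.castSucc) (M.y T.2.succ)
        (weakDeriv Omega 2 0 u) (weakDeriv Omega 2 1 u) r₀ r₁ ∧
      HasEndIntegrals (interior T) Prod.snd (M.y T.2.castSucc) (M.y T.2.succ)
        (fluxDx a u T) (fluxDxy a u T 0) t₀ t₁ ∧
      w (edge T 2) = M.h⁻¹ / 12 * (hx T * M.h⁻¹ * r₀ - 6 * ρ⁻¹ * t₀) ∧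
      w (edge T 3) = M.h⁻¹ / 12 * (hx T * M.h⁻¹ * r₁ - 6 * ρ⁻¹ * t₁) := by
  obtain ⟨r₀, t₀, hr₀, ht₀, hw₀⟩ := (hw T).2 2 (Or.inl rfl)
  obtain ⟨r₁, t₁, hr₁, ht₁, hw₁⟩ := (hw T).2 3 (Or.inr rfl)
  have hq := isWeakDeriv_fluxDx hu T a
  have hlen₂ : (seg (edge T 2)).len = hx T := rfl
  have hlen₃ : (seg (edge T 3)).len = hx T := rfl
  refine ⟨_, _, _, _,
    hr₀.hasEndIntegrals_snd_interior hr₁ ae_eq_rfl (hu.isWeakDeriv_interior_right T (by norm_num)),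
    ht₀.hasEndIntegrals_snd_interior ht₁ (hq.weakDeriv.ae_eq (isOpen_interior T) hq)
      (isWeakDeriv_fluxDxy_zero hu T a), ?_, ?_⟩
  · rw [hw₀, hlen₂]
    linear_combination M.h⁻¹ ^ 2 * hx T ^ 2 * r₀ / 12 * inv_mul_cancel₀ hρ
  · rw [hw₁, hlen₃]
    linear_combination M.h⁻¹ ^ 2 * hx T ^ 2 * r₁ / 12 * inv_mul_cancel₀ hρ

theorem IsCorrection.area_mul_weakGrad_zero (hw : IsCorrection ρ a u w) (hρ : ρ ≠ 0)
    (hu : MemH 3 Omega u) (T : M.Elem) :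
    area T * weakGrad w T 0 = hy T * M.h⁻¹ / 12 *
      (hy T * M.h⁻¹ * (∫ p in interior T, weakDeriv Omega 1 2 u p)
        - 6 * ρ⁻¹ * ∫ p in interior T, fluxDxy a u T 1 p) := by
  obtain ⟨r₀, r₁, t₀, t₁, hr, ht, hw₀, hw₁⟩ := hw.exists_vertical hρ hu T
  have hgrad := hx_mul_weakGrad w T
  rw [hw₀, hw₁] at hgrad
  rw [area, ← hr.sub_eq, ← ht.sub_eq]
  linear_combination hy T * hgrad

theorem IsCorrection.area_mul_weakGrad_one (hw : IsCorrection ρ a u w) (hρ : ρ ≠ 0)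
    (hu : MemH 3 Omega u) (T : M.Elem) :
    area T * weakGrad w T 1 = hx T * M.h⁻¹ / 12 *
      (hx T * M.h⁻¹ * (∫ p in interior T, weakDeriv Omega 2 1 u p)
        - 6 * ρ⁻¹ * ∫ p in interior T, fluxDxy a u T 0 p) := by
  obtain ⟨r₀, r₁, t₀, t₁, hr, ht, hw₂, hw₃⟩ := hw.exists_horizontal hρ hu T
  have hgrad := hy_mul_weakGrad w T
  rw [hw₂, hw₃] at hgrad
  rw [area, ← hr.sub_eq, ← ht.sub_eq]
  linear_combination hx T * hgrad

theorem IsCorrection.half_add_mul_hx (hw : IsCorrection ρ a u w) (hρ : ρ ≠ 0)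
    (hu : MemH 3 Omega u) (T : M.Elem) :
    (w (edge T 0) + w (edge T 1)) / 2 * hx T = M.h⁻¹ / 12 *
      (hy T * M.h⁻¹ * ((∫ p in interior T, weakDeriv Omega 0 2 u p)
          + ∫ p in interior T, weakDeriv Omega 1 2 u p * (p.1 - xMid T))
        - 6 * ρ⁻¹ * ((∫ p in interior T, fluxDy a u T p)
          + ∫ p in interior T, fluxDxy a u T 1 p * (p.1 - xMid T))) := by
  obtain ⟨r₀, r₁, t₀, t₁, hr, ht, hw₀, hw₁⟩ := hw.exists_vertical hρ hu T
  rw [← hr.half_add_mul_hx (hu.memLp_weakDeriv_interior T (by norm_num))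
      (hu.memLp_weakDeriv_interior T (by norm_num)),
    ← ht.half_add_mul_hx (isWeakDeriv_fluxDy hu T a).1 (isWeakDeriv_fluxDxy_one hu T a).1, hw₀, hw₁]
  ring

theorem IsCorrection.half_add_mul_hy (hw : IsCorrection ρ a u w) (hρ : ρ ≠ 0)
    (hu : MemH 3 Omega u) (T : M.Elem) :
    (w (edge T 2) + w (edge T 3)) / 2 * hy T = M.h⁻¹ / 12 *
      (hx T * M.h⁻¹ * ((∫ p in interior T, weakDeriv Omega 2 0 u p)
          + ∫ p in interior T, weakDeriv Omega 2 1 u p * (p.2 - yMid T))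
        - 6 * ρ⁻¹ * ((∫ p in interior T, fluxDx a u T p)
          + ∫ p in interior T, fluxDxy a u T 0 p * (p.2 - yMid T))) := by
  obtain ⟨r₀, r₁, t₀, t₁, hr, ht, hw₂, hw₃⟩ := hw.exists_horizontal hρ hu T
  rw [← hr.half_add_mul_hy (hu.memLp_weakDeriv_interior T (by norm_num))
      (hu.memLp_weakDeriv_interior T (by norm_num)),
    ← ht.half_add_mul_hy (isWeakDeriv_fluxDx hu T a).1 (isWeakDeriv_fluxDxy_zero hu T a).1,
    hw₂, hw₃]
  ring

-- The correction cancels the terms `|e|² ∫ ∂_y² u / 12` and `|e| ∫ ∂_y q₂` and their mirror images.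
theorem IsCorrection.stabResidual_eq (hw : IsCorrection ρ a u w) (hρ : ρ ≠ 0)
    (hu : MemH 3 Omega u) (hQ : IsEdgeProjection u Qu) (T : M.Elem) :
    stabResidual ρ a u Qu w T =
      2 * (ρ * M.h⁻¹) * ((∫ p in interior T, weakDeriv Omega 1 0 u p * (p.1 - xMid T))
          - hx T ^ 2 / 12 * ∫ p in interior T, weakDeriv Omega 2 0 u p)
        - 2 * (ρ * M.h⁻¹) * ((∫ p in interior T, weakDeriv Omega 0 1 u p * (p.2 - yMid T))
          - hy T ^ 2 / 12 * ∫ p in interior T, weakDeriv Omega 0 2 u p)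
        + ρ * M.h⁻¹ * hy T ^ 2 / 6 * (∫ p in interior T, weakDeriv Omega 1 2 u p * (p.1 - xMid T))
        - ρ * M.h⁻¹ * hx T ^ 2 / 6 * (∫ p in interior T, weakDeriv Omega 2 1 u p * (p.2 - yMid T))
        - hy T * (∫ p in interior T, fluxDxy a u T 1 p * (p.1 - xMid T))
        + hx T * ∫ p in interior T, fluxDxy a u T 0 p * (p.2 - yMid T) := by
  have hh : M.h ≠ 0 := (h_pos M).ne'
  have hdefect : area T * (hx T + hy T) * defect w T
      = hy T * ((w (edge T 0) + w (edge T 1)) / 2 * hx T)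
        - hx T * ((w (edge T 2) + w (edge T 3)) / 2 * hy T) := by
    rw [area]
    linear_combination (hx T * hy T) * defect_mul_add w T
  rw [hw.half_add_mul_hx hρ hu, hw.half_add_mul_hy hρ hu] at hdefect
  rw [stabResidual, defect_add_smul, mul_add, hQ.area_mul_defect hu,
    mul_left_comm _ (M.h ^ 2), hdefect]
  field_simp
  ring

/-! ### The error estimate -/

theorem MemH.abs_integral_weakDeriv_mul_xMid_sub_le (hu : MemH 3 Omega u) (T : M.Elem) :
    |(∫ p in interior T, weakDeriv Omega 1 0 u p * (p.1 - xMid T))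
        - hx T ^ 2 / 12 * ∫ p in interior T, weakDeriv Omega 2 0 u p|
      ≤ hx T ^ 3 / 48 * scaledSeminorm u T := by
  simpa only [mul_one] using
    (hu.isWeakDeriv_interior_left T (by norm_num)).abs_integral_mul_xMid_sub_le
      (hu.isWeakDeriv_interior_left T (by norm_num)) (hu.memLp_weakDeriv_interior T (by norm_num))
      (hu.isDominated_weakDeriv T (α := 3) (by norm_num))

theorem MemH.abs_integral_weakDeriv_mul_yMid_sub_le (hu : MemH 3 Omega u) (T : M.Elem) :
    |(∫ p in interior T, weakDeriv Omega 0 1 u p * (p.2 - yMid T))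
        - hy T ^ 2 / 12 * ∫ p in interior T, weakDeriv Omega 0 2 u p|
      ≤ hy T ^ 3 / 48 * scaledSeminorm u T := by
  simpa only [mul_one] using
    (hu.isWeakDeriv_interior_right T (by norm_num)).abs_integral_mul_yMid_sub_le
      (hu.isWeakDeriv_interior_right T (by norm_num)) (hu.memLp_weakDeriv_interior T (by norm_num))
      (hu.isDominated_weakDeriv T (α := 0) (by norm_num))

theorem hx_add_hy_le (T : M.Elem) : hx T + hy T ≤ 2 * M.h := by
  linarith [hx_le_h T, hy_le_h T]

theorem abs_mul_le_of_nonneg {c t b : ℝ} (hc : 0 ≤ c) (h : |t| ≤ b) : |c * t| ≤ c * b := by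
  rw [abs_mul, abs_of_nonneg hc]
  exact mul_le_mul_of_nonneg_left h hc

theorem IsCorrection.abs_stabResidual_le_cubes (hw : IsCorrection ρ a u w) (hρ : 0 < ρ)
    (hu : MemH 3 Omega u) (hQ : IsEdgeProjection u Qu) (ha : ∀ i j, |a T i j| ≤ L) :
    |stabResidual ρ a u Qu w T|
      ≤ (ρ * M.h⁻¹ * ((hx T ^ 3 + hy T ^ 3) / 24 + hx T * hy T * (hx T + hy T) / 12)
        + 2 * L * (hx T * hy T)) * scaledSeminorm u T := by
  have hX := (hx_pos T).le
  have hY := (hy_pos T).le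
  have hk : 0 ≤ ρ * M.h⁻¹ := mul_nonneg hρ.le (inv_nonneg.2 (h_pos M).le)
  have hu₁₀ := abs_mul_le_of_nonneg (c := 2 * (ρ * M.h⁻¹)) (by positivity)
    (hu.abs_integral_weakDeriv_mul_xMid_sub_le T)
  have hu₀₁ := abs_mul_le_of_nonneg (c := 2 * (ρ * M.h⁻¹)) (by positivity)
    (hu.abs_integral_weakDeriv_mul_yMid_sub_le T)
  have hu₁₂ := abs_mul_le_of_nonneg (c := ρ * M.h⁻¹ * hy T ^ 2 / 6) (by positivity)
    (hu.isDominated_weakDeriv T (α := 1) (by norm_num)).abs_integral_mul_xMid_le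
  have hu₂₁ := abs_mul_le_of_nonneg (c := ρ * M.h⁻¹ * hx T ^ 2 / 6) (by positivity)
    (hu.isDominated_weakDeriv T (α := 2) (by norm_num)).abs_integral_mul_yMid_le
  have hq₁ := abs_mul_le_of_nonneg hY (hu.isDominated_fluxDxy (ha 1)).abs_integral_mul_xMid_le
  have hq₀ := abs_mul_le_of_nonneg hX (hu.isDominated_fluxDxy (ha 0)).abs_integral_mul_yMid_le
  rw [hw.stabResidual_eq hρ.ne' hu hQ]
  rw [abs_le] at hu₁₀ hu₀₁ hu₁₂ hu₂₁ hq₁ hq₀ ⊢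
  constructor <;> linarith

theorem IsCorrection.abs_stabResidual_le (hw : IsCorrection ρ a u w) (hρ : 0 < ρ)
    (hu : MemH 3 Omega u) (hQ : IsEdgeProjection u Qu) (ha : ∀ i j, |a T i j| ≤ L) :
    |stabResidual ρ a u Qu w T| ≤ (ρ + L) * (hx T + hy T) ^ 2 * scaledSeminorm u T := by
  have hL : 0 ≤ L := (abs_nonneg _).trans (ha 0 0)
  have hX := hx_pos T
  have hY := hy_pos T
  have hh := h_pos M
  refine (hw.abs_stabResidual_le_cubes hρ hu hQ ha).trans
    (mul_le_mul_of_nonneg_right ?_ (scaledSeminorm_nonneg u T))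
  have hcubes : (hx T ^ 3 + hy T ^ 3) / 24 + hx T * hy T * (hx T + hy T) / 12
      ≤ (hx T + hy T) ^ 3 / 24 := by
    linarith [mul_pos (mul_pos hX hY) (add_pos hX hY)]
  calc _ ≤ ρ * M.h⁻¹ * ((hx T + hy T) ^ 2 * (2 * M.h) / 24) + 2 * L * ((hx T + hy T) ^ 2 / 4) := by
        gcongr
        · refine hcubes.trans ?_
          rw [pow_succ]
          gcongr
          exact hx_add_hy_le T
        · linarith [sq_nonneg (hx T - hy T)]
    _ = (ρ / 12 + L / 2) * (hx T + hy T) ^ 2 := by field_simp; ring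
    _ ≤ (ρ + L) * (hx T + hy T) ^ 2 := by gcongr <;> linarith

theorem IsCorrection.abs_area_mul_weakGrad_le (hw : IsCorrection ρ a u w) (hρ : 0 < ρ)
    (hu : MemH 3 Omega u) (ha : ∀ i j, |a T i j| ≤ L) (k : Fin 2) :
    |area T * weakGrad w T k| ≤ (1 / 12 + L * ρ⁻¹) * scaledSeminorm u T := by
  have hh := h_pos M
  have hL : 0 ≤ L := (abs_nonneg _).trans (ha 0 0)
  have hs := scaledSeminorm_nonneg u T
  have hbound {d I J : ℝ} (hd : 0 < d) (hdh : d ≤ M.h) (hI : |I| ≤ 1 * scaledSeminorm u T)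
      (hJ : |J| ≤ 2 * L * scaledSeminorm u T) : |d * M.h⁻¹ / 12 * (d * M.h⁻¹ * I - 6 * ρ⁻¹ * J)|
        ≤ (1 / 12 + L * ρ⁻¹) * scaledSeminorm u T := by
    have hratio : d * M.h⁻¹ ≤ 1 := by rwa [← div_eq_mul_inv, div_le_one hh]
    calc _ ≤ d * M.h⁻¹ / 12 * (d * M.h⁻¹ * (1 * scaledSeminorm u T)
          + 6 * ρ⁻¹ * (2 * L * scaledSeminorm u T)) :=
          abs_mul_le_of_nonneg (by positivity) <| (abs_sub _ _).trans <| add_le_add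
            (abs_mul_le_of_nonneg (by positivity) hI) (abs_mul_le_of_nonneg (by positivity) hJ)
      _ ≤ 1 / 12 * (1 * (1 * scaledSeminorm u T) + 6 * ρ⁻¹ * (2 * L * scaledSeminorm u T)) := by
          gcongr
      _ = (1 / 12 + L * ρ⁻¹) * scaledSeminorm u T := by ring
  match k with
  | 0 =>
    rw [hw.area_mul_weakGrad_zero hρ.ne' hu]
    exact hbound (hy_pos T) (hy_le_h T)
      (hu.isDominated_weakDeriv T (α := 1) (by norm_num)).abs_integral_le
      (hu.isDominated_fluxDxy (ha 1)).abs_integral_le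
  | 1 =>
    rw [hw.area_mul_weakGrad_one hρ.ne' hu]
    exact hbound (hx_pos T) (hx_le_h T)
      (hu.isDominated_weakDeriv T (α := 2) (by norm_num)).abs_integral_le
      (hu.isDominated_fluxDxy (ha 0)).abs_integral_le

theorem IsCorrection.abs_area_mul_mulVec_weakGrad_le (hw : IsCorrection ρ a u w) (hρ : 0 < ρ)
    (hu : MemH 3 Omega u) (ha : ∀ i j, |a T i j| ≤ L) (i : Fin 2) :
    |area T * (a T).mulVec (weakGrad w T) i|
      ≤ 2 * L * (1 / 12 + L * ρ⁻¹) * scaledSeminorm u T := by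
  have hterm (j : Fin 2) : |a T i j * (area T * weakGrad w T j)|
      ≤ L * ((1 / 12 + L * ρ⁻¹) * scaledSeminorm u T) := by
    rw [abs_mul]
    exact mul_le_mul (ha i j) (hw.abs_area_mul_weakGrad_le hρ hu ha j) (abs_nonneg _)
      ((abs_nonneg _).trans (ha i j))
  calc |area T * (a T).mulVec (weakGrad w T) i|
      = |a T i 0 * (area T * weakGrad w T 0) + a T i 1 * (area T * weakGrad w T 1)| := by
        rw [Matrix.mulVec, dotProduct, Fin.sum_univ_two]
        ring_nf
    _ ≤ L * ((1 / 12 + L * ρ⁻¹) * scaledSeminorm u T)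
          + L * ((1 / 12 + L * ρ⁻¹) * scaledSeminorm u T) :=
        (abs_add_le _ _).trans (add_le_add (hterm 0) (hterm 1))
    _ = 2 * L * (1 / 12 + L * ρ⁻¹) * scaledSeminorm u T := by ring

theorem IsCorrection.abs_gradResidual_le (hw : IsCorrection ρ a u w) (hρ : 0 < ρ)
    (hu : MemH 3 Omega u) (ha : ∀ i j, |a T i j| ≤ L) (k : Fin 2) :
    |gradResidual a u w T k| ≤ 2 * L * (1 + L * ρ⁻¹) * M.h ^ 2 * scaledSeminorm u T := by
  have hL : 0 ≤ L := (abs_nonneg _).trans (ha 0 0)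
  have hs := scaledSeminorm_nonneg u T
  have hbound {d I : ℝ} (hd : 0 < d) (hdh : d ≤ M.h)
      (hI : |I| ≤ d ^ 2 / 8 * (2 * L) * scaledSeminorm u T) (i : Fin 2) :
      |I + M.h ^ 2 * area T * (a T).mulVec (weakGrad w T) i|
        ≤ 2 * L * (1 + L * ρ⁻¹) * M.h ^ 2 * scaledSeminorm u T := by
    rw [mul_assoc (M.h ^ 2)]
    calc _ ≤ d ^ 2 / 8 * (2 * L) * scaledSeminorm u T
            + M.h ^ 2 * (2 * L * (1 / 12 + L * ρ⁻¹) * scaledSeminorm u T) :=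
          (abs_add_le _ _).trans <| add_le_add hI <| abs_mul_le_of_nonneg (sq_nonneg _) <|
            hw.abs_area_mul_mulVec_weakGrad_le hρ hu ha i
      _ ≤ M.h ^ 2 / 8 * (2 * L) * scaledSeminorm u T
            + M.h ^ 2 * (2 * L * (1 / 12 + L * ρ⁻¹) * scaledSeminorm u T) := by gcongr
      _ = 2 * L * (5 / 24 + L * ρ⁻¹) * M.h ^ 2 * scaledSeminorm u T := by ring
      _ ≤ _ := by gcongr; norm_num
  match k with
  | 0 =>
    exact hbound (hx_pos T) (hx_le_h T) ((isWeakDeriv_fluxDxy_one hu T a).abs_integral_mul_xMid_le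
      (isWeakDeriv_fluxDy hu T a).1 (hu.isDominated_fluxDxy (ha 1))) 0
  | 1 =>
    exact hbound (hy_pos T) (hy_le_h T) ((isWeakDeriv_fluxDxy_zero hu T a).abs_integral_mul_yMid_le
      (isWeakDeriv_fluxDx hu T a).1 (hu.isDominated_fluxDxy (ha 0))) 1

theorem mul_le_of_abs_le_scaledSeminorm {K ε r : ℝ} (hε : 0 < ε)
    (hr : |r| ≤ K * scaledSeminorm u T) (x : ℝ) :
    r * x ≤ ε / 2 * (area T * x ^ 2) + K ^ 2 / (2 * ε) * thirdSq u T := by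
  have hP := area_pos T
  have hsq : r ^ 2 ≤ K ^ 2 * (area T * thirdSq u T) := by
    rw [← scaledSeminorm_sq, ← mul_pow, ← sq_abs]
    gcongr
  have hyoung : r * x ≤ ε / 2 * (area T * x ^ 2) + r ^ 2 / (2 * ε * area T) := by
    have hsquare : 0 ≤ (ε * area T * x - r) ^ 2 / (2 * ε * area T) := by positivity
    have hexpand : (ε * area T * x - r) ^ 2 / (2 * ε * area T)
        = ε / 2 * (area T * x ^ 2) + r ^ 2 / (2 * ε * area T) - r * x := by field_simp; ring
    linarith
  calc r * x ≤ ε / 2 * (area T * x ^ 2) + r ^ 2 / (2 * ε * area T) := hyoung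
    _ ≤ ε / 2 * (area T * x ^ 2) + K ^ 2 * (area T * thirdSq u T) / (2 * ε * area T) := by gcongr
    _ = ε / 2 * (area T * x ^ 2) + K ^ 2 / (2 * ε) * thirdSq u T := by field_simp

/-- The constant `C₀` in the estimate
`λ/2 ‖∇_d e_b‖² + 1/2 |||S(e_b) - e_b|||² ≤ C₀ h⁴ ‖u‖₃²` of the error `e_b`. -/
def errorConst (ρ lam Lam : ℝ) : ℝ :=
  4 * Lam ^ 2 * (1 + Lam * ρ⁻¹) ^ 2 / lam + 4 * (ρ ^ 2 + Lam ^ 2) / ρ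

theorem errorConst_pos (hρ : 0 < ρ) (hlam : 0 < lam) (Lam : ℝ) : 0 < errorConst ρ lam Lam := by
  rw [errorConst]
  positivity

theorem IsCorrection.residual_le (hw : IsCorrection ρ a u w) (hρ : 0 < ρ) (hlam : 0 < lam)
    (hu : MemH 3 Omega u) (hQ : IsEdgeProjection u Qu) (ha : ∀ i j, |a T i j| ≤ L)
    (vb : M.Edge → ℝ) :
    gradResidual a u w T ⬝ᵥ weakGrad vb T + stabResidual ρ a u Qu w T * defect vb T
      ≤ lam / 2 * (area T * (weakGrad vb T ⬝ᵥ weakGrad vb T))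
        + ρ * M.h⁻¹ * (area T * (hx T + hy T) * (defect vb T * defect vb T))
        + errorConst ρ lam L * M.h ^ 4 * thirdSq u T := by
  have hh := h_pos M
  have hl : 0 < hx T + hy T := add_pos (hx_pos T) (hy_pos T)
  have hε : 0 < 2 * (ρ * M.h⁻¹) * (hx T + hy T) := by positivity
  have hgrad (k : Fin 2) := mul_le_of_abs_le_scaledSeminorm hlam
    (hw.abs_gradResidual_le hρ hu ha k) (weakGrad vb T k)
  have hstab := mul_le_of_abs_le_scaledSeminorm hε (hw.abs_stabResidual_le hρ hu hQ ha)
    (defect vb T)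
  have hconst : ((ρ + L) * (hx T + hy T) ^ 2) ^ 2 / (2 * (2 * (ρ * M.h⁻¹) * (hx T + hy T)))
      ≤ 4 * (ρ ^ 2 + L ^ 2) / ρ * M.h ^ 4 := by
    calc _ = (ρ + L) ^ 2 * M.h / (4 * ρ) * (hx T + hy T) ^ 3 := by field_simp; ring
      _ ≤ (ρ + L) ^ 2 * M.h / (4 * ρ) * (2 * M.h) ^ 3 := by gcongr; exact hx_add_hy_le T
      _ = 2 * (ρ + L) ^ 2 / ρ * M.h ^ 4 := by field_simp; ring
      _ ≤ 2 * (2 * (ρ ^ 2 + L ^ 2)) / ρ * M.h ^ 4 := by gcongr; exact add_sq_le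
      _ = 4 * (ρ ^ 2 + L ^ 2) / ρ * M.h ^ 4 := by ring
  grw [hconst] at hstab
  · rw [dotProduct, dotProduct, Fin.sum_univ_two, Fin.sum_univ_two, errorConst]
    refine (add_le_add (add_le_add (hgrad 0) (hgrad 1)) hstab).trans_eq ?_
    field_simp
    ring
  · exact thirdSq_nonneg u T

theorem IsCoeff.mul_gradNorm_sq_le (ha : IsCoeff lam Lam a) (vb : M.Edge → ℝ) :
    lam * gradNorm vb ^ 2 ≤ gradForm a vb vb := by
  rw [gradNorm_sq, gradForm, Finset.mul_sum]
  refine Finset.sum_le_sum fun T _ => ?_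
  rw [mul_left_comm]
  exact mul_le_mul_of_nonneg_left ((ha T).2 _).1 (area_pos T).le

theorem IsCorrection.sum_residual_le (hw : IsCorrection ρ a u w) (hρ : 0 < ρ) (hlam : 0 < lam)
    (ha : IsCoeff lam Lam a) (hu : MemH 3 Omega u) (hQ : IsEdgeProjection u Qu)
    (vb : M.Edge → ℝ) :
    ∑ T : M.Elem, (gradResidual a u w T ⬝ᵥ weakGrad vb T + stabResidual ρ a u Qu w T * defect vb T)
      ≤ lam / 2 * gradNorm vb ^ 2 + 1 / 2 * stabNorm ρ vb ^ 2
        + errorConst ρ lam Lam * M.h ^ 4 * sobolevNorm 3 Omega u ^ 2 := by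
  have hC := errorConst_pos hρ hlam Lam
  calc _ ≤ ∑ T : M.Elem, (lam / 2 * (area T * (weakGrad vb T ⬝ᵥ weakGrad vb T))
        + ρ * M.h⁻¹ * (area T * (hx T + hy T) * (defect vb T * defect vb T))
        + errorConst ρ lam Lam * M.h ^ 4 * thirdSq u T) :=
        Finset.sum_le_sum fun T _ => hw.residual_le hρ hlam hu hQ (ha.abs_entry_le hlam.le T) vb
    _ = lam / 2 * gradNorm vb ^ 2 + 1 / 2 * stabNorm ρ vb ^ 2
        + errorConst ρ lam Lam * M.h ^ 4 * ∑ T : M.Elem, thirdSq u T := by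
      rw [gradNorm_sq, stabNorm_sq hρ, stabForm]
      simp only [Finset.sum_add_distrib, Finset.mul_sum]
      ring_nf
    _ ≤ _ := by grw [sum_thirdSq_le hu]

theorem IsWGSolution.energy_error_le (ha : IsCoeff lam Lam a) (hρ : 0 < ρ) (hlam : 0 < lam)
    (hf : MemLp f 2 (volume.restrict Omega)) (hu : MemH 3 Omega u) (hs : IsSolution a f g u)
    (hw : IsCorrection ρ a u w) (hQ : IsEdgeProjection u Qu) {uh : WeakFun M}
    (huh : IsWGSolution ρ a f (fun e => (seg e).mean g + M.h ^ 2 * w e) uh) :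
    lam / 2 * gradNorm (Qu + M.h ^ 2 • w - uh.vb) ^ 2
        + 1 / 2 * stabNorm ρ (Qu + M.h ^ 2 • w - uh.vb) ^ 2
      ≤ errorConst ρ lam Lam * M.h ^ 4 * sobolevNorm 3 Omega u ^ 2 := by
  set eb := Qu + M.h ^ 2 • w - uh.vb with heb
  have hbdry : ∀ e, IsBdry e → eb e = 0 := fun e he => by
    simp only [heb, Pi.sub_apply, Pi.add_apply, Pi.smul_apply, smul_eq_mul, huh.1 e he,
      hQ.eq_mean_of_isBdry hs.2 he, sub_self]
  have herror := (huh.error_eq (Qu + M.h ^ 2 • w) hbdry).trans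
    (hs.sum_residual hf hu hQ ρ w hbdry)
  rw [← heb, ← stabNorm_sq hρ] at herror
  linarith [ha.mul_gradNorm_sq_le eb, hw.sum_residual_le hρ hlam ha hu hQ eb]

theorem add_le_of_sq_add_sq_le {G S X lam K : ℝ} (hlam : 0 < lam) (hX : 0 ≤ X)
    (h : lam / 2 * G ^ 2 + 1 / 2 * S ^ 2 ≤ K * X ^ 2) :
    G + S ≤ (√(2 * K / lam) + √(2 * K)) * X := by
  have hG : G ≤ √(2 * K / lam * X ^ 2) := Real.le_sqrt_of_sq_le <| by
    rw [div_mul_eq_mul_div, le_div_iff₀ hlam]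
    linarith [sq_nonneg S]
  have hS : S ≤ √(2 * K * X ^ 2) := Real.le_sqrt_of_sq_le <| by
    linarith [mul_nonneg hlam.le (sq_nonneg G)]
  rw [Real.sqrt_mul' _ (sq_nonneg X), Real.sqrt_sq hX] at hG hS
  linarith

end Estimate

end WG

end

theorem mainTheorem1 (ρ lam Lam : ℝ) (hρ : 0 < ρ) (hlam : 0 < lam) :
    ∃ C : ℝ, 0 < C ∧
      ∀ (M : WG.Mesh) (a : M.Elem → Matrix (Fin 2) (Fin 2) ℝ), WG.IsCoeff lam Lam a →
      ∀ f g u : ℝ × ℝ → ℝ, MemLp f 2 (volume.restrict WG.Omega) →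
        WG.MemH 3 WG.Omega u → WG.IsSolution a f g u →
      ∀ w : M.Edge → ℝ, WG.IsCorrection ρ a u w →
      ∀ uh : WG.WeakFun M,
        WG.IsWGSolution ρ a f (fun e => (WG.Mesh.seg e).mean g + M.h ^ 2 * w e) uh →
      ∀ Qu : M.Edge → ℝ, WG.IsEdgeProjection u Qu →
        WG.gradNorm (fun e => Qu e + M.h ^ 2 * w e - uh.vb e)
            + WG.stabNorm ρ (fun e => Qu e + M.h ^ 2 * w e - uh.vb e)
          ≤ C * M.h ^ 2 * WG.sobolevNorm 3 WG.Omega u := by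
  have hC := WG.errorConst_pos hρ hlam Lam
  refine ⟨√(2 * WG.errorConst ρ lam Lam / lam) + √(2 * WG.errorConst ρ lam Lam), by positivity, ?_⟩
  intro M a ha f g u hf hu hs w hw uh huh Qu hQ
  have henergy := huh.energy_error_le ha hρ hlam hf hu hs hw hQ
  rw [show M.h ^ 4 = (M.h ^ 2) ^ 2 by ring, mul_assoc, ← mul_pow] at henergy
  rw [mul_assoc]
  exact WG.add_le_of_sq_add_sq_le hlam (mul_nonneg (sq_nonneg _) (Real.sqrt_nonneg _)) henergy
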